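/- **Setting.** Let $\mathscr K\subset\mathbb R^m$ be open, connected and non-empty, $\mathscr M=\mathbb R\times\mathbb R^n\times\mathscr K$ with coordinates $x=(t,q,w)$, let $f:\mathscr M\to\mathbb R^n$ be real analytic, and consider the control system $\dot q=f(t,q,w)$. A *completed graph* is a finite composition of real analytic regular arcs in $\mathscr M$ (analytic up to the endpoints), each being either a *solution arc* $t\mapsto(t,q(t),w(t))$, $t\in[a,b]$, $a<b$, with $\dot q=f(t,q,w)$, or a *vertical arc*, along which $t$ and $q$ are constant; the first and the last arc must be solution arcs. For $T>0$ and $x_o=(t_o,q_o,w_o)\in\mathscr M$, $\operatorname{Attain}^{(T)}(x_o)$ is the set of final points, with time coordinate $t_o+T$, of completed graphs starting at $x_o$. A *section* on an open set $\Omega\subset\mathscr M$ is a real analytic vector field on $\Omega$ of the form $S=\frac{\partial}{\partial t}+f^i\frac{\partial}{\partial q^i}+\mu^\alpha\frac{\partial}{\partial w^\alpha}$. Flows $\Phi^X_s$ are defined wherever the integral curves of $X$ exist inside the domain of $X$. The *surrogate field* of $S$ with depth $\tau$ and constants $\lambda^\alpha\in\mathbb R$ is $\Phi^S_{\tau*}\big(\lambda^\alpha\frac{\partial}{\partial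 w^\alpha}\big)$; its domain is the set of points where $\Phi^S_{-\tau}$ is defined. The *secondary distribution* $(V^{II},\mathscr D^{II})$ is given by the smallest family $V^{II}$ of local real analytic vector fields that is closed under sums and multiplication by real analytic functions and contains all vertical real analytic fields $Z=\zeta^\alpha\frac{\partial}{\partial w^\alpha}$ and all iterated brackets $[Y_1,[Y_2,\dots,[Y_r,Z]\dots]]$ with sections $Y_1,\dots,Y_r$, and by $\mathscr D^{II}_x=\{X_x: X\in V^{II}\}$. For a section $S$, let $V^{II}_S$ be the family of the finite combinations, with real analytic coefficients, of the fields $[S,[S,\dots,[S,\frac{\partial}{\partial w^\alpha}]\dots]]$ ($k\ge0$ brackets), and $\mathscr D^{II}_{S}$ the corresponding family of spaces. A *set of generators* on $U$ for a family $V$ of local fields is a finite tuple $X_1,\dots,X_N$ of fields of $V$ on $U$ such that every field of $V$ on an open subset $U'\subset U$ is $\sum_i g^iX_i$ with real analytic $g^i:U'\to\mathbb R$. **Theorem A.** Let $T>0$, $x_o=(t_o,q_o,w_o)\in\mathscr M$ and $y_o\in\operatorname{Attain}^{(T)}(x_o)$. Let $\gamma$ be the last solution arc of a completed graph from $x_o$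 to $y_o$, and let $\delta T\in(0,T)$ be so small that the times in $[t_o+T-\delta T,t_o+T]$ belong to this arc. Then: (0) There is a section $S$, on an open set $\Omega$ containing $\gamma([t_o+T-\delta T,t_o+T])$, such that this part of $\gamma$ is an integral curve of $S$. (1) Let $S$ be any section as in (0), let $\delta T>\tau_1>\dots>\tau_p>0$, let $\lambda_j\in\mathbb R^m$ and $Y_j=\Phi^{S}_{\tau_j*}\big(\lambda_j^\alpha\frac{\partial}{\partial w^\alpha}\big)$. Then there are $\varepsilon_j>0$ such that $\Phi^{Y_p}_{s_p}\circ\dots\circ\Phi^{Y_1}_{s_1}(y_o)$ is defined if $|s_j|<\varepsilon_j$ for all $j$; and $\operatorname{Attain}^{(T)}(x_o)$ contains this point for all $s_1,\dots,s_p$ for which it is defined. (2) For every section $S$ on an open set, every $\tau\in(0,T)$ and every $\lambda\in\mathbb R^m$, the surrogate field $\Phi^{S}_{\tau*}\big(\lambda^\alpha\frac{\partial}{\partial w^\alpha}\big)$ takes values in $\mathscr D^{II}$; more precisely, it takes values in $\mathscr D^{II}_{S}$. (3) There is a neighbourhood $U_0$ of $y_o$ such that, for every open $U$ with $y_o\in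 U\subset U_0$, $V^{II}$ has a set of generators on $U$ which consists of surrogate fields (of finitely many sections) defined on $U$, with depths in $(0,\delta T)$. Moreover, for each section $S$ on an open set containing $y_o$, there is a neighbourhood $U_0$ of $y_o$ such that, for every open $U$ with $y_o\in U\subset U_0$, $V^{II}_S$ has a set of generators on $U$ which consists of surrogate fields of the single section $S$ defined on $U$, with depths $\delta T>\tau_1>\dots>\tau_N>0$. -/

import Mathlib

open Set

namespace CtrlSys

/-- The ambient vector space `ℝ × ℝⁿ × ℝᵐ` of triples (time, state, control). -/
abbrev Ext (n m : ℕ) : Type := ℝ × (Fin n → ℝ) × (Fin m → ℝ)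

variable {n m : ℕ}

/-- The extended space-time `ℝ × ℝⁿ × K`, as an open subset of `ℝ × ℝⁿ × ℝᵐ`. -/
def extSpace (n : ℕ) {m : ℕ} (K : Set (Fin m → ℝ)) : Set (Ext n m) := {x | x.2.2 ∈ K}

/-! ### Completed graphs and attainable points -/

/-- `t ↦ (t, q t, w t)`, for `t` between the times of `x` and `y`, is the graph of a real analytic
solution of `q' = f (t, q, w)` with controls in `K`, going from `x` to `y`. The time interval is
non-trivial. Analyticity is up to the endpoints. -/
def IsSolutionArc (f : Ext n m → (Fin n → ℝ)) (K : Set (Fin m → ℝ)) (x y : Ext n m)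
    (q : ℝ → (Fin n → ℝ)) (w : ℝ → (Fin m → ℝ)) : Prop :=
  x.1 < y.1 ∧
  AnalyticOnNhd ℝ q (Icc x.1 y.1) ∧ AnalyticOnNhd ℝ w (Icc x.1 y.1) ∧
  (∀ t ∈ Icc x.1 y.1, w t ∈ K ∧ HasDerivAt q (f (t, q t, w t)) t) ∧
  x = (x.1, q x.1, w x.1) ∧ y = (y.1, q y.1, w y.1)

/-- A regular real analytic arc from `x` to `y` along which time and state are constant and the
control moves in `K`. -/
def IsVerticalArc (K : Set (Fin m → ℝ)) (x y : Ext n m) (w : ℝ → (Fin m → ℝ)) : Prop :=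
  x.1 = y.1 ∧ x.2.1 = y.2.1 ∧
  AnalyticOnNhd ℝ w (Icc 0 1) ∧ (∀ s ∈ Icc (0 : ℝ) 1, w s ∈ K ∧ deriv w s ≠ 0) ∧
  w 0 = x.2.2 ∧ w 1 = y.2.2

/-- `x 0, x 1, …, x (k + 1)` are the consecutive vertices of a completed graph with `k + 1` regular
real analytic arcs: each arc is a solution arc or a vertical arc, and the first and the last one
are solution arcs. -/
def IsCompletedGraph (f : Ext n m → (Fin n → ℝ)) (K : Set (Fin m → ℝ)) (k : ℕ)
    (x : ℕ → Ext n m) : Prop :=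
  (∃ q w, IsSolutionArc f K (x 0) (x 1) q w) ∧
  (∃ q w, IsSolutionArc f K (x k) (x (k + 1)) q w) ∧
  ∀ i ≤ k, (∃ q w, IsSolutionArc f K (x i) (x (i + 1)) q w) ∨
    (∃ w, IsVerticalArc K (x i) (x (i + 1)) w)

/-- The set of final points of completed graphs that start at `xo` and last for the time `T`. -/
def Attain (f : Ext n m → (Fin n → ℝ)) (K : Set (Fin m → ℝ)) (T : ℝ) (xo : Ext n m) :
    Set (Ext n m) :=
  {y | y.1 = xo.1 + T ∧ ∃ (k : ℕ) (x : ℕ → Ext n m),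
    IsCompletedGraph f K k x ∧ x 0 = xo ∧ x (k + 1) = y}

/-- The solution arc `t ↦ (t, q t, w t)`, `c ≤ t ≤ (time of yo)`, is the last arc of a completed
graph from `xo` to `yo`. -/
def IsFinalArc (f : Ext n m → (Fin n → ℝ)) (K : Set (Fin m → ℝ)) (xo yo : Ext n m) (c : ℝ)
    (q : ℝ → (Fin n → ℝ)) (w : ℝ → (Fin m → ℝ)) : Prop :=
  ∃ (k : ℕ) (x : ℕ → Ext n m), IsCompletedGraph f K k x ∧ x 0 = xo ∧ x (k + 1) = yo ∧
    (x k).1 = c ∧ IsSolutionArc f K (x k) yo q w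

/-! ### Flows and push-forwards of vector fields -/

/-- The integral curve of `X` in `D` that starts at `x` is defined up to the parameter `s` (of
either sign), and it is at `y` for that parameter: `y = Φ^X_s (x)`. -/
def FlowsTo (D : Set (Ext n m)) (X : Ext n m → Ext n m) (s : ℝ) (x y : Ext n m) : Prop :=
  ∃ c : ℝ → Ext n m, c 0 = x ∧ c s = y ∧
    ∀ r ∈ uIcc 0 s, c r ∈ D ∧ HasDerivWithinAt c (X (c r)) (uIcc 0 s) r

/-- The domain of `Φ^X_s` for the vector field `X` on `D`. -/
def flowDom (D : Set (Ext n m)) (X : Ext n m → Ext n m) (s : ℝ) : Set (Ext n m) :=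
  {x | ∃ y, FlowsTo D X s x y}

open Classical in
/-- The map `Φ^X_s` for the vector field `X` on `D` (the identity outside `flowDom D X s`). -/
noncomputable def flowMap (D : Set (Ext n m)) (X : Ext n m → Ext n m) (s : ℝ) (x : Ext n m) :
    Ext n m :=
  if h : ∃ y, FlowsTo D X s x y then h.choose else x

/-- The pushed-forward field `(Φ^X_τ)_* Z`, for the vector field `X` on `D`. It is
meaningful at the points of `flowDom D X (-τ)`. -/
noncomputable def pushFlow (D : Set (Ext n m)) (X : Ext n m → Ext n m) (τ : ℝ)
    (Z : Ext n m → Ext n m) (y : Ext n m) : Ext n m :=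
  fderiv ℝ (flowMap D X τ) (flowMap D X (-τ) y) (Z (flowMap D X (-τ) y))

/-- `y = Φ^{Y_p}_{s_p} ∘ … ∘ Φ^{Y_1}_{s_1} (x)`, where `Y_j` is a vector field on `D_j`. -/
def IsComposite {p : ℕ} (D : Fin p → Set (Ext n m)) (Y : Fin p → Ext n m → Ext n m)
    (s : Fin p → ℝ) (x y : Ext n m) : Prop :=
  ∃ z : Fin (p + 1) → Ext n m, z 0 = x ∧ z (Fin.last p) = y ∧
    ∀ j : Fin p, FlowsTo (D j) (Y j) (s j) (z j.castSucc) (z j.succ)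

/-! ### Sections, surrogate fields and secondary distributions -/

/-- The vertical vector field `λ^α ∂/∂w^α` with constant coefficients. -/
def vert (lam : Fin m → ℝ) (_ : Ext n m) : Ext n m := (0, 0, lam)

/-- `S` is a real analytic vector field on the open set `Ω` of the extended space-time which is
equal to `∂/∂t + f^i ∂/∂q^i` modulo the fields `∂/∂w^α`. -/
def IsSection (f : Ext n m → (Fin n → ℝ)) (K : Set (Fin m → ℝ)) (Ω : Set (Ext n m))
    (S : Ext n m → Ext n m) : Prop :=
  IsOpen Ω ∧ Ω ⊆ extSpace n K ∧ AnalyticOnNhd ℝ S Ω ∧ ∀ x ∈ Ω, (S x).1 = 1 ∧ (S x).2.1 = f x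

/-- `S` is a section on `Ω` and the curve `t ↦ (t, q t, w t)`, `a ≤ t ≤ b`, is an integral curve
of `S` in `Ω`. -/
def IsAdaptedSection (f : Ext n m → (Fin n → ℝ)) (K : Set (Fin m → ℝ))
    (q : ℝ → (Fin n → ℝ)) (w : ℝ → (Fin m → ℝ)) (a b : ℝ) (Ω : Set (Ext n m))
    (S : Ext n m → Ext n m) : Prop :=
  IsSection f K Ω S ∧ ∀ t ∈ Icc a b, (t, q t, w t) ∈ Ω ∧
    HasDerivAt (fun r => ((r, q r, w r) : Ext n m)) (S (t, q t, w t)) t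

/-- The surrogate field `(Φ^S_τ)_* (λ^α ∂/∂w^α)` of the section `S` on `Ω`. -/
noncomputable def surrogate (Ω : Set (Ext n m)) (S : Ext n m → Ext n m) (τ : ℝ)
    (lam : Fin m → ℝ) : Ext n m → Ext n m :=
  pushFlow Ω S τ (vert lam)

/-- The domain of the surrogate fields `(Φ^S_τ)_* (λ^α ∂/∂w^α)`. -/
def surrogateDom (Ω : Set (Ext n m)) (S : Ext n m → Ext n m) (τ : ℝ) : Set (Ext n m) :=
  flowDom Ω S (-τ)

/-- On `U`, the field `Y` is a finite combination of fields of the set `G`, with real analytic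
coefficients. -/
def IsCombination (G : Set (Ext n m → Ext n m)) (U : Set (Ext n m)) (Y : Ext n m → Ext n m) :
    Prop :=
  ∃ (N : ℕ) (X : Fin N → Ext n m → Ext n m) (g : Fin N → Ext n m → ℝ),
    (∀ i, X i ∈ G) ∧ (∀ i, AnalyticOnNhd ℝ (g i) U) ∧ ∀ x ∈ U, Y x = ∑ i, g i x • X i x

/-- The real analytic vertical fields `Z` on `U`, and the iterated brackets
`[Y₁, [Y₂, …, [Y_r, Z]…]]` with sections `Y₁, …, Y_r` on `U`. -/
inductive IterBracket (f : Ext n m → (Fin n → ℝ)) (K : Set (Fin m → ℝ)) (U : Set (Ext n m)) :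
    (Ext n m → Ext n m) → Prop
  | vertical (Z : Ext n m → Ext n m) (hZ : AnalyticOnNhd ℝ Z U)
      (hv : ∀ x ∈ U, (Z x).1 = 0 ∧ (Z x).2.1 = 0) : IterBracket f K U Z
  | bracket (S X : Ext n m → Ext n m) (hS : IsSection f K U S) (hX : IterBracket f K U X) :
      IterBracket f K U (VectorField.lieBracket ℝ S X)

/-- The family of vector fields `V^{II}` of the secondary distribution: `Y` belongs to the smallest
family of fields on `U` which contains the fields `IterBracket f K U` and is closed under sums and
under multiplication by real analytic functions. -/
def Secondary (f : Ext n m → (Fin n → ℝ)) (K : Set (Fin m → ℝ)) (U : Set (Ext n m))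
    (Y : Ext n m → Ext n m) : Prop :=
  IsCombination {X | IterBracket f K U X} U Y

/-- The iterated bracket `[S, [S, …, [S, ∂/∂w^α]…]]`, with `k` brackets. -/
noncomputable def adField (S : Ext n m → Ext n m) (k : ℕ) (α : Fin m) : Ext n m → Ext n m :=
  (fun X => VectorField.lieBracket ℝ S X)^[k] (vert (Pi.single α 1))

/-- The family of vector fields, on open subsets `U` of the domain of the section `S`, which is
generated by `∂/∂w^α` and by the iterated brackets with `S` only. -/
def SecondaryOf (S : Ext n m → Ext n m) (U : Set (Ext n m)) (Y : Ext n m → Ext n m) : Prop :=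
  IsCombination {X | ∃ k α, X = adField S k α} U Y

/-- The set of values at `y` of the local vector fields of the family `V`. -/
def fibre (K : Set (Fin m → ℝ)) (V : Set (Ext n m) → (Ext n m → Ext n m) → Prop) (y : Ext n m) :
    Set (Ext n m) :=
  {v | ∃ (U : Set (Ext n m)) (Y : Ext n m → Ext n m),
    IsOpen U ∧ U ⊆ extSpace n K ∧ y ∈ U ∧ V U Y ∧ Y y = v}

/-- The tuple `X` is a set of generators on `U` for the family of local vector fields `V`. -/
def IsGeneratingTuple (V : Set (Ext n m) → (Ext n m → Ext n m) → Prop) (U : Set (Ext n m)) {N : ℕ}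
    (X : Fin N → Ext n m → Ext n m) : Prop :=
  (∀ i, V U (X i)) ∧
  ∀ U' : Set (Ext n m), IsOpen U' → U' ⊆ U → ∀ Y, V U' Y →
    ∃ g : Fin N → Ext n m → ℝ, (∀ i, AnalyticOnNhd ℝ (g i) U') ∧
      ∀ x ∈ U', Y x = ∑ i, g i x • X i x

end CtrlSys

open CtrlSys

/-! The surrogate field of depth τ is the image of a constant vertical field λ under Φ^S_τ, so its
flow is a conjugated translation: go back along S for the time τ, move by sλ in the controls, come
forward again (`FlowsTo.flowMap_neg_surrogate`). Decreasing depths make these detours compatible: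
after the j-th vertical move one comes forward only as far as the depth τ_{j+1}, where the next
vertical move is made. The result is a completed graph of the same duration, and it ends with a
solution arc because τ_p > 0 (`mem_attain_of_isComposite`). This is (1).

For (2), the derivative in t of Φ_{t*}Z is -Φ_{t*}[S,Z] (`hasDerivAt_pushFlow`). A linear form that
kills all iterated brackets of S with ∂/∂w at y therefore kills every derivative at t = 0 of t ↦
Φ_{t*}(∂/∂w^α) at y, and by analyticity it kills the surrogate fields at y (`surrogate_mem_span`).

For (3) the ring of germs of analytic functions is Noetherian, by Weierstrass division and induction
on the dimension. Hence finitely many iterated brackets of S generate the others near a point, and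
their push-forwards are given by the transition matrix of a linear differential equation
(`exists_pushFlow_eq_sum`). This equation is of companion type, so the rows that represent surrogate
fields span at arbitrarily small times. A suitable choice of depths gives an invertible matrix,
which expresses the brackets by surrogate fields (`exists_surrogates_locSpan`).

The family V^{II} also contains brackets with several different sections. They reduce to brackets
with one section at a time: if V is vertical, all the fields S + c e^{rt} V are sections, and
comparing coefficients of c and r in their iterated brackets isolates [V, ad_S^k ∂/∂w]
(`apply_pow_mem_of_perturbations`, `lieBracket_adField_mem_locSpan`). Thus the surrogates of all
sections generate V^{II} as germs, and by the Noetherian property finitely many of them suffice.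

A statement on germs gives a neighbourhood that may shrink with each further bracket. To have one
neighbourhood for all brackets, only finitely many relations are taken from germs, namely the
stability of the chosen generators under brackets with one section and with the ∂/∂w^α. The rest
follows from the Leibniz rule on any smaller open set, whether or not it contains y_o. -/

open Filter Topology

namespace CtrlSys

/-! ### Shift operators on bounded sequences -/

section Shift

open scoped ENNReal

/-- The Banach space of bounded real sequences, viewed as coefficients of power series. -/
def Coeffs : Type := lp (fun _ : ℕ => ℝ) ∞

noncomputable instance : NormedAddCommGroup Coeffs :=
  inferInstanceAs (NormedAddCommGroup (lp (fun _ : ℕ => ℝ) ∞))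

noncomputable instance : NormedSpace ℝ Coeffs :=
  inferInstanceAs (NormedSpace ℝ (lp (fun _ : ℕ => ℝ) ∞))

instance : CompleteSpace Coeffs := inferInstanceAs (CompleteSpace (lp (fun _ : ℕ => ℝ) ∞))

/-- The sequence underlying a bounded sequence. -/
def Coeffs.seq (a : Coeffs) : ℕ → ℝ := a.1

instance : CoeFun Coeffs (fun _ => ℕ → ℝ) := ⟨Coeffs.seq⟩

@[ext] lemma Coeffs.ext {a b : Coeffs} (h : ∀ k, a k = b k) : a = b := Subtype.ext (funext h)

lemma abs_coeff_le (a : Coeffs) (k : ℕ) : ‖a k‖ ≤ ‖a‖ :=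
  lp.norm_apply_le_norm (E := fun _ : ℕ => ℝ) (p := ∞) (by simp) a k

/-- A sequence with an explicit bound, as an element of the space of bounded sequences. -/
def Coeffs.mk (a : ℕ → ℝ) (C : ℝ) (h : ∀ k, ‖a k‖ ≤ C) : Coeffs :=
  ⟨a, memℓp_infty ⟨C, by rintro _ ⟨k, rfl⟩; exact h k⟩⟩

lemma Coeffs.norm_le {a : Coeffs} {C : ℝ} (hC : 0 ≤ C) (h : ∀ k, ‖a k‖ ≤ C) : ‖a‖ ≤ C :=
  lp.norm_le_of_forall_le (E := fun _ : ℕ => ℝ) (f := a) hC h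

@[simp] lemma Coeffs.zero_apply (k : ℕ) : (0 : Coeffs) k = 0 := rfl

/-- The coefficient of index `k`. -/
noncomputable def coeff (k : ℕ) : Coeffs →L[ℝ] ℝ :=
  LinearMap.mkContinuous
    { toFun := fun a => a k
      map_add' := fun _ _ => rfl
      map_smul' := fun _ _ => rfl } 1 (fun a => by rw [one_mul]; exact abs_coeff_le a k)

/-- Multiplication of a power series by the variable. -/
noncomputable def shiftRight : Coeffs →L[ℝ] Coeffs :=
  LinearMap.mkContinuous
    { toFun := fun a => Coeffs.mk (fun k => Nat.casesOn k 0 (fun j => a j)) ‖a‖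
        (by rintro (_ | k); · simp
            · exact abs_coeff_le a k)
      map_add' := by intro a b; ext (_ | k); exacts [(add_zero (0 : ℝ)).symm, rfl]
      map_smul' := by intro c a; ext (_ | k); exacts [(mul_zero c).symm, rfl] } 1
    (by
      intro a
      rw [one_mul]
      refine Coeffs.norm_le (norm_nonneg a) ?_
      rintro (_ | k)
      · exact (norm_zero (E := ℝ)).trans_le (norm_nonneg a)
      · exact abs_coeff_le a k)

@[simp] lemma shiftRight_zero (a : Coeffs) : shiftRight a 0 = 0 := rfl

@[simp] lemma shiftRight_succ (a : Coeffs) (k : ℕ) : shiftRight a (k + 1) = a k := rfl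

lemma norm_shiftRight_le : ‖shiftRight‖ ≤ 1 := LinearMap.mkContinuous_norm_le _ zero_le_one _

/-- Removal of the constant term of a power series, followed by division by the variable. -/
noncomputable def shiftLeft : Coeffs →L[ℝ] Coeffs :=
  LinearMap.mkContinuous
    { toFun := fun a => Coeffs.mk (fun k => a (k + 1)) ‖a‖ (fun k => abs_coeff_le a (k + 1))
      map_add' := by intro a b; ext k; rfl
      map_smul' := by intro c a; ext k; rfl } 1
    (by
      intro a
      rw [one_mul]
      exact Coeffs.norm_le (norm_nonneg a) fun k => abs_coeff_le a (k + 1))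

@[simp] lemma shiftLeft_apply (a : Coeffs) (k : ℕ) : shiftLeft a k = a (k + 1) := rfl

lemma norm_shiftLeft_le : ‖shiftLeft‖ ≤ 1 := LinearMap.mkContinuous_norm_le _ zero_le_one _

lemma shiftLeft_pow_apply (j k : ℕ) (a : Coeffs) : ((shiftLeft ^ j) a) k = a (k + j) := by
  induction j generalizing k with
  | zero => rfl
  | succ j ih =>
    rw [pow_succ', mul_apply_eq_comp, shiftLeft_apply, ih]
    exact congrArg (fun i => coeff i a) (by omega)

lemma shiftLeft_mul_shiftRight : shiftLeft * shiftRight = 1 := by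
  ext a k; simp

lemma shiftLeft_pow_mul_shiftRight_pow (b : ℕ) : shiftLeft ^ b * shiftRight ^ b = 1 := by
  induction b with
  | zero => simp
  | succ b ih =>
    rw [pow_succ, pow_succ', mul_assoc, ← mul_assoc shiftLeft, shiftLeft_mul_shiftRight, one_mul, ih]

/-- The value at `θ` of the power series with the given coefficients. -/
noncomputable def evalSeries (θ : ℝ) : Coeffs →L[ℝ] ℝ :=
  coeff 0 ∘L Ring.inverse (1 - θ • shiftLeft)

lemma isUnit_one_sub_smul_shiftLeft {θ : ℝ} (hθ : |θ| < 1) :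
    IsUnit (1 - θ • shiftLeft : Coeffs →L[ℝ] Coeffs) := by
  refine isUnit_one_sub_of_norm_lt_one ?_
  rw [norm_smul, Real.norm_eq_abs]
  calc |θ| * ‖shiftLeft‖ ≤ |θ| * 1 := by gcongr; exact norm_shiftLeft_le
    _ < 1 := by simpa using hθ

/-- This is the resolvent identity for 1 - θ • `shiftLeft`, read on the constant coefficient. It
replaces the summation of the series everywhere below. -/
lemma evalSeries_eq {θ : ℝ} (hθ : |θ| < 1) (a : Coeffs) :
    evalSeries θ a = a 0 + θ * evalSeries θ (shiftLeft a) := by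
  have h := Ring.inverse_mul_cancel _ (isUnit_one_sub_smul_shiftLeft hθ)
  rw [mul_sub, mul_one, sub_eq_iff_eq_add] at h
  have h2 := congrArg (fun L : Coeffs →L[ℝ] Coeffs => (L a) 0) h
  simp only [add_apply, mul_apply_eq_comp, one_apply_eq_self, smul_apply, map_smul] at h2
  exact h2

lemma evalSeries_shiftRight {θ : ℝ} (hθ : |θ| < 1) (a : Coeffs) :
    evalSeries θ (shiftRight a) = θ * evalSeries θ a := by
  rw [evalSeries_eq hθ, shiftRight_zero, zero_add]
  rfl

lemma evalSeries_shiftRight_pow {θ : ℝ} (hθ : |θ| < 1) (k : ℕ) (a : Coeffs) :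
    evalSeries θ ((shiftRight ^ k) a) = θ ^ k * evalSeries θ a := by
  induction k with
  | zero => simp
  | succ k ih =>
    rw [pow_succ', mul_apply_eq_comp, evalSeries_shiftRight hθ, ih]; ring

lemma evalSeries_eq_sum {θ : ℝ} (hθ : |θ| < 1) (b : ℕ) (a : Coeffs) :
    evalSeries θ a = ∑ k : Fin b, a k * θ ^ (k : ℕ) + θ ^ b * evalSeries θ ((shiftLeft ^ b) a) := by
  induction b with
  | zero => simp
  | succ b ih =>
    rw [ih, evalSeries_eq hθ, shiftLeft_pow_apply, Fin.sum_univ_castSucc]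
    simp only [Fin.val_castSucc, Fin.val_last, zero_add]
    rw [pow_succ' shiftLeft, mul_apply_eq_comp]
    ring

/-- Inversion is analytic at a unit of a Banach algebra. Analyticity holds for the operator norm, so
that θ and the series can later vary together. -/
lemma analyticAt_evalSeries : AnalyticAt ℝ evalSeries 0 := by
  have h1 : AnalyticAt ℝ (fun θ : ℝ => (1 - θ • shiftLeft : Coeffs →L[ℝ] Coeffs)) 0 := by fun_prop
  have h2 : AnalyticAt ℝ (fun θ : ℝ => Ring.inverse (1 - θ • shiftLeft : Coeffs →L[ℝ] Coeffs)) 0 := by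
    refine AnalyticAt.fun_comp ?_ h1
    have e : (1 - (0 : ℝ) • shiftLeft : Coeffs →L[ℝ] Coeffs) =
        ((1 : (Coeffs →L[ℝ] Coeffs)ˣ) : Coeffs →L[ℝ] Coeffs) := by
      rw [zero_smul, sub_zero, Units.val_one]
    rw [e]
    exact analyticAt_inverse (𝕜 := ℝ) (1 : (Coeffs →L[ℝ] Coeffs)ˣ)
  exact ((ContinuousLinearMap.compL ℝ Coeffs Coeffs ℝ (coeff 0)).analyticAt _).fun_comp h2

/-- The coefficients are peeled off one at a time: the constant term is the value at 0, and what
remains is θ times the shifted series, which vanishes for θ ≠ 0 and hence near 0. -/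
lemma eq_zero_of_evalSeries_eq_zero {a : Coeffs} (h : ∀ᶠ θ in 𝓝 (0 : ℝ), evalSeries θ a = 0) :
    a = 0 := by
  have key : ∀ k : ℕ, ∀ᶠ θ in 𝓝 (0 : ℝ), evalSeries θ ((shiftLeft ^ k) a) = 0 ∧
      ((shiftLeft ^ k) a) 0 = 0 := by
    have step : ∀ c : Coeffs, (∀ᶠ θ in 𝓝 (0 : ℝ), evalSeries θ c = 0) →
        c 0 = 0 ∧ ∀ᶠ θ in 𝓝 (0 : ℝ), evalSeries θ (shiftLeft c) = 0 := by
      intro c hc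
      have h0 : c 0 = 0 := by
        have := evalSeries_eq (θ := 0) (by simp) c
        rw [hc.self_of_nhds] at this
        simpa using this.symm
      refine ⟨h0, ?_⟩
      have hne : ∀ᶠ θ in 𝓝[≠] (0 : ℝ), evalSeries θ (shiftLeft c) = 0 := by
        have h1 : ∀ᶠ θ in 𝓝 (0 : ℝ), |θ| < 1 := by
          have : Metric.ball (0 : ℝ) 1 ∈ 𝓝 (0 : ℝ) := Metric.ball_mem_nhds _ one_pos
          filter_upwards [this] with θ hθ using by simpa using hθ
        filter_upwards [hc.filter_mono nhdsWithin_le_nhds, h1.filter_mono nhdsWithin_le_nhds,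
          self_mem_nhdsWithin] with θ hθ hθ1 hθ0
        have := evalSeries_eq hθ1 c
        rw [hθ, h0, zero_add] at this
        exact (mul_eq_zero.1 this.symm).resolve_left hθ0
      have han : AnalyticAt ℝ (fun θ => evalSeries θ (shiftLeft c)) 0 :=
        ((ContinuousLinearMap.apply ℝ ℝ (shiftLeft c)).analyticAt _).fun_comp analyticAt_evalSeries
      exact (han.frequently_zero_iff_eventually_zero).1 hne.frequently
    intro k
    induction k with
    | zero => simpa using h.and (Eventually.of_forall fun _ => (step a h).1)
    | succ k ih =>
      have h1 := (step _ (ih.mono fun _ h => h.1)).2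
      rw [← mul_apply_eq_comp, ← pow_succ'] at h1
      exact h1.and (Eventually.of_forall fun _ => (step _ h1).1)
  ext k
  have := (key k).self_of_nhds.2
  rw [shiftLeft_pow_apply, zero_add] at this
  simpa using this

/-- Reduces an identity between operators on series to an identity between numbers, for all small θ.
-/
lemma operator_ext_of_evalSeries {L L' : Coeffs →L[ℝ] Coeffs}
    (h : ∀ᶠ θ in 𝓝 (0 : ℝ), ∀ a, evalSeries θ (L a) = evalSeries θ (L' a)) : L = L' := by
  ext1 a
  rw [← sub_eq_zero]
  refine eq_zero_of_evalSeries_eq_zero ?_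
  filter_upwards [h] with θ hθ
  rw [map_sub, hθ, sub_self]

end Shift

/-! ### Weierstrass division -/

section Division

variable {E F G : Type*} [NormedAddCommGroup E] [NormedSpace ℝ E] [NormedAddCommGroup F]
  [NormedSpace ℝ F] [NormedAddCommGroup G] [NormedSpace ℝ G]

lemma analyticAt_clm_apply {L : E → F →L[ℝ] G} {v : E → F} {x : E} (hL : AnalyticAt ℝ L x)
    (hv : AnalyticAt ℝ v x) : AnalyticAt ℝ (fun y => L y (v y)) x :=
  AnalyticAt.fun_comp (g := fun p : (F →L[ℝ] G) × F => p.1 p.2) (f := fun y => (L y, v y))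
    ((ContinuousLinearMap.id ℝ (F →L[ℝ] G)).analyticAt_bilinear (L x, v x)) (hL.prod hv)

/-- The power series obtained from a power series in `(x, z)` by substituting the operator
`z • shiftRight` for `z`. -/
noncomputable def operatorSeries (p : FormalMultilinearSeries ℝ (E × ℝ) ℝ) :
    FormalMultilinearSeries ℝ (E × ℝ) (Coeffs →L[ℝ] Coeffs) := fun k =>
  ∑ s : Finset (Fin k), ((p k).compContinuousLinearMap (fun i => if i ∈ s then
      (ContinuousLinearMap.inr ℝ E ℝ) ∘L (ContinuousLinearMap.snd ℝ E ℝ) else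
      (ContinuousLinearMap.inl ℝ E ℝ) ∘L (ContinuousLinearMap.fst ℝ E ℝ))).smulRight
    (shiftRight ^ s.card)

lemma norm_shiftRight_pow_le (k : ℕ) : ‖shiftRight ^ k‖ ≤ 1 := by
  rcases Nat.eq_zero_or_pos k with rfl | hk
  · rw [pow_zero]; exact ContinuousLinearMap.norm_id_le
  · exact (norm_pow_le' _ hk).trans (pow_le_one₀ (norm_nonneg _) norm_shiftRight_le)

/-- There are 2 ^ k subsets, each contributing at most ‖p k‖. The price of the substitution is half
of the radius of convergence. -/
lemma norm_operatorSeries_le (p : FormalMultilinearSeries ℝ (E × ℝ) ℝ) (k : ℕ) :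
    ‖operatorSeries p k‖ ≤ 2 ^ k * ‖p k‖ := by
  have : ∀ s ∈ (Finset.univ : Finset (Finset (Fin k))),
      ‖((p k).compContinuousLinearMap (fun i => if i ∈ s then
      (ContinuousLinearMap.inr ℝ E ℝ) ∘L (ContinuousLinearMap.snd ℝ E ℝ) else
      (ContinuousLinearMap.inl ℝ E ℝ) ∘L (ContinuousLinearMap.fst ℝ E ℝ))).smulRight
    (shiftRight ^ s.card)‖ ≤ ‖p k‖ := by
    intro s _
    rw [ContinuousMultilinearMap.norm_smulRight]
    refine (mul_le_of_le_one_right (norm_nonneg _) (norm_shiftRight_pow_le _)).trans ?_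
    refine (ContinuousMultilinearMap.norm_compContinuousLinearMap_le _ _).trans ?_
    refine mul_le_of_le_one_right (norm_nonneg _) (Finset.prod_le_one (fun _ _ => norm_nonneg _) ?_)
    intro i _
    split_ifs
    · refine ContinuousLinearMap.opNorm_le_bound _ zero_le_one fun x => ?_
      simpa using norm_snd_le x
    · refine ContinuousLinearMap.opNorm_le_bound _ zero_le_one fun x => ?_
      simpa using norm_fst_le x
  rw [operatorSeries]
  refine (norm_sum_le (E := ContinuousMultilinearMap ℝ (fun _ : Fin k => E × ℝ)
    (Coeffs →L[ℝ] Coeffs)) _ _).trans ((Finset.sum_le_sum this).trans ?_)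
  simp

/-- Expand p k at (x, 0) + θ(0, z) by multilinearity. The subset s of the slots filled with (0, z)
carries θ ^ |s|, which is the effect of `shiftRight` ^ |s| after evaluation. -/
lemma evalSeries_operatorSeries (p : FormalMultilinearSeries ℝ (E × ℝ) ℝ) (k : ℕ) (x : E) (z : ℝ)
    {θ : ℝ} (hθ : |θ| < 1) (a : Coeffs) :
    evalSeries θ (operatorSeries p k (fun _ => (x, z)) a) =
      p k (fun _ => (x, θ * z)) * evalSeries θ a := by
  have h1 : (fun _ : Fin k => ((x, θ * z) : E × ℝ)) =
      (fun _ => θ • ((0, z) : E × ℝ)) + (fun _ => ((x, 0) : E × ℝ)) := by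
    funext i; simp
  have h2 : operatorSeries p k (fun _ => (x, z)) a =
      ∑ s : Finset (Fin k), (p k (s.piecewise (fun _ => ((0, z) : E × ℝ)) (fun _ => (x, 0)))) •
        (shiftRight ^ s.card) a := by
    simp only [operatorSeries, sum_apply,
      ContinuousMultilinearMap.smulRight_apply, smul_apply,
      ContinuousMultilinearMap.compContinuousLinearMap_apply]
    refine Finset.sum_congr rfl fun s _ => ?_
    congr 2
    funext i
    by_cases hi : i ∈ s <;> simp [hi]
  rw [h1, ContinuousMultilinearMap.map_add_univ, h2, map_sum, Finset.sum_mul]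
  refine Finset.sum_congr rfl fun s _ => ?_
  rw [map_smul, evalSeries_shiftRight_pow hθ]
  have h3 : (p k) (s.piecewise (fun _ => θ • ((0, z) : E × ℝ)) (fun _ => (x, 0))) =
      θ ^ s.card * (p k) (s.piecewise (fun _ => ((0, z) : E × ℝ)) (fun _ => (x, 0))) := by
    have := (p k).map_piecewise_smul (fun _ => θ)
      (s.piecewise (fun _ => ((0, z) : E × ℝ)) (fun _ => (x, 0))) s
    rw [Finset.prod_const, smul_eq_mul] at this
    rw [← this]
    congr 1
    funext i
    by_cases hi : i ∈ s <;> simp [hi]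
  rw [h3, smul_eq_mul]; ring

/-- Substitution of the operator `z • shiftRight` for `z` in an analytic function of `(x, z)`. -/
lemma exists_operator_of_analyticAt {f : E × ℝ → ℝ} (hf : AnalyticAt ℝ f 0) :
    ∃ M : E × ℝ → Coeffs →L[ℝ] Coeffs, AnalyticAt ℝ M 0 ∧ ∃ r > 0, ∀ x z θ, ‖x‖ < r → |z| < r →
      |θ| < 1 → ∀ a, evalSeries θ (M (x, z) a) = f (x, θ * z) * evalSeries θ a := by
  obtain ⟨p, R, hp⟩ := hf
  obtain ⟨r, hr0, hr⟩ := ENNReal.lt_iff_exists_nnreal_btwn.1 hp.r_pos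
  have hr0' : 0 < r := by exact_mod_cast hr0
  obtain ⟨C, hC, hb⟩ := p.norm_mul_pow_le_of_lt_radius (hr.trans_le hp.r_le)
  have hrad : ((r / 2 : NNReal) : ENNReal) ≤ (operatorSeries p).radius := by
    refine FormalMultilinearSeries.le_radius_of_bound _ C fun k => ?_
    calc ‖operatorSeries p k‖ * ((r / 2 : NNReal) : ℝ) ^ k
        ≤ (2 ^ k * ‖p k‖) * ((r / 2 : NNReal) : ℝ) ^ k := by
          gcongr; exact norm_operatorSeries_le p k
      _ = ‖p k‖ * (r : ℝ) ^ k := by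
          rw [NNReal.coe_div, div_pow]; push_cast; field_simp
      _ ≤ C := hb k
  have hpos : 0 < (operatorSeries p).radius :=
    lt_of_lt_of_le (by exact_mod_cast half_pos hr0') hrad
  have hball := (operatorSeries p).hasFPowerSeriesOnBall hpos
  refine ⟨(operatorSeries p).sum, ⟨_, _, hball⟩, r / 2, by positivity, ?_⟩
  intro x z θ hx hz hθ a
  have hmem : ∀ y : E × ℝ, ‖y‖ < r / 2 → y ∈ Metric.eball (0 : E × ℝ) (operatorSeries p).radius := by
    intro y hy
    refine Metric.eball_subset_eball hrad ?_
    rw [Metric.mem_eball, edist_zero_right]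
    have : ‖y‖₊ < r / 2 := by exact_mod_cast hy
    exact_mod_cast this
  have h1 := hball.hasSum (hmem (x, z) (by
    rw [Prod.norm_def]; exact max_lt hx hz))
  rw [zero_add] at h1
  have h2 := ((evalSeries θ).hasSum (((ContinuousLinearMap.apply ℝ Coeffs a).hasSum h1)))
  simp only [ContinuousLinearMap.apply_apply,
    evalSeries_operatorSeries p _ x z hθ] at h2
  refine h2.unique ?_
  have h3 := hp.hasSum (y := (x, θ * z)) (by
    refine Metric.eball_subset_eball hr.le ?_
    rw [Metric.mem_eball, edist_zero_right]
    have : ‖(x, θ * z)‖ < r := by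
      rw [Prod.norm_def]
      refine max_lt (hx.trans (half_lt_self hr0')) ?_
      rw [norm_mul, Real.norm_eq_abs, Real.norm_eq_abs]
      calc |θ| * |z| ≤ 1 * |z| := by gcongr
        _ < r := by rw [one_mul]; exact hz.trans (half_lt_self hr0')
    have : ‖(x, θ * z)‖₊ < r := by exact_mod_cast this
    exact_mod_cast this)
  rw [zero_add] at h3
  exact h3.mul_right _

lemma eventually_abs_lt {r : ℝ} (hr : 0 < r) : ∀ᶠ z in 𝓝 (0 : ℝ), |z| < r := by
  filter_upwards [Metric.ball_mem_nhds (0 : ℝ) hr] with z hz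
  simpa using hz

lemma isUnit_smul_of_ne_zero {A : Type*} [Ring A] [Algebra ℝ A] {c : ℝ} (hc : c ≠ 0) {a : A}
    (ha : IsUnit a) : IsUnit (c • a) := by
  rw [Algebra.smul_def]
  exact ((IsUnit.mk0 c hc).map (algebraMap ℝ A)).mul ha

set_option maxHeartbeats 1000000 in
/-- The Weierstrass division theorem for real analytic functions. -/
theorem weierstrass_division {f : E × ℝ → ℝ} (hf : AnalyticAt ℝ f 0)
    (hf0 : ¬ ∀ᶠ z in 𝓝 (0 : ℝ), f (0, z) = 0) :
    ∃ b : ℕ, ∀ g : E × ℝ → ℝ, AnalyticAt ℝ g 0 → ∃ (q : E × ℝ → ℝ) (r : Fin b → E → ℝ),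
      AnalyticAt ℝ q 0 ∧ (∀ k, AnalyticAt ℝ (r k) 0) ∧
      ∀ᶠ y in 𝓝 (0 : E × ℝ), g y = q y * f y + ∑ k, r k y.1 * y.2 ^ (k : ℕ) := by
  have hfz : AnalyticAt ℝ (fun z : ℝ => f (0, z)) 0 := by
    refine AnalyticAt.fun_comp (g := f) (f := fun z : ℝ => ((0, z) : E × ℝ)) hf ?_
    exact analyticAt_const.prod analyticAt_id
  -- The degree b is the order of vanishing of f on the axis: f (0, z) = z ^ b u(z) with u(0) ≠ 0.
  obtain ⟨b, u, hu, hu0, hfu⟩ := hfz.exists_eventuallyEq_pow_smul_nonzero_iff.2 hf0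
  refine ⟨b, fun g hg => ?_⟩
  obtain ⟨Mf, hMf, rf, hrf, hevf⟩ := exists_operator_of_analyticAt hf
  obtain ⟨Mg, hMg, rg, hrg, hevg⟩ := exists_operator_of_analyticAt hg
  obtain ⟨Mu, hMu, ru, hru, hevu⟩ := exists_operator_of_analyticAt (E := E)
    (f := fun y : E × ℝ => u y.2) (AnalyticAt.fun_comp (g := u) hu analyticAt_snd)
  have hMu0 : Mu 0 = u 0 • 1 := by
    refine operator_ext_of_evalSeries ?_
    filter_upwards [eventually_abs_lt one_pos] with θ hθ a
    have := hevu 0 0 θ (by simpa using hru) (by simpa using hru) hθ a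
    rw [mul_zero] at this
    rw [show (0 : E × ℝ) = (0, 0) from rfl, this]
    simp
  -- The factorization of f on the axis becomes a factorization of operators, with `Mu` invertible
  -- near 0.
  have hMfz : ∀ᶠ z in 𝓝 (0 : ℝ), Mf (0, z) = z ^ b • (shiftRight ^ b * Mu (0, z)) := by
    obtain ⟨δ, hδ, hδu⟩ := Metric.eventually_nhds_iff.1 hfu
    filter_upwards [eventually_abs_lt hrf, eventually_abs_lt hru, eventually_abs_lt hδ]
      with z hzf hzu hzδ
    refine operator_ext_of_evalSeries ?_
    filter_upwards [eventually_abs_lt one_pos] with θ hθ a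
    rw [hevf 0 z θ (by simpa using hrf) hzf hθ, smul_apply, map_smul, mul_apply_eq_comp,
      evalSeries_shiftRight_pow hθ, hevu 0 z θ (by simpa using hru) hzu hθ, hδu]
    · simp only [sub_zero, smul_eq_mul, mul_pow]; ring
    · rw [Real.dist_eq, sub_zero, abs_mul]
      calc |θ| * |z| ≤ 1 * |z| := by gcongr
        _ < δ := by rwa [one_mul]
  have hcurve : Tendsto (fun z : ℝ => ((0, z) : E × ℝ)) (𝓝 0) (𝓝 0) := by
    have : Continuous (fun z : ℝ => ((0, z) : E × ℝ)) := by fun_prop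
    exact this.tendsto 0
  have hunit : ∀ᶠ z in 𝓝 (0 : ℝ), IsUnit (Mu (0, z)) := by
    have hu1 : IsUnit (Mu 0) := by
      rw [hMu0]
      exact isUnit_smul_of_ne_zero hu0 isUnit_one
    have : ∀ᶠ y in 𝓝 (0 : E × ℝ), IsUnit (Mu y) :=
      hMu.continuousAt.eventually (Units.isOpen.mem_nhds hu1)
    exact hcurve.eventually this
  -- From here on z = θρ with ρ fixed and |θ| < 1. It must not be 0, because ρ ^ b has to be
  -- invertible.
  obtain ⟨ρ, hρ0, hρ⟩ : ∃ ρ : ℝ, 0 < ρ ∧ (Mf (0, ρ) = ρ ^ b • (shiftRight ^ b * Mu (0, ρ)) ∧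
      IsUnit (Mu (0, ρ)) ∧ |ρ| < rf ∧ |ρ| < rg ∧ AnalyticAt ℝ Mf (0, ρ) ∧
      AnalyticAt ℝ Mg (0, ρ)) := by
    have hall := ((((hMfz.and hunit).and (eventually_abs_lt hrf)).and (eventually_abs_lt hrg)).and
      (hcurve.eventually hMf.eventually_analyticAt)).and
      (hcurve.eventually hMg.eventually_analyticAt)
    obtain ⟨ρ, h, h0⟩ := ((hall.filter_mono nhdsWithin_le_nhds).and
      (self_mem_nhdsWithin (a := (0 : ℝ)) (s := Set.Ioi 0))).exists
    exact ⟨ρ, h0, h.1.1.1.1.1, h.1.1.1.1.2, h.1.1.1.2, h.1.1.2, h.1.2, h.2⟩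
  obtain ⟨hMfρ, hMuρ, hρf, hρg, hMfan, hMgan⟩ := hρ
  have hins : AnalyticAt ℝ (fun x : E => ((x, ρ) : E × ℝ)) 0 := analyticAt_id.prod analyticAt_const
  have hA : AnalyticAt ℝ (fun x : E => Mf (x, ρ)) 0 :=
    AnalyticAt.fun_comp (g := Mf) (f := fun x : E => ((x, ρ) : E × ℝ)) hMfan hins
  have hB : AnalyticAt ℝ (fun x : E => Mg (x, ρ)) 0 :=
    AnalyticAt.fun_comp (g := Mg) (f := fun x : E => ((x, ρ) : E × ℝ)) hMgan hins
  -- Multiplication by f followed by removal of the terms of degree < b. It is invertible at x = 0,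
  -- hence near 0.
  set L : E → Coeffs →L[ℝ] Coeffs := fun x => shiftLeft ^ b * Mf (x, ρ) with hL
  have hLan : AnalyticAt ℝ L 0 := analyticAt_const.mul hA
  have hL0 : IsUnit (L 0) := by
    have : L 0 = ρ ^ b • Mu (0, ρ) := by
      simp only [hL]
      rw [hMfρ, mul_smul_comm, ← mul_assoc, shiftLeft_pow_mul_shiftRight_pow, one_mul]
    rw [this]
    exact isUnit_smul_of_ne_zero (pow_pos hρ0 b).ne' hMuρ
  let e0 : Coeffs := Coeffs.mk (fun k => if k = 0 then 1 else 0) 1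
    (by intro k; split_ifs <;> simp)
  have he0 : ∀ θ : ℝ, |θ| < 1 → evalSeries θ e0 = 1 := by
    intro θ hθ
    have hz : shiftLeft e0 = 0 := by
      ext k
      change (if k + 1 = 0 then (1 : ℝ) else 0) = 0
      simp
    rw [evalSeries_eq hθ, hz, map_zero, mul_zero, add_zero]
    rfl
  -- The only quotient for which g - q f has no terms of degree ≥ b: the series of g is `Mg (x, ρ)
  -- e0`, since `e0` is the constant series 1, and `L x` is inverted on its terms of degree ≥ b.
  set qh : E → Coeffs := fun x => Ring.inverse (L x) ((shiftLeft ^ b) (Mg (x, ρ) e0)) with hqh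
  have hinv : AnalyticAt ℝ (fun x => Ring.inverse (L x)) 0 := by
    refine AnalyticAt.fun_comp (g := Ring.inverse) ?_ hLan
    have := analyticAt_inverse (𝕜 := ℝ) hL0.unit
    rwa [IsUnit.unit_spec] at this
  have hqan : AnalyticAt ℝ qh 0 :=
    analyticAt_clm_apply hinv (((shiftLeft ^ b).analyticAt _).fun_comp
      (analyticAt_clm_apply hB analyticAt_const))
  set rh : E → Coeffs := fun x => Mg (x, ρ) e0 - Mf (x, ρ) (qh x) with hrh
  have hran : AnalyticAt ℝ rh 0 :=
    (analyticAt_clm_apply hB analyticAt_const).sub (analyticAt_clm_apply hA hqan)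
  have hrz : ∀ᶠ x in 𝓝 (0 : E), (shiftLeft ^ b) (rh x) = 0 := by
    have : ∀ᶠ x in 𝓝 (0 : E), IsUnit (L x) :=
      hLan.continuousAt.eventually (Units.isOpen.mem_nhds hL0)
    filter_upwards [this] with x hx
    have h1 : (shiftLeft ^ b) (Mf (x, ρ) (qh x)) = (L x * Ring.inverse (L x))
        ((shiftLeft ^ b) (Mg (x, ρ) e0)) := rfl
    rw [hrh, map_sub, h1, Ring.mul_inverse_cancel _ hx]
    simp
  have hdiv : AnalyticAt ℝ (fun y : E × ℝ => y.2 / ρ) 0 := by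
    simp only [div_eq_mul_inv]
    exact analyticAt_snd.mul analyticAt_const
  -- Back from θ to z = ρθ, which explains the powers of ρ⁻¹ in the remainder.
  refine ⟨fun y => evalSeries (y.2 / ρ) (qh y.1), fun k x => rh x k * (ρ⁻¹) ^ (k : ℕ), ?_, ?_, ?_⟩
  · refine analyticAt_clm_apply (L := fun y : E × ℝ => evalSeries (y.2 / ρ))
      (AnalyticAt.fun_comp (g := evalSeries) ?_ hdiv) (AnalyticAt.fun_comp (g := qh) hqan analyticAt_fst)
    simpa using analyticAt_evalSeries
  · intro k
    exact (((coeff k).analyticAt _).fun_comp hran).mul analyticAt_const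
  · have e1 : ∀ᶠ y in 𝓝 (0 : E × ℝ), (shiftLeft ^ b) (rh y.1) = 0 :=
      (continuous_fst.tendsto (0 : E × ℝ)).eventually hrz
    have e2 : ∀ᶠ y in 𝓝 (0 : E × ℝ), ‖y.1‖ < min rf rg := by
      have : Tendsto (fun y : E × ℝ => ‖y.1‖) (𝓝 0) (𝓝 0) := by
        have : Continuous (fun y : E × ℝ => ‖y.1‖) := by fun_prop
        simpa using this.tendsto 0
      exact this.eventually (gt_mem_nhds (lt_min hrf hrg))
    have e3 : ∀ᶠ y in 𝓝 (0 : E × ℝ), |y.2 / ρ| < 1 := by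
      have := hdiv.continuousAt.tendsto
      simp only [Prod.snd_zero, zero_div] at this
      exact this.eventually (eventually_abs_lt one_pos)
    filter_upwards [e1, e2, e3] with y h1 h2 h3
    have hy : y.2 / ρ * ρ = y.2 := by field_simp
    have hgy := hevg y.1 ρ _ (h2.trans_le (min_le_right _ _)) hρg h3 e0
    have hfy := hevf y.1 ρ _ (h2.trans_le (min_le_left _ _)) hρf h3 (qh y.1)
    rw [he0 _ h3, mul_one, hy] at hgy
    rw [hy] at hfy
    have hsum := evalSeries_eq_sum h3 b (rh y.1)
    rw [h1, map_zero, mul_zero, add_zero] at hsum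
    have hdec : evalSeries (y.2 / ρ) (rh y.1) =
        evalSeries (y.2 / ρ) (Mg (y.1, ρ) e0) - evalSeries (y.2 / ρ) (Mf (y.1, ρ) (qh y.1)) := by
      rw [hrh, map_sub]
    rw [hgy, hfy, hsum] at hdec
    have : ∑ k : Fin b, rh y.1 k * (ρ⁻¹) ^ (k : ℕ) * y.2 ^ (k : ℕ) =
        ∑ k : Fin b, rh y.1 k * (y.2 / ρ) ^ (k : ℕ) := by
      refine Finset.sum_congr rfl fun k _ => ?_
      rw [div_eq_mul_inv, mul_pow]; ring
    rw [this, hdec]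
    ring

end Division

/-! ### The Noetherian ring of analytic germs -/

section Germs

universe u v

variable {E : Type u} {F : Type v} [NormedAddCommGroup E] [NormedSpace ℝ E] [NormedAddCommGroup F]
  [NormedSpace ℝ F]

/-- The ring of germs at `x₀` of real analytic functions. -/
def analyticGerms (x₀ : E) : Subring (Germ (𝓝 x₀) ℝ) where
  carrier := {g | ∃ f : E → ℝ, AnalyticAt ℝ f x₀ ∧ (f : Germ (𝓝 x₀) ℝ) = g}
  mul_mem' := by
    rintro _ _ ⟨f, hf, rfl⟩ ⟨g, hg, rfl⟩
    exact ⟨f * g, hf.mul hg, rfl⟩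
  one_mem' := ⟨fun _ => 1, analyticAt_const, rfl⟩
  add_mem' := by
    rintro _ _ ⟨f, hf, rfl⟩ ⟨g, hg, rfl⟩
    exact ⟨f + g, hf.add hg, rfl⟩
  zero_mem' := ⟨fun _ => 0, analyticAt_const, rfl⟩
  neg_mem' := by
    rintro _ ⟨f, hf, rfl⟩
    exact ⟨-f, hf.neg, rfl⟩

/-- The germ of an analytic function. -/
def germOf {x₀ : E} (f : E → ℝ) (hf : AnalyticAt ℝ f x₀) : analyticGerms x₀ := ⟨f, f, hf, rfl⟩

lemma exists_germOf {x₀ : E} (g : analyticGerms x₀) : ∃ f, ∃ hf : AnalyticAt ℝ f x₀, germOf f hf = g := by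
  obtain ⟨_, f, hf, rfl⟩ := g
  exact ⟨f, hf, rfl⟩

lemma germOf_eq_iff {x₀ : E} {f g : E → ℝ} (hf : AnalyticAt ℝ f x₀) (hg : AnalyticAt ℝ g x₀) :
    germOf f hf = germOf g hg ↔ f =ᶠ[𝓝 x₀] g := by
  exact Subtype.ext_iff.trans Germ.coe_eq

lemma germOf_smul_coe {x₀ : E} {f : E → ℝ} (hf : AnalyticAt ℝ f x₀) (Y : E → F) :
    germOf f hf • (Y : Germ (𝓝 x₀) F) = ((fun x => f x • Y x : E → F) : Germ (𝓝 x₀) F) := rfl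

/-- The pull-back of germs of analytic functions by an analytic map. -/
def pullback {E' : Type*} [NormedAddCommGroup E'] [NormedSpace ℝ E'] {x₀ : E} {y₀ : E'} (h : E → E')
    (hh : AnalyticAt ℝ h x₀) (h0 : h x₀ = y₀) : analyticGerms y₀ →+* analyticGerms x₀ where
  toFun g := ⟨g.1.compTendsto h (h0 ▸ hh.continuousAt), by
    obtain ⟨f, hf, rfl⟩ := exists_germOf g
    refine ⟨f ∘ h, ?_, rfl⟩
    subst h0
    exact hf.comp hh⟩
  map_one' := rfl
  map_zero' := rfl
  map_mul' := by
    intro a b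
    obtain ⟨f, hf, rfl⟩ := exists_germOf a
    obtain ⟨g, hg, rfl⟩ := exists_germOf b
    rfl
  map_add' := by
    intro a b
    obtain ⟨f, hf, rfl⟩ := exists_germOf a
    obtain ⟨g, hg, rfl⟩ := exists_germOf b
    rfl

lemma pullback_germOf {E' : Type*} [NormedAddCommGroup E'] [NormedSpace ℝ E'] {x₀ : E} {y₀ : E'}
    (h : E → E') (hh : AnalyticAt ℝ h x₀) (h0 : h x₀ = y₀) (f : E' → ℝ) (hf : AnalyticAt ℝ f y₀)
    (hfh : AnalyticAt ℝ (fun x => f (h x)) x₀) :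
    pullback h hh h0 (germOf f hf) = germOf (fun x => f (h x)) hfh := rfl

lemma isUnit_germOf {x₀ : E} {f : E → ℝ} (hf : AnalyticAt ℝ f x₀) (h : f x₀ ≠ 0) :
    IsUnit (germOf f hf) := by
  refine IsUnit.of_mul_eq_one (germOf (fun x => (f x)⁻¹) (hf.inv h)) ?_
  refine Subtype.ext (Germ.coe_eq.2 ?_)
  filter_upwards [hf.continuousAt.eventually_ne h] with x hx
  exact mul_inv_cancel₀ hx

/-- Otherwise the identity theorem along each segment from 0 would make f vanish on a whole ball.
The direction found replaces the linear change of coordinates that makes f regular in one variable.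
-/
lemma exists_line_ne_zero {f : E → ℝ} (hf : AnalyticAt ℝ f 0) (h : ¬ ∀ᶠ x in 𝓝 (0 : E), f x = 0) :
    ∃ v : E, ¬ ∀ᶠ t in 𝓝 (0 : ℝ), f (t • v) = 0 := by
  by_contra! hv
  refine h ?_
  obtain ⟨r, hr, hball⟩ := hf.exists_ball_analyticOnNhd
  filter_upwards [Metric.ball_mem_nhds (0 : E) hr] with x hx
  have hseg : AnalyticOnNhd ℝ (fun t : ℝ => f (t • x)) (Set.Icc 0 1) := by
    intro t ht
    refine AnalyticAt.fun_comp (g := f) (f := fun t : ℝ => t • x) (hball _ ?_)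
      (analyticAt_id.smul analyticAt_const)
    rw [mem_ball_zero_iff] at hx ⊢
    rw [norm_smul, Real.norm_eq_abs, abs_of_nonneg ht.1]
    exact (mul_le_of_le_one_left (norm_nonneg x) ht.2).trans_lt hx
  have := hseg.eqOn_zero_of_preconnected_of_eventuallyEq_zero isPreconnected_Icc
    (Set.left_mem_Icc.2 zero_le_one) (hv x) (Set.right_mem_Icc.2 zero_le_one)
  simpa using this

/-- Division by an analytic function, in a direction along which it does not vanish. -/
lemma exists_division {f : E → ℝ} (hf : AnalyticAt ℝ f 0) {v : E} {φ : E →L[ℝ] ℝ} (hφ : φ v = 1)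
    (hv : ¬ ∀ᶠ t in 𝓝 (0 : ℝ), f (t • v) = 0) :
    ∃ (π : E →L[ℝ] φ.ker) (b : ℕ), ∀ g : E → ℝ, AnalyticAt ℝ g 0 →
      ∃ (q : E → ℝ) (r : Fin b → φ.ker → ℝ), AnalyticAt ℝ q 0 ∧
      (∀ k, AnalyticAt ℝ (r k) 0) ∧
      ∀ᶠ y in 𝓝 (0 : E), g y = q y * f y + ∑ k, r k (π y) * φ y ^ (k : ℕ) := by
  -- The splitting of E into the kernel of φ and the line of v, where φ plays the role of the last
  -- coordinate.
  let π : E →L[ℝ] φ.ker :=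
    (ContinuousLinearMap.id ℝ E - φ.smulRight v).codRestrict φ.ker (by
      intro x
      simp [hφ])
  have hπ : ∀ x, (π x : E) = x - φ x • v := fun x => rfl
  let j : φ.ker × ℝ →L[ℝ] E :=
    φ.ker.subtypeL ∘L ContinuousLinearMap.fst ℝ _ _ + (ContinuousLinearMap.snd ℝ φ.ker ℝ).smulRight v
  have hj : ∀ y : φ.ker × ℝ, j y = (y.1 : E) + y.2 • v := fun y => rfl
  have hjπ : ∀ x, j (π x, φ x) = x := by
    intro x; rw [hj, hπ]; simp
  have hcomp : ∀ g : E → ℝ, AnalyticAt ℝ g 0 → AnalyticAt ℝ (fun y => g (j y)) 0 := by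
    intro g hg
    refine AnalyticAt.fun_comp (g := g) (f := j) ?_ (j.analyticAt 0)
    rwa [map_zero]
  obtain ⟨b, hb⟩ := weierstrass_division (hcomp f hf) (by
    intro h0
    refine hv (h0.mono fun t ht => ?_)
    rw [hj] at ht
    simpa using ht)
  let P : E →L[ℝ] φ.ker × ℝ := π.prod φ
  have hP0 : P 0 = 0 := map_zero P
  refine ⟨π, b, fun g hg => ?_⟩
  obtain ⟨q, r, hq, hr, h⟩ := hb _ (hcomp g hg)
  refine ⟨fun x => q (P x), r, ?_, hr, ?_⟩
  · refine AnalyticAt.fun_comp (g := q) (f := P) ?_ (P.analyticAt 0)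
    rwa [map_zero]
  · have ht : Tendsto P (𝓝 0) (𝓝 0) := by
      have := P.continuous.tendsto 0
      rwa [hP0] at this
    filter_upwards [ht.eventually h] with x hx
    have e : j (P x) = x := hjπ x
    rw [e] at hx
    exact hx

/-- Rückert's argument. Divide by a nonzero element f of the ideal: modulo f each germ is a
polynomial of bounded degree with coefficients in the germs of one variable less, and these
polynomials form a Noetherian module by induction. -/
theorem isNoetherianRing_analyticGerms_zero (d : ℕ) : ∀ (E : Type u) [NormedAddCommGroup E]
    [NormedSpace ℝ E] [FiniteDimensional ℝ E], Module.finrank ℝ E = d →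
    IsNoetherianRing (analyticGerms (0 : E)) := by
  induction d with
  | zero =>
    intro E _ _ _ hd
    have : Subsingleton E := Module.finrank_zero_iff.1 hd
    refine (isNoetherianRing_iff_ideal_fg _).2 fun I => ?_
    by_cases hI : I = ⊥
    · rw [hI]; exact Submodule.fg_bot
    · obtain ⟨g, hgI, hg0⟩ := Submodule.exists_mem_ne_zero_of_ne_bot hI
      obtain ⟨f, hf, rfl⟩ := exists_germOf g
      have hf0 : f 0 ≠ 0 := by
        intro h0
        refine hg0 ((germOf_eq_iff hf analyticAt_const).2 (Eventually.of_forall fun x => ?_))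
        rw [Subsingleton.elim x 0]; exact h0
      rw [Ideal.eq_top_of_isUnit_mem I hgI (isUnit_germOf hf hf0)]
      exact Ideal.fg_top _
  | succ d ih =>
    intro E _ _ _ hd
    refine (isNoetherianRing_iff_ideal_fg _).2 fun I => ?_
    by_cases hI : I = ⊥
    · rw [hI]; exact Submodule.fg_bot
    obtain ⟨g, hgI, hg0⟩ := Submodule.exists_mem_ne_zero_of_ne_bot hI
    obtain ⟨f, hf, rfl⟩ := exists_germOf g
    by_cases hf0 : f 0 ≠ 0
    · rw [Ideal.eq_top_of_isUnit_mem I hgI (isUnit_germOf hf hf0)]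
      exact Ideal.fg_top _
    rw [not_not] at hf0
    obtain ⟨v, hv⟩ := exists_line_ne_zero hf (fun h0 => hg0
      ((germOf_eq_iff hf analyticAt_const).2 h0))
    have hv0 : v ≠ 0 := by
      rintro rfl
      exact hv (Eventually.of_forall fun t => by rw [smul_zero, hf0])
    obtain ⟨φ, hφ⟩ := SeparatingDual.exists_eq_one (R := ℝ) hv0
    obtain ⟨π, b, hdiv⟩ := exists_division hf hφ hv
    have hker : Module.finrank ℝ φ.ker = d := by
      have hne : φ.toLinearMap ≠ 0 := by
        intro h
        have := congrArg (fun L : E →ₗ[ℝ] ℝ => L v) h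
        simp [hφ] at this
      have := Module.Dual.finrank_ker_add_one_of_ne_zero (f := φ.toLinearMap) hne
      rw [hd] at this
      exact Nat.succ_injective this
    have : IsNoetherianRing (analyticGerms (0 : φ.ker)) := ih φ.ker hker
    let ψ := pullback (x₀ := (0 : E)) (y₀ := (0 : φ.ker)) π (π.analyticAt 0) (map_zero π)
    let : Algebra (analyticGerms (0 : φ.ker)) (analyticGerms (0 : E)) := ψ.toAlgebra
    let z : analyticGerms (0 : E) := germOf φ (φ.analyticAt 0)
    -- The possible remainders. The ideal is generated by f and by generators of its intersection
    -- with `N`.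
    let N : Submodule (analyticGerms (0 : φ.ker)) (analyticGerms (0 : E)) :=
      Submodule.span _ (Set.range fun k : Fin b => z ^ (k : ℕ))
    have : IsNoetherian (analyticGerms (0 : φ.ker)) N :=
      isNoetherian_span_of_finite _ (Set.finite_range _)
    obtain ⟨t, ht⟩ := isNoetherian_submodule.1 this
      (I.restrictScalars (analyticGerms (0 : φ.ker)) ⊓ N) inf_le_right
    classical
    refine ⟨insert (germOf f hf) t, le_antisymm ?_ ?_⟩
    · rw [Submodule.span_le, Finset.coe_insert]
      rintro x (rfl | hx)
      · exact hgI
      · have : x ∈ (I.restrictScalars (analyticGerms (0 : φ.ker)) ⊓ N) := by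
          rw [← ht]; exact Submodule.subset_span hx
        exact this.1
    · intro x hx
      obtain ⟨g, hg, rfl⟩ := exists_germOf x
      obtain ⟨q, r, hq, hr, h⟩ := hdiv g hg
      have hrπ : ∀ k, AnalyticAt ℝ (fun y => r k (π y)) 0 := by
        intro k
        refine AnalyticAt.fun_comp (g := r k) (f := π) ?_ (π.analyticAt 0)
        rw [map_zero]; exact hr k
      have hdec : germOf g hg = germOf q hq * germOf f hf +
          ∑ k, germOf (r k) (hr k) • z ^ (k : ℕ) := by
        refine Subtype.ext ?_
        have : (((∑ k, germOf (r k) (hr k) • z ^ (k : ℕ) : analyticGerms (0 : E))) :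
            Germ (𝓝 (0 : E)) ℝ) = ((∑ k, (fun y => r k (π y) * φ y ^ (k : ℕ)) : E → ℝ) :
              Germ (𝓝 (0 : E)) ℝ) := by
          rw [AddSubmonoidClass.coe_finsetSum]
          have hmap := map_sum (Germ.coeAddHom (𝓝 (0 : E)) (M := ℝ))
            (fun (k : Fin b) (y : E) => r k (π y) * φ y ^ (k : ℕ)) Finset.univ
          exact (hmap.trans rfl).symm
        rw [Subring.coe_add, this]
        refine Germ.coe_eq.2 ?_
        filter_upwards [h] with y hy
        rw [hy]
        simp
      have hmem : germOf g hg - germOf q hq * germOf f hf ∈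
          I.restrictScalars (analyticGerms (0 : φ.ker)) ⊓ N := by
        refine ⟨?_, ?_⟩
        · exact I.sub_mem hx (I.mul_mem_left _ hgI)
        · rw [hdec, add_sub_cancel_left]
          exact N.sum_mem fun k _ => N.smul_mem _ (Submodule.subset_span ⟨k, rfl⟩)
      rw [← ht] at hmem
      have h1 : germOf g hg - germOf q hq * germOf f hf ∈
          Submodule.span (analyticGerms (0 : E)) (t : Set (analyticGerms (0 : E))) :=
        Submodule.span_le_restrictScalars (analyticGerms (0 : φ.ker)) _ _ hmem
      rw [← sub_add_cancel (germOf g hg) (germOf q hq * germOf f hf)]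
      refine Submodule.add_mem _ (Submodule.span_mono (by simp) h1) ?_
      exact Submodule.smul_mem _ _ (Submodule.subset_span (by simp))

/-- Germs of real analytic functions of finitely many variables form a Noetherian ring. -/
instance isNoetherianRing_analyticGerms [FiniteDimensional ℝ E] (x₀ : E) :
    IsNoetherianRing (analyticGerms x₀) := by
  have := isNoetherianRing_analyticGerms_zero _ E rfl
  have h1 : AnalyticAt ℝ (fun x : E => x - x₀) x₀ := analyticAt_id.sub analyticAt_const
  have h2 : AnalyticAt ℝ (fun x : E => x + x₀) 0 := analyticAt_id.add analyticAt_const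
  refine isNoetherianRing_of_surjective _ _ (pullback (x₀ := x₀) (y₀ := (0 : E)) _ h1 (sub_self x₀)) ?_
  intro g
  obtain ⟨f, hf, rfl⟩ := exists_germOf g
  have h3 : AnalyticAt ℝ (fun x : E => f (x + x₀)) 0 := by
    refine AnalyticAt.fun_comp (g := f) ?_ h2
    rwa [zero_add]
  refine ⟨germOf _ h3, ?_⟩
  have h4 : AnalyticAt ℝ (fun x : E => f (x - x₀ + x₀)) x₀ := by simpa using hf
  refine (pullback_germOf _ h1 (sub_self x₀) _ h3 h4).trans ?_
  exact (germOf_eq_iff _ _).2 (Eventually.of_forall fun x => by simp)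

/-- The module of the germs at `x₀` of combinations, with analytic coefficients, of the given
maps. -/
def locSpan (x₀ : E) (G : Set (E → F)) : Submodule (analyticGerms x₀) (Germ (𝓝 x₀) F) :=
  Submodule.span _ ((fun Y : E → F => (Y : Germ (𝓝 x₀) F)) '' G)

lemma coe_finset_sum_germ {ι E F : Type*} [TopologicalSpace E] [AddCommMonoid F] (x₀ : E) (s : Finset ι) (Y : ι → E → F) :
    ((fun x => ∑ i ∈ s, Y i x : E → F) : Germ (𝓝 x₀) F) = ∑ i ∈ s, (Y i : Germ (𝓝 x₀) F) := by
  have hmap := map_sum (Germ.coeAddHom (𝓝 x₀) (M := F)) Y s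
  refine Eq.trans ?_ hmap
  congr 1
  funext x
  simp

lemma mem_locSpan_iff {x₀ : E} {G : Set (E → F)} {Y : E → F} :
    (Y : Germ (𝓝 x₀) F) ∈ locSpan x₀ G ↔ ∃ (N : ℕ) (X : Fin N → E → F) (g : Fin N → E → ℝ),
      (∀ i, X i ∈ G) ∧ (∀ i, AnalyticAt ℝ (g i) x₀) ∧ Y =ᶠ[𝓝 x₀] fun x => ∑ i, g i x • X i x := by
  constructor
  · intro h
    obtain ⟨N, c, v, hv⟩ := Submodule.mem_span_set'.1 h
    choose X hXG hX using fun i => (v i).2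
    choose g hg hgc using fun i => exists_germOf (c i)
    refine ⟨N, X, g, hXG, hg, ?_⟩
    rw [← Germ.coe_eq, coe_finset_sum_germ, ← hv]
    refine Finset.sum_congr rfl fun i _ => ?_
    rw [← hgc, ← hX]
    rfl
  · rintro ⟨N, X, g, hX, hg, hY⟩
    rw [Germ.coe_eq.2 hY, coe_finset_sum_germ]
    refine Submodule.sum_mem _ fun i _ => ?_
    exact Submodule.smul_mem _ (germOf (g i) (hg i)) (Submodule.subset_span (Set.mem_image_of_mem _ (hX i)))

/-- Any family of germs of analytic maps is generated by finitely many of its members. -/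
theorem exists_finset_locSpan_eq [FiniteDimensional ℝ E] [FiniteDimensional ℝ F] (x₀ : E)
    (G : Set (E → F)) (hG : ∀ Y ∈ G, AnalyticAt ℝ Y x₀) :
    ∃ s : Finset (E → F), (s : Set (E → F)) ⊆ G ∧ locSpan x₀ G = locSpan x₀ (s : Set (E → F)) := by
  classical
  let b := Module.finBasis ℝ F
  let e : Fin (Module.finrank ℝ F) → Germ (𝓝 x₀) F := fun k => ((fun _ => b k : E → F) : Germ (𝓝 x₀) F)
  -- All germs in question lie in the module generated by the constant basis fields, which is
  -- Noetherian.
  have hle : locSpan x₀ G ≤ Submodule.span (analyticGerms x₀) (Set.range e) := by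
    refine Submodule.span_le.2 ?_
    rintro _ ⟨Y, hY, rfl⟩
    have hc : ∀ k, AnalyticAt ℝ (fun x => b.repr (Y x) k) x₀ := fun k =>
      ((b.coord k).toContinuousLinearMap.analyticAt _).fun_comp (hG Y hY)
    have : (Y : Germ (𝓝 x₀) F) = ∑ k, germOf _ (hc k) • e k := by
      have h1 : (Y : Germ (𝓝 x₀) F) =
          ((fun x => ∑ k, b.repr (Y x) k • b k : E → F) : Germ (𝓝 x₀) F) := by
        congr 1
        funext x
        exact (b.sum_repr (Y x)).symm
      rw [h1, coe_finset_sum_germ]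
      rfl
    rw [SetLike.mem_coe]
    beta_reduce
    rw [this]
    exact Submodule.sum_mem _ fun k _ => Submodule.smul_mem _ _ (Submodule.subset_span ⟨k, rfl⟩)
  have : IsNoetherian (analyticGerms x₀) (Submodule.span (analyticGerms x₀) (Set.range e)) :=
    isNoetherian_span_of_finite _ (Set.finite_range _)
  obtain ⟨s', hs', hspan⟩ := (Submodule.fg_span_iff_fg_span_finset_subset _).1
    (isNoetherian_submodule.1 this _ hle)
  obtain ⟨s, hsG, hs⟩ := (Finset.subset_set_image_iff).1 hs'
  refine ⟨s, hsG, ?_⟩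
  rw [locSpan, hspan, ← hs, Finset.coe_image]
  rfl

end Germs

/-! ### Analytic dependence of local flows -/

section LocalFlow

open unitInterval

variable {E F : Type*} [NormedAddCommGroup E] [NormedSpace ℝ E] [NormedAddCommGroup F]
  [NormedSpace ℝ F]

/-- The power series acting pointwise on continuous curves. -/
noncomputable def pointwiseSeries (p : FormalMultilinearSeries ℝ E F) :
    FormalMultilinearSeries ℝ C(I, E) C(I, F) := fun k =>
  MultilinearMap.mkContinuous
    { toFun := fun u => ⟨fun t => p k (fun i => u i t),
        (p k).cont.comp (continuous_pi fun i => (u i).continuous)⟩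
      map_update_add' := by
        intro _ u i a b
        ext t
        have h : ∀ c : C(I, E), (fun j => Function.update u i c j t) =
            Function.update (fun j => u j t) i (c t) := by
          intro c; funext j
          by_cases hj : j = i
          · subst hj; simp
          · simp [hj]
        simp [h]
      map_update_smul' := by
        intro _ u i c a
        ext t
        have h : ∀ c : C(I, E), (fun j => Function.update u i c j t) =
            Function.update (fun j => u j t) i (c t) := by
          intro c; funext j
          by_cases hj : j = i
          · subst hj; simp
          · simp [hj]
        simp [h] } ‖p k‖
    (by
      intro u
      refine (ContinuousMap.norm_le _ (by positivity)).2 fun t => ?_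
      refine ((p k).le_opNorm _).trans ?_
      gcongr with i
      exact (u i).norm_coe_le_norm t)

lemma norm_pointwiseSeries_le (p : FormalMultilinearSeries ℝ E F) (k : ℕ) :
    ‖pointwiseSeries p k‖ ≤ ‖p k‖ := MultilinearMap.mkContinuous_norm_le _ (norm_nonneg _) _

/-- Composition with an analytic map is analytic on spaces of continuous curves. -/
lemma exists_analytic_superposition [CompleteSpace F] {S : E → F} {x₀ : E} (hS : AnalyticAt ℝ S x₀) :
    ∃ N : C(I, E) → C(I, F), AnalyticAt ℝ N (ContinuousMap.const I x₀) ∧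
      ∀ᶠ u in 𝓝 (ContinuousMap.const I x₀), ∀ t, N u t = S (u t) := by
  obtain ⟨p, R, hp⟩ := hS
  have hrad : p.radius ≤ (pointwiseSeries p).radius :=
    FormalMultilinearSeries.radius_le_of_le fun {n} => by exact norm_pointwiseSeries_le p n
  have hball := (pointwiseSeries p).hasFPowerSeriesOnBall (hp.r_pos.trans_le (hp.r_le.trans hrad))
  refine ⟨fun u => (pointwiseSeries p).sum (u - ContinuousMap.const I x₀), ?_, ?_⟩
  · refine AnalyticAt.fun_comp (g := (pointwiseSeries p).sum)
      (f := fun u : C(I, E) => u - ContinuousMap.const I x₀) ?_ (analyticAt_id.sub analyticAt_const)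
    rw [sub_self]
    exact ⟨_, _, hball⟩
  · have h1 : Metric.eball (ContinuousMap.const I x₀) R ∈ 𝓝 (ContinuousMap.const I x₀) :=
      Metric.eball_mem_nhds _ hp.r_pos
    filter_upwards [h1] with u hu t
    have hu' : u - ContinuousMap.const I x₀ ∈ Metric.eball (0 : C(I, E)) R := by
      rw [Metric.mem_eball, edist_zero_right, ← edist_eq_enorm_sub]
      exact hu
    have hs := hball.hasSum (Metric.eball_subset_eball (hp.r_le.trans hrad) hu')
    rw [zero_add] at hs
    have hst := (ContinuousMap.evalCLM ℝ t : C(I, F) →L[ℝ] F).hasSum hs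
    have hpt := hp.hasSum (y := u t - x₀) (by
      rw [Metric.mem_eball, edist_zero_right] at hu' ⊢
      refine lt_of_le_of_lt ?_ hu'
      have := (u - ContinuousMap.const I x₀).norm_coe_le_norm t
      simp only [ContinuousMap.sub_apply, ContinuousMap.const_apply] at this
      rw [← ofReal_norm, ← ofReal_norm]
      exact ENNReal.ofReal_le_ofReal this)
    rw [add_sub_cancel] at hpt
    exact hst.unique hpt

/-- The primitive vanishing at `0` of a continuous curve. -/
noncomputable def primitive : C(I, E) →L[ℝ] C(I, E) :=
  LinearMap.mkContinuous
    { toFun := fun u => ⟨fun t => ∫ r in (0 : ℝ)..t, Set.IccExtend zero_le_one u r,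
        (intervalIntegral.continuous_primitive
          (fun _ _ => (u.continuous.Icc_extend').intervalIntegrable _ _) 0).comp
            continuous_subtype_val⟩
      map_add' := by
        intro u v
        ext t
        exact intervalIntegral.integral_add ((u.continuous.Icc_extend').intervalIntegrable _ _)
          ((v.continuous.Icc_extend').intervalIntegrable _ _)
      map_smul' := by
        intro c u
        ext t
        exact intervalIntegral.integral_smul c _ } 1
    (by
      intro u
      refine (ContinuousMap.norm_le _ (by positivity)).2 fun t => ?_
      have h := intervalIntegral.norm_integral_le_of_norm_le_const (a := 0) (b := (t : ℝ))
        (f := Set.IccExtend zero_le_one u) (C := ‖u‖) (fun r _ => u.norm_coe_le_norm _)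
      refine h.trans ?_
      rw [sub_zero, abs_of_nonneg t.2.1, one_mul]
      exact mul_le_of_le_one_right (norm_nonneg _) t.2.2)

lemma primitive_apply (u : C(I, E)) (t : I) :
    primitive u t = ∫ r in (0 : ℝ)..t, Set.IccExtend zero_le_one u r := rfl

/-- The constant curves. -/
noncomputable def constCurve : E →L[ℝ] C(I, E) :=
  LinearMap.mkContinuous
    { toFun := fun x => ContinuousMap.const I x
      map_add' := fun _ _ => rfl
      map_smul' := fun _ _ => rfl } 1
    (by
      intro x
      rw [one_mul]
      exact (ContinuousMap.norm_le _ (norm_nonneg _)).2 fun t => le_rfl)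

@[simp] lemma constCurve_apply (x : E) (t : I) : constCurve x t = x := rfl

/-- The rescaling `t ↦ u (θ t)` of a curve `u`. -/
def rescale (θ : I) (u : C(I, E)) : C(I, E) := ⟨fun t => u (θ * t), by fun_prop⟩

lemma rescale_apply (θ : I) (u : C(I, E)) (t : I) : rescale θ u t = u (θ * t) := rfl

lemma norm_rescale_sub_le (θ : I) (u : C(I, E)) (x : E) :
    ‖rescale θ u - constCurve x‖ ≤ ‖u - constCurve x‖ := by
  refine (ContinuousMap.norm_le _ (norm_nonneg _)).2 fun t => ?_
  exact (u - constCurve x).norm_coe_le_norm (θ * t)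

variable [CompleteSpace E]

/-- The solutions of `u' = s S(u)`, `u 0 = x` on the unit interval depend analytically on
`(s, x)`. -/
lemma exists_analytic_solution_curve {S : E → E} {x₀ : E} (hS : AnalyticAt ℝ S x₀) :
    ∃ φ : ℝ × E → C(I, E), AnalyticAt ℝ φ (0, x₀) ∧ φ (0, x₀) = constCurve x₀ ∧
      (∀ᶠ p in 𝓝 ((0 : ℝ), x₀), ∀ t : I, φ p t = p.2 +
        p.1 • ∫ r in (0 : ℝ)..t, S (Set.IccExtend zero_le_one (φ p) r)) ∧
      (∀ᶠ p in 𝓝 ((0 : ℝ), x₀), ∀ θ : I, φ (θ * p.1, p.2) = rescale θ (φ p)) := by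
  obtain ⟨N, hN, hNS⟩ := exists_analytic_superposition hS
  have hx₀ : ContinuousMap.const I x₀ = constCurve x₀ := rfl
  rw [hx₀] at hN hNS
  -- The integral equation u = x + s ∫ S(u), to be solved by the implicit function theorem. Time is
  -- rescaled so that s is a mere parameter; at s = 0 the derivative in u is the identity.
  let G : (ℝ × E) × C(I, E) → C(I, E) := fun v => v.2 - constCurve v.1.2 - v.1.1 • primitive (N v.2)
  let pt : (ℝ × E) × C(I, E) := ((0, x₀), constCurve x₀)
  have hG : AnalyticAt ℝ G pt := by
    have h1 : AnalyticAt ℝ (fun v : (ℝ × E) × C(I, E) => primitive (N v.2)) pt :=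
      (primitive.analyticAt _).fun_comp (AnalyticAt.fun_comp (g := N)
        (f := fun v : (ℝ × E) × C(I, E) => v.2) hN analyticAt_snd)
    have h2 : AnalyticAt ℝ (fun v : (ℝ × E) × C(I, E) => v.1.2) pt :=
      AnalyticAt.fun_comp (g := Prod.snd) analyticAt_snd analyticAt_fst
    have h3 : AnalyticAt ℝ (fun v : (ℝ × E) × C(I, E) => v.1.1) pt :=
      AnalyticAt.fun_comp (g := Prod.fst) analyticAt_fst analyticAt_fst
    exact (analyticAt_snd.sub ((constCurve.analyticAt _).fun_comp h2)).sub (h3.smul h1)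
  have hGpt : G pt = 0 := by simp [G, pt]
  -- The exponent ⊤ is ω, so that the implicit function is analytic and not only smooth.
  have hG' : ContDiffAt ℝ ⊤ G pt := hG.contDiffAt
  have hpartial : fderiv ℝ G pt ∘SL ContinuousLinearMap.inr ℝ (ℝ × E) C(I, E) =
      ContinuousLinearMap.id ℝ C(I, E) := by
    have h1 : HasFDerivAt (fun u => G ((0, x₀), u))
        (fderiv ℝ G pt ∘SL ContinuousLinearMap.inr ℝ (ℝ × E) C(I, E)) (constCurve x₀) :=
      HasFDerivAt.comp (g := G) (constCurve x₀) hG.differentiableAt.hasFDerivAt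
        (hasFDerivAt_prodMk_right _ _)
    have h2 : HasFDerivAt (fun u => G ((0, x₀), u)) (ContinuousLinearMap.id ℝ C(I, E))
        (constCurve x₀) := by
      have : (fun u => G ((0, x₀), u)) = fun u => u - constCurve x₀ := by
        funext u; simp [G]
      rw [this]
      exact (hasFDerivAt_id _).sub_const _
    exact h1.unique h2
  have hinv : (fderiv ℝ G pt ∘SL ContinuousLinearMap.inr ℝ (ℝ × E) C(I, E)).IsInvertible := by
    rw [hpartial]
    exact ⟨ContinuousLinearEquiv.refl ℝ _, rfl⟩
  let φ := hG'.implicitFunction (by simp) hinv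
  have hφan : AnalyticAt ℝ φ (0, x₀) := (hG'.contDiffAt_implicitFunction (by simp) hinv).analyticAt
  have hφ0 : φ (0, x₀) = constCurve x₀ := hG'.implicitFunction_apply_self (by simp) hinv
  have hφc : Tendsto φ (𝓝 (0, x₀)) (𝓝 (constCurve x₀)) := by
    have := hφan.continuousAt.tendsto
    rwa [hφ0] at this
  have hsol : ∀ᶠ p in 𝓝 ((0 : ℝ), x₀), ∀ t : I, φ p t = p.2 +
        p.1 • ∫ r in (0 : ℝ)..t, S (Set.IccExtend zero_le_one (φ p) r) := by
    have h1 : ∀ᶠ p in 𝓝 ((0 : ℝ), x₀), G (p, φ p) = G pt :=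
      hG'.eventually_apply_implicitFunction (by simp) hinv
    filter_upwards [h1, hφc.eventually hNS] with p hp hpN t
    rw [hGpt] at hp
    have := congrArg (fun u : C(I, E) => u t) hp
    simp only [G, ContinuousMap.sub_apply, constCurve_apply, ContinuousMap.smul_apply,
      ContinuousMap.zero_apply, ContinuousMap.add_apply, primitive_apply, sub_sub, sub_eq_zero] at this
    rw [this]
    congr 2
    refine intervalIntegral.integral_congr fun r _ => ?_
    exact hpN _
  refine ⟨φ, hφan, hφ0, hsol, ?_⟩
  -- The rescaled curve solves the equation with parameter θs. It is no farther from the constant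
  -- curve than `φ p`, so local uniqueness applies to it.
  have huniq : ∀ᶠ v in 𝓝 pt, G v = G pt ↔ φ v.1 = v.2 :=
    hG'.eventually_apply_eq_iff_implicitFunction (by simp) hinv
  have hNS' : ∀ᶠ v in 𝓝 pt, ∀ t, N v.2 t = S (v.2 t) := (continuous_snd.tendsto pt).eventually hNS
  obtain ⟨δ, hδ, hb⟩ := Metric.eventually_nhds_iff.1 (huniq.and hNS')
  have hclose : ∀ᶠ p in 𝓝 ((0 : ℝ), x₀), dist p ((0 : ℝ), x₀) < δ :=
    Metric.ball_mem_nhds _ hδ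
  have hclose' : ∀ᶠ p in 𝓝 ((0 : ℝ), x₀), dist (φ p) (constCurve x₀) < δ :=
    hφc.eventually (Metric.ball_mem_nhds _ hδ)
  filter_upwards [hsol, hclose, hclose'] with p hp hp1 hp2 θ
  have hdist : dist (((θ : ℝ) * p.1, p.2), rescale θ (φ p)) pt < δ := by
    rw [Prod.dist_eq, Prod.dist_eq]
    rw [Prod.dist_eq] at hp1
    refine max_lt (max_lt ?_ ?_) ?_
    · refine lt_of_le_of_lt ?_ ((le_max_left _ _).trans_lt hp1)
      simp only [dist_zero_right, norm_mul, pt]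
      refine mul_le_of_le_one_left (norm_nonneg _) ?_
      rw [Real.norm_eq_abs, abs_of_nonneg θ.2.1]
      exact θ.2.2
    · exact (le_max_right _ _).trans_lt hp1
    · refine lt_of_le_of_lt ?_ hp2
      rw [dist_eq_norm, dist_eq_norm]
      exact norm_rescale_sub_le θ (φ p) x₀
  obtain ⟨h1, h2⟩ := hb hdist
  refine h1.1 ?_
  rw [hGpt]
  ext t
  simp only [G, ContinuousMap.sub_apply, constCurve_apply, ContinuousMap.smul_apply,
    ContinuousMap.zero_apply, ContinuousMap.add_apply, primitive_apply, sub_sub, sub_eq_zero]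
  have h3 : ∫ r in (0 : ℝ)..t, Set.IccExtend zero_le_one (N (rescale θ (φ p))) r =
      ∫ r in (0 : ℝ)..t, S (Set.IccExtend zero_le_one (φ p) (θ * r)) := by
    refine intervalIntegral.integral_congr fun r hr => ?_
    rw [Set.uIcc_of_le t.2.1] at hr
    have hr' : r ∈ Set.Icc (0 : ℝ) 1 := ⟨hr.1, hr.2.trans t.2.2⟩
    have hθr : (θ : ℝ) * r ∈ Set.Icc (0 : ℝ) 1 :=
      ⟨mul_nonneg θ.2.1 hr'.1, mul_le_one₀ θ.2.2 hr'.1 hr'.2⟩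
    rw [Set.IccExtend_of_mem _ _ hr', Set.IccExtend_of_mem _ _ hθr]
    exact h2 ⟨r, hr'⟩
  rw [h3, rescale_apply, hp, mul_comm (θ : ℝ) p.1, mul_smul,
    intervalIntegral.smul_integral_comp_mul_left
      (fun r => S (Set.IccExtend zero_le_one (φ p) r)) (θ : ℝ), mul_zero]
  rfl

/-- Local flows of analytic vector fields are analytic. -/
theorem exists_analytic_localFlow {S : E → E} {x₀ : E} (hS : AnalyticAt ℝ S x₀) :
    ∃ Φ : ℝ × E → E, AnalyticAt ℝ Φ (0, x₀) ∧ ∀ᶠ p in 𝓝 ((0 : ℝ), x₀),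
      Φ (0, p.2) = p.2 ∧ HasDerivAt (fun s => Φ (s, p.2)) (S (Φ p)) p.1 := by
  obtain ⟨φ, hφ, hφ0, hsol, hscale⟩ := exists_analytic_solution_curve hS
  have hΦ : AnalyticAt ℝ (fun p => φ p 1) (0, x₀) :=
    ((ContinuousMap.evalCLM ℝ (1 : I) : C(I, E) →L[ℝ] E).analyticAt _).fun_comp hφ
  have hΦ0 : φ (0, x₀) 1 = x₀ := by rw [hφ0]; rfl
  refine ⟨fun p => φ p 1, hΦ, ?_⟩
  have hcont : ∀ᶠ p in 𝓝 ((0 : ℝ), x₀), ContinuousAt S (φ p 1) := by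
    refine hΦ.continuousAt.eventually ?_
    beta_reduce
    rw [hΦ0]
    exact hS.eventually_continuousAt
  obtain ⟨δ, hδ, hb⟩ := Metric.eventually_nhds_iff.1
    (((hsol.and hscale).and hcont).and hΦ.eventually_continuousAt)
  filter_upwards [Metric.ball_mem_nhds ((0 : ℝ), x₀) hδ] with p hp
  rw [Metric.mem_ball, Prod.dist_eq, max_lt_iff] at hp
  have hbox : ∀ s : ℝ, |s| < δ → dist (s, p.2) ((0 : ℝ), x₀) < δ := by
    intro s hs
    rw [Prod.dist_eq]
    exact max_lt (by simpa using hs) hp.2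
  -- By rescaling, the curve with parameter s at the time r is the curve with parameter sr at the
  -- time 1. Substituting in the integral leaves the usual integral equation in s.
  have hint : ∀ s : ℝ, |s| < δ → φ (s, p.2) 1 = p.2 + ∫ r in (0 : ℝ)..s, S (φ (r, p.2) 1) := by
    intro s hs
    obtain ⟨⟨⟨h1, h2⟩, -⟩, -⟩ := hb (hbox s hs)
    rw [h1 1]
    congr 1
    have h3 : ∫ r in (0 : ℝ)..((1 : I) : ℝ), S (Set.IccExtend zero_le_one (φ (s, p.2)) r) =
        ∫ r in (0 : ℝ)..1, S (φ (s * r, p.2) 1) := by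
      refine intervalIntegral.integral_congr fun r hr => ?_
      rw [Set.Icc.coe_one, Set.uIcc_of_le zero_le_one] at hr
      rw [Set.IccExtend_of_mem _ _ hr, mul_comm s r]
      have := h2 ⟨r, hr⟩
      simp only at this
      rw [this, rescale_apply, mul_one]
    rw [h3, intervalIntegral.smul_integral_comp_mul_left (fun r => S (φ (r, p.2) 1)) s]
    simp
  have hc : ∀ s : ℝ, |s| < δ → ContinuousAt (fun r => S (φ (r, p.2) 1)) s := by
    intro s hs
    obtain ⟨⟨-, h1⟩, h2⟩ := hb (hbox s hs)
    refine ContinuousAt.comp (g := S) (f := fun r => φ (r, p.2) 1) h1 ?_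
    exact ContinuousAt.comp (g := fun p => φ p 1) (f := fun r => (r, p.2)) h2 (by fun_prop)
  have hp1 : |p.1| < δ := by simpa using hp.1
  have hmem : ∀ s : ℝ, |s| < δ → Metric.ball (0 : ℝ) δ ∈ 𝓝 s := fun s hs =>
    Metric.isOpen_ball.mem_nhds (by simpa using hs)
  refine ⟨by rw [hint 0 (by simpa using hδ)]; simp, ?_⟩
  have hco : ContinuousOn (fun r => S (φ (r, p.2) 1)) (Metric.ball (0 : ℝ) δ) := fun r hr =>
    (hc r (by simpa using hr)).continuousWithinAt
  have hd : HasDerivAt (fun s => ∫ r in (0 : ℝ)..s, S (φ (r, p.2) 1)) (S (φ (p.1, p.2) 1)) p.1 := by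
    refine intervalIntegral.integral_hasDerivAt_right ?_ ?_ (hc _ hp1)
    · refine ContinuousOn.intervalIntegrable (hco.mono ?_)
      exact (convex_ball (0 : ℝ) δ).ordConnected.uIcc_subset (by simpa using hδ) (by simpa using hp1)
    · exact hco.stronglyMeasurableAtFilter Metric.isOpen_ball _ (by simpa using hp1)
  refine (hd.const_add p.2).congr_of_eventuallyEq ?_
  filter_upwards [hmem p.1 hp1] with s hs
  exact hint s (by simpa using hs)

end LocalFlow

/-! ### Flows along whole integral curves -/

section Flows

variable {n m : ℕ} {D : Set (Ext n m)} {X : Ext n m → Ext n m} {s t : ℝ} {x y z : Ext n m}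

lemma FlowsTo.zero (hx : x ∈ D) : FlowsTo D X 0 x x := by
  -- Only the parameter 0 is tested, and any curve with the right value and velocity at 0 serves.
  refine ⟨fun r => x + r • X x, by simp, by simp, fun r hr => ?_⟩
  rw [uIcc_self, mem_singleton_iff] at hr
  subst hr
  simp only [zero_smul, add_zero]
  refine ⟨hx, HasDerivAt.hasDerivWithinAt ?_⟩
  simpa using ((hasDerivAt_id (0 : ℝ)).smul_const (X x)).const_add x

lemma FlowsTo.mem_left (h : FlowsTo D X s x y) : x ∈ D := by
  obtain ⟨c, rfl, -, h⟩ := h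
  exact (h 0 left_mem_uIcc).1

lemma FlowsTo.mem_right (h : FlowsTo D X s x y) : y ∈ D := by
  obtain ⟨c, -, rfl, h⟩ := h
  exact (h s right_mem_uIcc).1

lemma FlowsTo.neg_field (h : FlowsTo D X s x y) : FlowsTo D (fun x => -X x) (-s) x y := by
  obtain ⟨c, h0, hs, h⟩ := h
  refine ⟨fun r => c (-r), by simpa using h0, by simpa using hs, fun r hr => ?_⟩
  have hr' : -r ∈ uIcc 0 s := by
    have := mem_image_of_mem (fun r => -r) hr
    simpa [image_neg_uIcc] using this
  refine ⟨(h _ hr').1, ?_⟩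
  have h1 := HasDerivWithinAt.scomp r (h _ hr').2 (hasDerivAt_neg r).hasDerivWithinAt
    (s := uIcc 0 (-s)) (fun u hu => by
      have := mem_image_of_mem (fun r => -r) hu
      simpa [image_neg_uIcc] using this)
  simpa [Function.comp_def] using h1

lemma flowsTo_neg_field_iff : FlowsTo D (fun x => -X x) (-s) x y ↔ FlowsTo D X s x y :=
  ⟨fun h => by simpa using h.neg_field, fun h => h.neg_field⟩

lemma FlowsTo.symm (h : FlowsTo D X s x y) : FlowsTo D X (-s) y x := by
  obtain ⟨c, h0, hs, h⟩ := h
  have hmaps : ∀ r ∈ uIcc 0 (-s), s + r ∈ uIcc 0 s := by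
    intro r hr
    rcases le_total 0 s with h0 | h0
    · rw [uIcc_of_ge (by linarith)] at hr
      rw [uIcc_of_le h0]
      exact ⟨by linarith [hr.1], by linarith [hr.2]⟩
    · rw [uIcc_of_le (by linarith)] at hr
      rw [uIcc_of_ge h0]
      exact ⟨by linarith [hr.1], by linarith [hr.2]⟩
  refine ⟨fun r => c (s + r), by simpa using hs, by simpa using h0, fun r hr => ?_⟩
  refine ⟨(h _ (hmaps r hr)).1, ?_⟩
  have h1 := HasDerivWithinAt.scomp r (h _ (hmaps r hr)).2
    ((hasDerivAt_id r).const_add s).hasDerivWithinAt hmaps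
  simpa [Function.comp_def] using h1

lemma FlowsTo.trans_of_nonneg (hs : 0 ≤ s) (ht : 0 ≤ t) (h₁ : FlowsTo D X s x y)
    (h₂ : FlowsTo D X t y z) : FlowsTo D X (s + t) x z := by
  obtain ⟨c, hc0, hcs, hc⟩ := h₁
  obtain ⟨d, hd0, hdt, hd⟩ := h₂
  rw [uIcc_of_le hs] at hc
  rw [uIcc_of_le ht] at hd
  let e : ℝ → Ext n m := fun r => if r ≤ s then c r else d (r - s)
  have he1 : ∀ r ∈ Icc 0 s, e r = c r := fun r hr => if_pos hr.2
  have he2 : ∀ r ∈ Icc s (s + t), e r = d (r - s) := by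
    intro r hr
    rcases hr.1.eq_or_lt with rfl | h
    · simp [e, hcs, hd0]
    · exact if_neg (not_le.2 h)
  have hmaps : ∀ r ∈ Icc s (s + t), r - s ∈ Icc 0 t :=
    fun r hr => ⟨by linarith [hr.1], by linarith [hr.2]⟩
  refine ⟨e, ?_, ?_, fun r hr => ?_⟩
  · rw [he1 0 ⟨le_rfl, hs⟩, hc0]
  · rw [he2 _ ⟨by linarith, le_rfl⟩, ← hdt]; congr 1; ring
  rw [uIcc_of_le (add_nonneg hs ht)] at hr ⊢
  have hmem : e r ∈ D := by
    rcases le_total r s with h | h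
    · rw [he1 r ⟨hr.1, h⟩]; exact (hc r ⟨hr.1, h⟩).1
    · rw [he2 r ⟨h, hr.2⟩]; exact (hd _ (hmaps r ⟨h, hr.2⟩)).1
  refine ⟨hmem, ?_⟩
  have hu : Icc 0 (s + t) = Icc 0 s ∪ Icc s (s + t) :=
    (Icc_union_Icc_eq_Icc hs (by linarith)).symm
  rw [hu]
  refine HasDerivWithinAt.union ?_ ?_
  · by_cases h : r ∈ Icc 0 s
    · rw [he1 r h]
      exact (hc r h).2.congr he1 (he1 r h)
    · exact HasFDerivWithinAt.of_notMem_closure (by rwa [isClosed_Icc.closure_eq])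
  · by_cases h : r ∈ Icc s (s + t)
    · rw [he2 r h]
      have h1 := HasDerivWithinAt.scomp r (hd _ (hmaps r h)).2
        ((hasDerivAt_id r).sub_const s).hasDerivWithinAt hmaps
      rw [one_smul] at h1
      exact h1.congr he2 (he2 r h)
    · exact HasFDerivWithinAt.of_notMem_closure (by rwa [isClosed_Icc.closure_eq])

lemma FlowsTo.trans_of_nonpos (hs : s ≤ 0) (ht : t ≤ 0) (h₁ : FlowsTo D X s x y)
    (h₂ : FlowsTo D X t y z) : FlowsTo D X (s + t) x z := by
  rw [← flowsTo_neg_field_iff] at h₁ h₂ ⊢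
  rw [neg_add]
  exact h₁.trans_of_nonneg (by linarith) (by linarith) h₂

/-- Uniqueness needs one Lipschitz constant along both curves. It exists because their images are
compact and X is locally Lipschitz. -/
lemma eqOn_of_integral_curves (hX : AnalyticOnNhd ℝ X D) {a b : ℝ}
    {c d : ℝ → Ext n m} (h0 : c a = d a)
    (hc : ∀ r ∈ Icc a b, c r ∈ D ∧ HasDerivWithinAt c (X (c r)) (Icc a b) r)
    (hd : ∀ r ∈ Icc a b, d r ∈ D ∧ HasDerivWithinAt d (X (d r)) (Icc a b) r) :
    EqOn c d (Icc a b) := by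
  have hcc : ContinuousOn c (Icc a b) := fun r hr => (hc r hr).2.continuousWithinAt
  have hdc : ContinuousOn d (Icc a b) := fun r hr => (hd r hr).2.continuousWithinAt
  let C := c '' Icc a b ∪ d '' Icc a b
  have hC : IsCompact C := (isCompact_Icc.image_of_continuousOn hcc).union
    (isCompact_Icc.image_of_continuousOn hdc)
  have hCD : C ⊆ D := by
    rintro _ (⟨r, hr, rfl⟩ | ⟨r, hr, rfl⟩)
    exacts [(hc r hr).1, (hd r hr).1]
  have hlip : LocallyLipschitzOn C X := by
    intro x hx
    have h1 : ContDiffAt ℝ 1 X x := (hX x (hCD hx)).contDiffAt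
    obtain ⟨K, u, hu, hK⟩ := h1.exists_lipschitzOnWith
    exact ⟨K, u, mem_nhdsWithin_of_mem_nhds hu, hK⟩
  obtain ⟨K, hK⟩ := hlip.exists_lipschitzOnWith_of_compact hC
  have hder : ∀ e : ℝ → Ext n m, (∀ r ∈ Icc a b, e r ∈ D ∧ HasDerivWithinAt e (X (e r)) (Icc a b) r) →
      ∀ r ∈ Ico a b, HasDerivWithinAt e (X (e r)) (Ici r) r := by
    intro e he r hr
    exact (he r (Ico_subset_Icc_self hr)).2.mono_of_mem_nhdsWithin
      (Icc_mem_nhdsGE_of_mem hr)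
  exact ODE_solution_unique_of_mem_Icc_right (v := fun _ => X) (s := fun _ => C) (K := K)
    (fun _ _ => hK) hcc (hder c hc) (fun r hr => Or.inl ⟨r, Ico_subset_Icc_self hr, rfl⟩)
    hdc (hder d hd) (fun r hr => Or.inr ⟨r, Ico_subset_Icc_self hr, rfl⟩) h0

lemma FlowsTo.unique_of_nonneg (hX : AnalyticOnNhd ℝ X D) (hs : 0 ≤ s)
    (h₁ : FlowsTo D X s x y) (h₂ : FlowsTo D X s x z) : y = z := by
  obtain ⟨c, hc0, rfl, hc⟩ := h₁
  obtain ⟨d, hd0, rfl, hd⟩ := h₂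
  rw [uIcc_of_le hs] at hc hd
  exact eqOn_of_integral_curves hX (hc0.trans hd0.symm) hc hd ⟨hs, le_rfl⟩

lemma FlowsTo.unique (hX : AnalyticOnNhd ℝ X D)
    (h₁ : FlowsTo D X s x y) (h₂ : FlowsTo D X s x z) : y = z := by
  rcases le_total 0 s with hs | hs
  · exact h₁.unique_of_nonneg hX hs h₂
  · exact h₁.neg_field.unique_of_nonneg hX.neg (by linarith) h₂.neg_field

lemma flowMap_eq (hX : AnalyticOnNhd ℝ X D) (h : FlowsTo D X s x y) :
    flowMap D X s x = y := by
  have hex : ∃ y, FlowsTo D X s x y := ⟨y, h⟩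
  rw [flowMap, dif_pos hex]
  exact hex.choose_spec.unique hX h

lemma flowsTo_flowMap (h : x ∈ flowDom D X s) : FlowsTo D X s x (flowMap D X s x) := by
  have hex : ∃ y, FlowsTo D X s x y := h
  rw [flowMap, dif_pos hex]
  exact hex.choose_spec

lemma exists_local_flow (hD : IsOpen D) (hX : AnalyticOnNhd ℝ X D) (hx : x ∈ D) :
    ∃ Φ : ℝ × Ext n m → Ext n m, AnalyticAt ℝ Φ (0, x) ∧
      ∀ᶠ p in 𝓝 ((0 : ℝ), x), FlowsTo D X p.1 p.2 (Φ p) := by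
  obtain ⟨Φ, hΦ, h⟩ := exists_analytic_localFlow (hX x hx)
  refine ⟨Φ, hΦ, ?_⟩
  have hΦ0 : Φ (0, x) = x := h.self_of_nhds.1
  have hmem : ∀ᶠ p in 𝓝 ((0 : ℝ), x), Φ p ∈ D :=
    hΦ.continuousAt.eventually (by rw [hΦ0]; exact hD.mem_nhds hx)
  obtain ⟨δ, hδ, hb⟩ := Metric.eventually_nhds_iff.1 (h.and hmem)
  filter_upwards [Metric.ball_mem_nhds ((0 : ℝ), x) hδ] with p hp
  rw [Metric.mem_ball, Prod.dist_eq, max_lt_iff] at hp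
  have hbox : ∀ r ∈ uIcc 0 p.1, dist (r, p.2) ((0 : ℝ), x) < δ := by
    intro r hr
    rw [Prod.dist_eq]
    refine max_lt (lt_of_le_of_lt ?_ hp.1) hp.2
    simp only [dist_zero_right, Real.norm_eq_abs]
    simpa using abs_sub_left_of_mem_uIcc hr
  refine ⟨fun r => Φ (r, p.2), (hb (hbox 0 left_mem_uIcc)).1.1, rfl, fun r hr => ?_⟩
  obtain ⟨⟨-, h1⟩, h2⟩ := hb (hbox r hr)
  exact ⟨h2, h1.hasDerivWithinAt⟩

/-- Cut the integral curve into pieces, each of which lies in the range of one local flow, and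
compose these flows. -/
lemma exists_analytic_flow_of_nonneg (hD : IsOpen D) (hX : AnalyticOnNhd ℝ X D) (hs : 0 ≤ s)
    (h : FlowsTo D X s x y) : ∃ Ψ : ℝ × Ext n m → Ext n m, AnalyticAt ℝ Ψ (s, x) ∧
      ∀ᶠ p in 𝓝 (s, x), FlowsTo D X p.1 p.2 (Ψ p) := by
  obtain ⟨c, rfl, rfl, hc⟩ := h
  rw [uIcc_of_le hs] at hc
  let Q : ℝ → ℝ → Prop := fun a b => ∃ Ψ : ℝ × Ext n m → Ext n m, AnalyticAt ℝ Ψ (b - a, c a) ∧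
      ∀ᶠ p in 𝓝 (b - a, c a), FlowsTo D X p.1 p.2 (Ψ p)
  have hcurve : ∀ a ∈ Icc 0 s, ∀ b ∈ Icc 0 s, a ≤ b → FlowsTo D X (b - a) (c a) (c b) := by
    intro a ha b hb hab
    have hmaps : ∀ r ∈ uIcc 0 (b - a), a + r ∈ Icc 0 s := by
      intro r hr
      rw [uIcc_of_le (by linarith)] at hr
      exact ⟨by linarith [hr.1, ha.1], by linarith [hr.2, hb.2]⟩
    refine ⟨fun r => c (a + r), by simp, by simp, fun r hr => ⟨(hc _ (hmaps r hr)).1, ?_⟩⟩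
    have h1 := HasDerivWithinAt.scomp r (hc _ (hmaps r hr)).2
      ((hasDerivAt_id r).const_add a).hasDerivWithinAt hmaps
    simpa [Function.comp_def] using h1
  have hval : ∀ a ∈ Icc 0 s, ∀ b ∈ Icc 0 s, a ≤ b → ∀ Ψ : ℝ × Ext n m → Ext n m,
      (∀ᶠ p in 𝓝 (b - a, c a), FlowsTo D X p.1 p.2 (Ψ p)) → Ψ (b - a, c a) = c b := by
    intro a ha b hb hab Ψ hΨ
    exact hΨ.self_of_nhds.unique hX (hcurve a ha b hb hab)
  have hlocal : ∀ r : Icc 0 s, ∃ V : Set (Icc 0 s), IsOpen V ∧ r ∈ V ∧ ∀ a ∈ V, ∀ b ∈ V, Q a b := by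
    intro r
    obtain ⟨Φ, hΦ, hΦf⟩ := exists_local_flow hD hX (hc r r.2).1
    have h1 := hΦ.eventually_analyticAt.and (eventually_eventually_nhds.2 hΦf)
    have hcont : Continuous fun a : Icc 0 s => c a :=
      continuousOn_iff_continuous_domRestrict.1 fun r hr => (hc r hr).2.continuousWithinAt
    have h2 : Tendsto (fun q : Icc 0 s × Icc 0 s => ((q.2 : ℝ) - q.1, c q.1)) (𝓝 (r, r))
        (𝓝 ((0 : ℝ), c r)) := by
      have : Continuous (fun q : Icc 0 s × Icc 0 s => ((q.2 : ℝ) - q.1, c q.1)) :=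
        (by fun_prop : Continuous fun q : Icc 0 s × Icc 0 s => ((q.2 : ℝ) - q.1)).prodMk
          (hcont.comp continuous_fst)
      simpa using this.tendsto (r, r)
    have h3 := h2.eventually h1
    rw [nhds_prod_eq] at h3
    obtain ⟨V, hV, hVQ⟩ := eventually_prod_self_iff'.1 h3
    obtain ⟨W, hWV, hW, hrW⟩ := mem_nhds_iff.1 hV
    exact ⟨W, hW, hrW, fun a ha b hb => ⟨Φ, hVQ a (hWV ha) b (hWV hb)⟩⟩
  choose V hVo hrV hVQ using hlocal
  obtain ⟨τ, hτ0, hmono, ⟨k, hk⟩, hτ⟩ := exists_monotone_Icc_subset_open_cover_Icc hs hVo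
    (fun r _ => mem_iUnion.2 ⟨r, hrV r⟩)
  have key : ∀ j, Q 0 (τ j) := by
    intro j
    induction j with
    | zero =>
      rw [hτ0]
      obtain ⟨r, hr⟩ := hτ 0
      have := hVQ r _ (hr (left_mem_Icc.2 (hmono (Nat.zero_le 1)))) _
        (hr (left_mem_Icc.2 (hmono (Nat.zero_le 1))))
      rwa [hτ0] at this
    | succ j ih =>
      -- For a trivial piece the remaining time could be negative at nearby parameters, and the
      -- concatenation below uses times of the same sign.
      rcases (hmono (Nat.le_succ j)).eq_or_lt with heq | hlt
      · rw [Nat.succ_eq_add_one] at heq; rw [← heq]; exact ih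
      obtain ⟨r, hr⟩ := hτ j
      obtain ⟨Ψ₁, hΨ₁, hF₁⟩ := ih
      obtain ⟨Ψ₂, hΨ₂, hF₂⟩ := hVQ r _ (hr (left_mem_Icc.2 hlt.le)) _ (hr (right_mem_Icc.2 hlt.le))
      have hlt' : (τ j : ℝ) < τ (j + 1) := hlt
      have hv := hval 0 ⟨le_rfl, hs⟩ (τ j) (τ j).2 (τ j).2.1 Ψ₁ hF₁
      rw [sub_zero] at hv hΨ₁ hF₁
      have hi1 : AnalyticAt ℝ (fun p : ℝ × Ext n m => ((τ j : ℝ), p.2))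
          ((τ (j + 1) : ℝ) - 0, c 0) := analyticAt_const.prod analyticAt_snd
      have hi2 : AnalyticAt ℝ (fun p : ℝ × Ext n m => Ψ₁ ((τ j : ℝ), p.2))
          ((τ (j + 1) : ℝ) - 0, c 0) :=
        AnalyticAt.fun_comp (g := Ψ₁) (f := fun p : ℝ × Ext n m => ((τ j : ℝ), p.2)) hΨ₁ hi1
      have hi3 : AnalyticAt ℝ (fun p : ℝ × Ext n m => (p.1 - τ j, Ψ₁ ((τ j : ℝ), p.2)))
          ((τ (j + 1) : ℝ) - 0, c 0) := (analyticAt_fst.sub analyticAt_const).prod hi2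
      have hpt : (((τ (j + 1) : ℝ) - 0, c 0).1 - (τ j : ℝ), Ψ₁ ((τ j : ℝ),
          ((τ (j + 1) : ℝ) - 0, c 0).2)) = ((τ (j + 1) : ℝ) - τ j, c (τ j)) := by
        simp only [sub_zero, hv]
      refine ⟨fun p => Ψ₂ (p.1 - τ j, Ψ₁ ((τ j : ℝ), p.2)), ?_, ?_⟩
      · exact AnalyticAt.fun_comp (g := Ψ₂)
          (f := fun p : ℝ × Ext n m => (p.1 - τ j, Ψ₁ ((τ j : ℝ), p.2))) (by rw [hpt]; exact hΨ₂) hi3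
      · have e1 := hi1.continuousAt.eventually hF₁
        have e2 := hi3.continuousAt.eventually (p := fun q => FlowsTo D X q.1 q.2 (Ψ₂ q))
          (by beta_reduce; rw [hpt]; exact hF₂)
        have e3 : ∀ᶠ p : ℝ × Ext n m in 𝓝 ((τ (j + 1) : ℝ) - 0, c 0), (τ j : ℝ) < p.1 := by
          have : Tendsto (fun p : ℝ × Ext n m => p.1) (𝓝 ((τ (j + 1) : ℝ) - 0, c 0))
              (𝓝 (τ (j + 1) : ℝ)) := by
            simpa using (continuous_fst.tendsto ((τ (j + 1) : ℝ) - 0, c 0))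
          exact this.eventually (lt_mem_nhds hlt')
        filter_upwards [e1, e2, e3] with p h1 h2 h3
        have := FlowsTo.trans_of_nonneg (τ j).2.1 (sub_nonneg.2 h3.le) h1 h2
        rwa [add_sub_cancel] at this
  have := key k
  rw [hk k le_rfl] at this
  simpa [Q] using this

lemma exists_analytic_flow (hD : IsOpen D) (hX : AnalyticOnNhd ℝ X D)
    (h : FlowsTo D X s x y) : ∃ Ψ : ℝ × Ext n m → Ext n m, AnalyticAt ℝ Ψ (s, x) ∧
      ∀ᶠ p in 𝓝 (s, x), FlowsTo D X p.1 p.2 (Ψ p) := by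
  rcases le_total 0 s with hs | hs
  · exact exists_analytic_flow_of_nonneg hD hX hs h
  · obtain ⟨Ψ, hΨ, hF⟩ := exists_analytic_flow_of_nonneg hD hX.neg (by linarith) h.neg_field
    have hi : AnalyticAt ℝ (fun p : ℝ × Ext n m => (-p.1, p.2)) (s, x) :=
      analyticAt_fst.neg.prod analyticAt_snd
    refine ⟨fun p => Ψ (-p.1, p.2), AnalyticAt.fun_comp (g := Ψ) hΨ hi, ?_⟩
    filter_upwards [hi.continuousAt.eventually hF] with p hp
    exact flowsTo_neg_field_iff.1 hp

/-- The flow of an analytic field, as a function of time and of the initial point. -/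
noncomputable def flow (D : Set (Ext n m)) (X : Ext n m → Ext n m) (p : ℝ × Ext n m) : Ext n m :=
  flowMap D X p.1 p.2

lemma eventually_flowsTo (hD : IsOpen D) (hX : AnalyticOnNhd ℝ X D) (h : x ∈ flowDom D X s) :
    ∀ᶠ p in 𝓝 (s, x), FlowsTo D X p.1 p.2 (flow D X p) := by
  obtain ⟨Ψ, -, hF⟩ := exists_analytic_flow hD hX h.choose_spec
  exact hF.mono fun p hp => flowsTo_flowMap ⟨_, hp⟩

theorem analyticAt_flow (hD : IsOpen D) (hX : AnalyticOnNhd ℝ X D) (h : x ∈ flowDom D X s) :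
    AnalyticAt ℝ (flow D X) (s, x) := by
  obtain ⟨Ψ, hΨ, hF⟩ := exists_analytic_flow hD hX h.choose_spec
  exact hΨ.congr (hF.mono fun p hp => (flowMap_eq hX hp).symm)

lemma isOpen_flowDom (hD : IsOpen D) (hX : AnalyticOnNhd ℝ X D) : IsOpen (flowDom D X s) := by
  refine isOpen_iff_mem_nhds.2 fun x hx => ?_
  have : Tendsto (fun x : Ext n m => (s, x)) (𝓝 x) (𝓝 (s, x)) :=
    (Continuous.prodMk_right s).tendsto x
  filter_upwards [this.eventually (eventually_flowsTo hD hX hx)] with z hz using ⟨_, hz⟩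

lemma mem_flowDom_zero (hx : x ∈ D) : x ∈ flowDom D X 0 := ⟨x, FlowsTo.zero hx⟩

lemma flowMap_zero (hX : AnalyticOnNhd ℝ X D) (hx : x ∈ D) : flowMap D X 0 x = x :=
  flowMap_eq hX (FlowsTo.zero hx)

lemma mem_flowDom_neg (h : x ∈ flowDom D X s) : flowMap D X s x ∈ flowDom D X (-s) :=
  ⟨x, (flowsTo_flowMap h).symm⟩

lemma flowMap_flowMap_neg (hX : AnalyticOnNhd ℝ X D) (h : x ∈ flowDom D X (-s)) :
    flowMap D X s (flowMap D X (-s) x) = x := by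
  refine flowMap_eq hX ?_
  simpa using (flowsTo_flowMap h).symm

lemma flowMap_mem_flowDom (h : x ∈ flowDom D X (-s)) : flowMap D X (-s) x ∈ flowDom D X s := by
  simpa using mem_flowDom_neg h

lemma FlowsTo.of_mem_uIcc {c : ℝ → Ext n m}
    (hc : ∀ r ∈ uIcc 0 s, c r ∈ D ∧ HasDerivWithinAt c (X (c r)) (uIcc 0 s) r) (ht : t ∈ uIcc 0 s) :
    FlowsTo D X t (c 0) (c t) :=
  ⟨c, rfl, rfl, fun r hr => ⟨(hc r (uIcc_subset_uIcc_left ht hr)).1,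
    (hc r (uIcc_subset_uIcc_left ht hr)).2.mono (uIcc_subset_uIcc_left ht)⟩⟩

lemma mem_flowDom_of_mem_uIcc (h : x ∈ flowDom D X s) (ht : t ∈ uIcc 0 s) : x ∈ flowDom D X t := by
  obtain ⟨y, c, rfl, -, hc⟩ := h
  exact ⟨_, FlowsTo.of_mem_uIcc hc ht⟩

/-- An integral curve on a closed interval only has a one-sided derivative at its end. Analyticity
of the flow gives a two-sided one, and the two agree. -/
theorem hasDerivAt_flowMap (hD : IsOpen D) (hX : AnalyticOnNhd ℝ X D) (h : x ∈ flowDom D X s) :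
    HasDerivAt (fun r => flowMap D X r x) (X (flowMap D X s x)) s := by
  -- For s = 0 the interval is a point and determines no derivative, so it is enlarged first.
  obtain ⟨t, ht0, hst, hxt⟩ : ∃ t, t ≠ 0 ∧ s ∈ uIcc 0 t ∧ x ∈ flowDom D X t := by
    by_cases hs : s = 0
    · subst hs
      have : Tendsto (fun r : ℝ => (r, x)) (𝓝 0) (𝓝 (0, x)) :=
        (Continuous.prodMk_left x).tendsto 0
      obtain ⟨t, ht, ht0⟩ := (((this.eventually (eventually_flowsTo hD hX h)).filter_mono
        nhdsWithin_le_nhds).and (self_mem_nhdsWithin (a := (0 : ℝ)) (s := Ioi 0))).exists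
      exact ⟨t, (ne_of_gt ht0), left_mem_uIcc, _, ht⟩
    · exact ⟨s, hs, right_mem_uIcc, h⟩
  obtain ⟨y, c, rfl, -, hc⟩ := hxt
  have heq : ∀ r ∈ uIcc 0 t, flowMap D X r (c 0) = c r := fun r hr =>
    flowMap_eq hX (FlowsTo.of_mem_uIcc hc hr)
  have han : AnalyticAt ℝ (fun r => flowMap D X r (c 0)) s :=
    AnalyticAt.fun_comp (g := flow D X) (f := fun r : ℝ => (r, c 0)) (analyticAt_flow hD hX h)
      (analyticAt_id.prod analyticAt_const)
  have h1 := han.differentiableAt.hasDerivAt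
  have h2 : HasDerivWithinAt (fun r => flowMap D X r (c 0)) (X (c s)) (uIcc 0 t) s :=
    (hc s hst).2.congr heq (heq s hst)
  have hud : UniqueDiffWithinAt ℝ (uIcc 0 t) s := by
    rw [uIcc]
    refine uniqueDiffOn_Icc ?_ s hst
    rcases lt_or_gt_of_ne ht0 with h | h
    · rw [min_eq_right h.le, max_eq_left h.le]; exact h
    · rw [min_eq_left h.le, max_eq_right h.le]; exact h
  rw [heq s hst]
  have h3 := hud.eq_deriv _ h1.hasDerivWithinAt h2
  rwa [← h3]

/-- The infinitesimal form of `Φ_{s + h} ∘ Φ_{-h} = Φ_s`. -/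
theorem fderiv_flow_apply (hD : IsOpen D) (hX : AnalyticOnNhd ℝ X D) (h : x ∈ flowDom D X s) :
    fderiv ℝ (flow D X) (s, x) (1, -X x) = 0 := by
  have hx : x ∈ D := h.choose_spec.mem_left
  have hx0 : x ∈ flowDom D X 0 := mem_flowDom_zero hx
  have hback : HasDerivAt (fun r => flowMap D X (-r) x) (-X x) 0 := by
    have h1 : HasDerivAt (fun r => flowMap D X r x) (X x) (-0) := by
      have := hasDerivAt_flowMap hD hX hx0
      rw [flowMap_zero hX hx] at this
      rwa [neg_zero]
    simpa [Function.comp_def] using HasDerivAt.scomp (0 : ℝ) h1 (hasDerivAt_neg (0 : ℝ))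
  have hpair : HasDerivAt (fun r : ℝ => (s + r, flowMap D X (-r) x)) (1, -X x) 0 := by
    have := ((hasDerivAt_id (0 : ℝ)).const_add s).prodMk hback
    simpa using this
  have hk : HasDerivAt (fun r => flow D X (s + r, flowMap D X (-r) x))
      (fderiv ℝ (flow D X) (s, x) (1, -X x)) 0 := by
    have hpt : (s + 0, flowMap D X (-0) x) = (s, x) := by
      simp [flowMap_zero hX hx]
    refine HasFDerivAt.comp_hasDerivAt (0 : ℝ) (l := flow D X)
      (f := fun r : ℝ => (s + r, flowMap D X (-r) x)) ?_ hpair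
    rw [hpt]
    exact (analyticAt_flow hD hX h).differentiableAt.hasFDerivAt
  have hev : ∀ᶠ r : ℝ in 𝓝 0, x ∈ flowDom D X (-r) := by
    have : Tendsto (fun r : ℝ => (-r, x)) (𝓝 0) (𝓝 (0, x)) := by
      have : Continuous (fun r : ℝ => (-r, x)) := by fun_prop
      simpa using this.tendsto 0
    exact (this.eventually (eventually_flowsTo hD hX hx0)).mono fun r hr => ⟨_, hr⟩
  -- Only r of the sign of s are considered, where flows concatenate. A half-line suffices, as the
  -- two-sided derivative is known to exist.
  have hconst : ∀ r : ℝ, x ∈ flowDom D X (-r) → (0 ≤ s ∧ 0 ≤ r ∨ s ≤ 0 ∧ r ≤ 0) →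
      flow D X (s + r, flowMap D X (-r) x) = flowMap D X s x := by
    intro r hr hsgn
    have h1 : FlowsTo D X r (flowMap D X (-r) x) x := by
      simpa using (flowsTo_flowMap hr).symm
    refine flowMap_eq hX ?_
    rw [add_comm]
    rcases hsgn with ⟨h2, h3⟩ | ⟨h2, h3⟩
    · exact h1.trans_of_nonneg h3 h2 (flowsTo_flowMap h)
    · exact h1.trans_of_nonpos h3 h2 (flowsTo_flowMap h)
  rcases le_total 0 s with hs | hs
  · refine (uniqueDiffWithinAt_Ici (0 : ℝ)).eq_deriv _ hk.hasDerivWithinAt ?_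
    refine (hasDerivWithinAt_const (0 : ℝ) (Ici 0) (flowMap D X s x)).congr_of_eventuallyEq ?_ ?_
    · filter_upwards [hev.filter_mono nhdsWithin_le_nhds, self_mem_nhdsWithin] with r h1 h2
      exact hconst r h1 (Or.inl ⟨hs, h2⟩)
    · exact hconst 0 hev.self_of_nhds (Or.inl ⟨hs, le_rfl⟩)
  · refine (uniqueDiffWithinAt_Iic (0 : ℝ)).eq_deriv _ hk.hasDerivWithinAt ?_
    refine (hasDerivWithinAt_const (0 : ℝ) (Iic 0) (flowMap D X s x)).congr_of_eventuallyEq ?_ ?_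
    · filter_upwards [hev.filter_mono nhdsWithin_le_nhds, self_mem_nhdsWithin] with r h1 h2
      exact hconst r h1 (Or.inr ⟨hs, h2⟩)
    · exact hconst 0 hev.self_of_nhds (Or.inr ⟨hs, le_rfl⟩)

end Flows

/-! ### Push-forwards and iterated brackets -/

section PushForward

variable {n m : ℕ} {D : Set (Ext n m)} {S Z : Ext n m → Ext n m} {s t τ : ℝ} {x y : Ext n m}

lemma analyticAt_lieBracket {E : Type*} [NormedAddCommGroup E] [NormedSpace ℝ E] [CompleteSpace E]
    {V W : E → E} {x : E} (hV : AnalyticAt ℝ V x)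
    (hW : AnalyticAt ℝ W x) : AnalyticAt ℝ (VectorField.lieBracket ℝ V W) x :=
  (analyticAt_clm_apply hW.fderiv hV).sub (analyticAt_clm_apply hV.fderiv hW)

lemma fderiv_flowMap (hD : IsOpen D) (hS : AnalyticOnNhd ℝ S D) (h : x ∈ flowDom D S s)
    (v : Ext n m) : fderiv ℝ (flowMap D S s) x v = fderiv ℝ (flow D S) (s, x) (0, v) := by
  have h1 : HasFDerivAt (flowMap D S s)
      (fderiv ℝ (flow D S) (s, x) ∘L ContinuousLinearMap.inr ℝ ℝ (Ext n m)) x :=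
    HasFDerivAt.comp (g := flow D S) (f := fun x => (s, x)) x
      (analyticAt_flow hD hS h).differentiableAt.hasFDerivAt (hasFDerivAt_prodMk_right s x)
  rw [h1.fderiv]
  rfl

lemma analyticAt_flow_neg (hD : IsOpen D) (hS : AnalyticOnNhd ℝ S D) (hy : y ∈ flowDom D S (-τ)) :
    AnalyticAt ℝ (fun p : ℝ × Ext n m => flow D S (-p.1, p.2)) (τ, y) :=
  AnalyticAt.fun_comp (g := flow D S) (f := fun p : ℝ × Ext n m => (-p.1, p.2))
    (analyticAt_flow hD hS hy) (analyticAt_fst.neg.prod analyticAt_snd)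

lemma pushFlow_eq (hD : IsOpen D) (hS : AnalyticOnNhd ℝ S D) (hy : y ∈ flowDom D S (-τ)) :
    pushFlow D S τ Z y = fderiv ℝ (flow D S) (τ, flow D S (-τ, y)) (0, Z (flow D S (-τ, y))) :=
  fderiv_flowMap hD hS (flowMap_mem_flowDom hy) _

lemma eventually_mem_flowDom_neg (hD : IsOpen D) (hS : AnalyticOnNhd ℝ S D)
    (hy : y ∈ flowDom D S (-τ)) : ∀ᶠ p in 𝓝 (τ, y), p.2 ∈ flowDom D S (-p.1) := by
  have h1 : Tendsto (fun p : ℝ × Ext n m => (-p.1, p.2)) (𝓝 (τ, y)) (𝓝 (-τ, y)) := by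
    have : Continuous (fun p : ℝ × Ext n m => (-p.1, p.2)) := by fun_prop
    exact this.tendsto (τ, y)
  filter_upwards [h1.eventually (eventually_flowsTo hD hS hy)] with p hp using ⟨_, hp⟩

theorem analyticAt_pushFlow (hD : IsOpen D) (hS : AnalyticOnNhd ℝ S D) (hZ : AnalyticOnNhd ℝ Z D)
    (hy : y ∈ flowDom D S (-τ)) :
    AnalyticAt ℝ (fun p : ℝ × Ext n m => pushFlow D S p.1 Z p.2) (τ, y) := by
  have hx := flowMap_mem_flowDom hy
  have hc := analyticAt_flow_neg hD hS hy
  have h1 : AnalyticAt ℝ (fun p : ℝ × Ext n m =>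
      fderiv ℝ (flow D S) (p.1, flow D S (-p.1, p.2))) (τ, y) :=
    AnalyticAt.fun_comp (g := fderiv ℝ (flow D S))
      (f := fun p : ℝ × Ext n m => (p.1, flow D S (-p.1, p.2)))
      (analyticAt_flow hD hS hx).fderiv (analyticAt_fst.prod hc)
  have h2 : AnalyticAt ℝ (fun p : ℝ × Ext n m => Z (flow D S (-p.1, p.2))) (τ, y) :=
    AnalyticAt.fun_comp (g := Z) (f := fun p : ℝ × Ext n m => flow D S (-p.1, p.2))
      (hZ _ hx.choose_spec.mem_left) hc
  refine (analyticAt_clm_apply (v := fun p : ℝ × Ext n m => ((0 : ℝ), Z (flow D S (-p.1, p.2)))) h1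
    (analyticAt_const.prod h2)).congr ?_
  filter_upwards [eventually_mem_flowDom_neg hD hS hy] with p hp
  exact (pushFlow_eq hD hS hp).symm

lemma analyticAt_surrogate (hD : IsOpen D) (hS : AnalyticOnNhd ℝ S D) (hZ : AnalyticOnNhd ℝ Z D)
    (hy : y ∈ flowDom D S (-τ)) : AnalyticAt ℝ (pushFlow D S τ Z) y :=
  AnalyticAt.fun_comp (g := fun p : ℝ × Ext n m => pushFlow D S p.1 Z p.2) (f := fun y => (τ, y))
    (analyticAt_pushFlow hD hS hZ hy) (analyticAt_const.prod analyticAt_id)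

/-- The push-forward of a field by the flow of `S` is differentiable with respect to time. -/
theorem hasDerivAt_pushFlow (hD : IsOpen D) (hS : AnalyticOnNhd ℝ S D) (hZ : AnalyticOnNhd ℝ Z D)
    (hy : y ∈ flowDom D S (-τ)) :
    HasDerivAt (fun t => pushFlow D S t Z y)
      (-pushFlow D S τ (VectorField.lieBracket ℝ S Z) y) τ := by
  set x := flow D S (-τ, y) with hxdef
  have hx : x ∈ flowDom D S τ := flowMap_mem_flowDom hy
  have hxD : x ∈ D := hx.choose_spec.mem_left
  have hΦ := analyticAt_flow hD hS hx
  have hΦ2 : HasFDerivAt (fderiv ℝ (flow D S)) (fderiv ℝ (fderiv ℝ (flow D S)) (τ, x)) (τ, x) :=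
    hΦ.fderiv.differentiableAt.hasFDerivAt
  have hc : HasDerivAt (fun t => flow D S (-t, y)) (-S x) τ := by
    have := HasDerivAt.scomp τ (hasDerivAt_flowMap hD hS hy) (hasDerivAt_neg τ)
    rw [neg_one_smul] at this
    exact this
  have hpair : HasDerivAt (fun t => (t, flow D S (-t, y))) (1, -S x) τ := (hasDerivAt_id τ).prodMk hc
  have hL : HasDerivAt (fun t => fderiv ℝ (flow D S) (t, flow D S (-t, y)))
      (fderiv ℝ (fderiv ℝ (flow D S)) (τ, x) (1, -S x)) τ :=
    HasFDerivAt.comp_hasDerivAt τ (l := fderiv ℝ (flow D S)) (f := fun t => (t, flow D S (-t, y)))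
      hΦ2 hpair
  have hZx : HasFDerivAt Z (fderiv ℝ Z x) x := (hZ x hxD).differentiableAt.hasFDerivAt
  have hv : HasDerivAt (fun t => ((0, Z (flow D S (-t, y))) : ℝ × Ext n m))
      (0, fderiv ℝ Z x (-S x)) τ :=
    (hasDerivAt_const τ (0 : ℝ)).prodMk
      (HasFDerivAt.comp_hasDerivAt τ (l := Z) (f := fun t => flow D S (-t, y)) hZx hc)
  have hF := hL.clm_apply hv
  -- The symmetric second derivative turns the variation of DΦ along the backward curve into a
  -- derivative in the direction Z, which `hinv` computes by differentiating DΦ (1, -S) = 0.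
  have hsymm : fderiv ℝ (fderiv ℝ (flow D S)) (τ, x) (1, -S x) (0, Z x) =
      fderiv ℝ (fderiv ℝ (flow D S)) (τ, x) (0, Z x) (1, -S x) :=
    (hΦ.contDiffAt (n := 2)).isSymmSndFDerivAt (by simp) _ _
  have hinv : fderiv ℝ (fderiv ℝ (flow D S)) (τ, x) (0, Z x) (1, -S x) +
      fderiv ℝ (flow D S) (τ, x) (0, -fderiv ℝ S x (Z x)) = 0 := by
    have hSx : HasFDerivAt S (fderiv ℝ S x) x := (hS x hxD).differentiableAt.hasFDerivAt
    have hline : HasDerivAt (fun r : ℝ => x + r • Z x) (Z x) 0 := by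
      simpa using ((hasDerivAt_id (0 : ℝ)).smul_const (Z x)).const_add x
    have hline0 : x + (0 : ℝ) • Z x = x := by simp
    have h1 : HasDerivAt (fun r : ℝ => fderiv ℝ (flow D S) (τ, x + r • Z x))
        (fderiv ℝ (fderiv ℝ (flow D S)) (τ, x) (0, Z x)) 0 := by
      refine HasFDerivAt.comp_hasDerivAt (0 : ℝ) (l := fderiv ℝ (flow D S))
        (f := fun r : ℝ => (τ, x + r • Z x)) ?_ ((hasDerivAt_const (0 : ℝ) τ).prodMk hline)
      rw [hline0]
      exact hΦ2
    have h2 : HasDerivAt (fun r : ℝ => ((1, -S (x + r • Z x)) : ℝ × Ext n m))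
        (0, -fderiv ℝ S x (Z x)) 0 := by
      refine (hasDerivAt_const (0 : ℝ) (1 : ℝ)).prodMk (HasDerivAt.neg ?_)
      refine HasFDerivAt.comp_hasDerivAt (0 : ℝ) (l := S) (f := fun r : ℝ => x + r • Z x) ?_ hline
      rw [hline0]
      exact hSx
    have h3 := h1.clm_apply h2
    rw [hline0] at h3
    refine h3.unique ((hasDerivAt_const (0 : ℝ) (0 : Ext n m)).congr_of_eventuallyEq ?_)
    have h4 : ∀ᶠ r in 𝓝 (0 : ℝ), x + r • Z x ∈ flowDom D S τ :=
      hline.continuousAt.eventually ((isOpen_flowDom hD hS).mem_nhds (by beta_reduce; rw [hline0]; exact hx))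
    filter_upwards [h4] with r hr
    exact fderiv_flow_apply hD hS hr
  have hval : fderiv ℝ (fderiv ℝ (flow D S)) (τ, x) (1, -S x) (0, Z x) +
      fderiv ℝ (flow D S) (τ, x) (0, fderiv ℝ Z x (-S x)) =
      -pushFlow D S τ (VectorField.lieBracket ℝ S Z) y := by
    rw [pushFlow_eq hD hS hy, ← hxdef, hsymm, eq_neg_of_add_eq_zero_left hinv, ← map_neg, ← map_neg,
      ← map_add, VectorField.lieBracket]
    rw [← map_neg]
    congr 1
    simp
    abel
  rw [← hval]
  refine hF.congr_of_eventuallyEq ?_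
  have h5 : Tendsto (fun t : ℝ => (t, y)) (𝓝 τ) (𝓝 (τ, y)) := (Continuous.prodMk_left y).tendsto τ
  filter_upwards [h5.eventually (eventually_mem_flowDom_neg hD hS hy)] with t ht
  exact pushFlow_eq hD hS ht

lemma pushFlow_zero (hD : IsOpen D) (hS : AnalyticOnNhd ℝ S D) (hy : y ∈ D) :
    pushFlow D S 0 Z y = Z y := by
  have hev : flowMap D S 0 =ᶠ[𝓝 y] id := by
    filter_upwards [hD.mem_nhds hy] with z hz using flowMap_zero hS hz
  rw [pushFlow, neg_zero, flowMap_zero hS hy, hev.fderiv_eq, fderiv_id]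
  rfl

/-- A function is zero near a point if it is analytic there and the derivatives of all orders
vanish at that point. -/
lemma eventually_eq_zero_of_hasDerivAt {g : ℕ → ℝ → ℝ} (h0 : AnalyticAt ℝ (g 0) 0)
    (hd : ∀ k, ∀ᶠ t in 𝓝 0, HasDerivAt (g k) (-g (k + 1) t) t) (hz : ∀ k, g k 0 = 0) :
    ∀ᶠ t in 𝓝 0, g 0 t = 0 := by
  have hit : ∀ k, ∀ᶠ t in 𝓝 0, iteratedDeriv k (g 0) t = (-1) ^ k * g k t := by
    intro k
    induction k with
    | zero => simp
    | succ k ih =>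
      filter_upwards [eventually_eventually_nhds.2 ih, hd k] with t ht htd
      rw [iteratedDeriv_succ, EventuallyEq.deriv_eq ht, (htd.const_mul _).deriv]
      ring
  have hp := h0.hasFPowerSeriesAt
  have hzero : FormalMultilinearSeries.ofScalars ℝ
      (fun k : ℕ => iteratedDeriv k (g 0) 0 / (k.factorial : ℝ)) = 0 := by
    have : (fun k : ℕ => iteratedDeriv k (g 0) 0 / (k.factorial : ℝ)) = 0 := by
      funext k
      rw [(hit k).self_of_nhds, hz]
      simp
    rw [this]
    simp
  rw [hzero] at hp
  exact hp.eventually_eq_zero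

lemma adField_succ (S : Ext n m → Ext n m) (k : ℕ) (α : Fin m) :
    adField S (k + 1) α = VectorField.lieBracket ℝ S (adField S k α) :=
  Function.iterate_succ_apply' _ _ _

lemma adField_zero (S : Ext n m → Ext n m) (α : Fin m) :
    adField S 0 α = vert (Pi.single α 1) := rfl

lemma analyticAt_adField (hS : AnalyticAt ℝ S x) (k : ℕ) (α : Fin m) :
    AnalyticAt ℝ (adField S k α) x := by
  induction k with
  | zero => exact analyticAt_const
  | succ k ih => rw [adField_succ]; exact analyticAt_lieBracket hS ih

lemma sum_smul_vert (lam : Fin m → ℝ) (x : Ext n m) :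
    ∑ α, lam α • vert (Pi.single α 1) x = ((0, 0, lam) : Ext n m) := by
  have : (fun α : Fin m => lam α • (vert (Pi.single α 1) x : Ext n m)) =
      fun α => ((0, 0, lam α • Pi.single α 1) : Ext n m) := by
    funext α; simp [vert]
  rw [this]
  refine Prod.ext ?_ (Prod.ext ?_ ?_)
  · simp [Prod.fst_sum]
  · simp [Prod.fst_sum, Prod.snd_sum]
  · simp only [Prod.snd_sum]
    funext β
    simp [Finset.sum_apply, Pi.single_apply]

lemma surrogate_eq_sum (lam : Fin m → ℝ) (y : Ext n m) :
    surrogate D S τ lam y = ∑ α, lam α • pushFlow D S τ (adField S 0 α) y := by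
  simp only [surrogate, pushFlow, adField_zero, ← map_smul, ← map_sum, sum_smul_vert]
  rfl

/-- The values of surrogate fields are combinations of the values of the iterated brackets. -/
theorem surrogate_mem_span (hD : IsOpen D) (hS : AnalyticOnNhd ℝ S D) (hτ : 0 ≤ τ)
    (lam : Fin m → ℝ) (hy : y ∈ surrogateDom D S τ) :
    surrogate D S τ lam y ∈
      Submodule.span ℝ (range fun i : ℕ × Fin m => adField S i.1 i.2 y) := by
  by_contra hnot
  -- A linear form that separates the surrogate vector from the brackets. Along t ↦ Φ_{t*}(∂/∂w^α)
  -- at y, its derivatives at 0 are, up to sign, its values on the brackets.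
  obtain ⟨ℓ, hℓ, hker⟩ := Submodule.exists_le_ker_of_notMem hnot
  have hyD : y ∈ D := hy.choose_spec.mem_left
  let L : Ext n m →L[ℝ] ℝ := LinearMap.toContinuousLinearMap ℓ
  have hzero : ∀ α, ℓ (pushFlow D S τ (adField S 0 α) y) = 0 := by
    intro α
    have hdom : ∀ t ∈ Icc 0 τ, y ∈ flowDom D S (-t) := by
      intro t ht
      refine mem_flowDom_of_mem_uIcc hy ?_
      rw [uIcc_of_ge (by linarith)]
      exact ⟨by linarith [ht.2], by linarith [ht.1]⟩
    have had : ∀ k, AnalyticOnNhd ℝ (adField S k α) D := fun k x hx => analyticAt_adField (hS x hx) k α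
    let g : ℕ → ℝ → ℝ := fun k t => L (pushFlow D S t (adField S k α) y)
    have han : AnalyticOnNhd ℝ (g 0) (Icc 0 τ) := by
      intro t ht
      refine (L.analyticAt _).fun_comp ?_
      exact AnalyticAt.fun_comp (g := fun p : ℝ × Ext n m => pushFlow D S p.1 (adField S 0 α) p.2)
        (f := fun t => (t, y)) (analyticAt_pushFlow hD hS (had 0) (hdom t ht))
        (analyticAt_id.prod analyticAt_const)
    have hev : ∀ᶠ t in 𝓝 (0 : ℝ), y ∈ flowDom D S (-t) := by
      have h5 : Tendsto (fun t : ℝ => (t, y)) (𝓝 0) (𝓝 (0, y)) := (Continuous.prodMk_left y).tendsto 0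
      exact h5.eventually (eventually_mem_flowDom_neg hD hS (by
        rw [neg_zero]; exact mem_flowDom_zero hyD))
    have hd : ∀ k, ∀ᶠ t in 𝓝 0, HasDerivAt (g k) (-g (k + 1) t) t := by
      intro k
      filter_upwards [hev] with t ht
      have h1 := hasDerivAt_pushFlow hD hS (had k) ht
      rw [← adField_succ] at h1
      have h2 := L.hasFDerivAt.comp_hasDerivAt t h1
      simpa [g, Function.comp_def] using h2
    have hz : ∀ k, g k 0 = 0 := by
      intro k
      change ℓ (pushFlow D S 0 (adField S k α) y) = 0
      rw [pushFlow_zero hD hS hyD]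
      exact hker (Submodule.subset_span ⟨(k, α), rfl⟩)
    have h0 : (0 : ℝ) ∈ Icc 0 τ := ⟨le_rfl, hτ⟩
    exact han.eqOn_zero_of_preconnected_of_eventuallyEq_zero isPreconnected_Icc h0
      (eventually_eq_zero_of_hasDerivAt (han 0 h0) hd hz) ⟨hτ, le_rfl⟩
  refine hℓ ?_
  rw [surrogate_eq_sum, map_sum]
  exact Finset.sum_eq_zero fun α _ => by rw [map_smul, hzero, smul_zero]

lemma iterBracket_adField {f : Ext n m → (Fin n → ℝ)} {K : Set (Fin m → ℝ)} {U : Set (Ext n m)}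
    (hS : IsSection f K U S) (k : ℕ) (α : Fin m) : IterBracket f K U (adField S k α) := by
  induction k with
  | zero => exact .vertical _ (fun _ _ => analyticAt_const) (fun _ _ => ⟨rfl, rfl⟩)
  | succ k ih => rw [adField_succ]; exact .bracket _ _ hS ih

/-- A pointwise statement, so a combination of brackets with constant coefficients that has the
right value at y is enough; it need not agree with the surrogate field elsewhere. -/
theorem surrogate_mem_fibre {f : Ext n m → (Fin n → ℝ)} {K : Set (Fin m → ℝ)}
    (hS : IsSection f K D S) (hτ : 0 ≤ τ) (lam : Fin m → ℝ) (hy : y ∈ surrogateDom D S τ) :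
    surrogate D S τ lam y ∈ fibre K (Secondary f K) y ∧
      surrogate D S τ lam y ∈ fibre K (SecondaryOf S) y := by
  have hyD : y ∈ D := hy.choose_spec.mem_left
  obtain ⟨N, c, v, hv⟩ := Submodule.mem_span_set'.1 (surrogate_mem_span hS.1 hS.2.2.1 hτ lam hy)
  choose i hi using fun j => (v j).2
  let Y : Ext n m → Ext n m := fun x => ∑ j, c j • adField S (i j).1 (i j).2 x
  have hY : Y y = surrogate D S τ lam y := by
    rw [← hv]
    exact Finset.sum_congr rfl fun j _ => by rw [← hi]
  exact ⟨⟨D, Y, hS.1, hS.2.1, hyD, ⟨N, fun j => adField S (i j).1 (i j).2, fun j _ => c j,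
      fun j => iterBracket_adField hS _ _, fun j _ _ => analyticAt_const, fun _ _ => rfl⟩, hY⟩,
    ⟨D, Y, hS.1, hS.2.1, hyD, ⟨N, fun j => adField S (i j).1 (i j).2, fun j _ => c j,
      fun j => ⟨_, _, rfl⟩, fun j _ _ => analyticAt_const, fun _ _ => rfl⟩, hY⟩⟩

end PushForward

/-! ### Surrogate flows and attainable points -/

section Attainability

variable {n m : ℕ} {D : Set (Ext n m)} {S : Ext n m → Ext n m} {s τ : ℝ} {x y z : Ext n m}
  {f : Ext n m → (Fin n → ℝ)} {K : Set (Fin m → ℝ)} {Ω : Set (Ext n m)} {xo yo : Ext n m}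

lemma isOpen_extSpace (hK : IsOpen K) : IsOpen (extSpace n K) :=
  hK.preimage (by fun_prop : Continuous fun x : Ext n m => x.2.2)

/-- A solution arc is an integral curve of a section. -/
theorem exists_isAdaptedSection (hK : IsOpen K) (hf : AnalyticOnNhd ℝ f (extSpace n K))
    {q : ℝ → (Fin n → ℝ)} {w : ℝ → (Fin m → ℝ)} {a b : ℝ}
    (hw : AnalyticOnNhd ℝ w (Icc a b))
    (hq : ∀ t ∈ Icc a b, w t ∈ K ∧ HasDerivAt q (f (t, q t, w t)) t) :
    ∃ Ω S, IsAdaptedSection f K q w a b Ω S := by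
  -- The controls are driven by the velocity of the given control curve, which depends on time only.
  refine ⟨extSpace n K ∩ {x | AnalyticAt ℝ w x.1}, fun x => (1, f x, deriv w x.1),
    ⟨(isOpen_extSpace hK).inter ((isOpen_analyticAt ℝ w).preimage continuous_fst),
      inter_subset_left, fun x hx => ?_, fun x _ => ⟨rfl, rfl⟩⟩, fun t ht => ⟨⟨(hq t ht).1, hw t ht⟩,
      (hasDerivAt_id t).prodMk ((hq t ht).2.prodMk (hw t ht).differentiableAt.hasDerivAt)⟩⟩
  exact analyticAt_const.prod ((hf x hx.1).prod
    (AnalyticAt.fun_comp (g := deriv w) (f := fun x : Ext n m => x.1) (AnalyticAt.deriv hx.2)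
      analyticAt_fst))

lemma IsAdaptedSection.flowsTo {q : ℝ → (Fin n → ℝ)} {w : ℝ → (Fin m → ℝ)} {a b : ℝ}
    (h : IsAdaptedSection f K q w a b Ω S) (h0 : 0 ≤ τ) (h1 : τ ≤ b - a) :
    FlowsTo Ω S (-τ) (b, q b, w b) (b - τ, q (b - τ), w (b - τ)) := by
  refine ⟨fun r => (b + r, q (b + r), w (b + r)), by simp, by simp [sub_eq_add_neg], fun r hr => ?_⟩
  rw [uIcc_of_ge (by linarith)] at hr
  obtain ⟨h2, h3⟩ := h.2 (b + r) ⟨by linarith [hr.1], by linarith [hr.2]⟩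
  refine ⟨h2, ?_⟩
  have := HasDerivAt.scomp r h3 ((hasDerivAt_id r).const_add b)
  rw [one_smul] at this
  exact this.hasDerivWithinAt

/-- Flows of finitely many fields can be composed, near a given point and for small parameters. -/
lemma eventually_isComposite {p : ℕ} {D : Fin p → Set (Ext n m)} {Y : Fin p → Ext n m → Ext n m}
    (hD : ∀ j, IsOpen (D j)) (hY : ∀ j, AnalyticOnNhd ℝ (Y j) (D j)) (hx : ∀ j, x ∈ D j) :
    ∀ᶠ r in 𝓝 ((0 : Fin p → ℝ), x), ∃ y, IsComposite D Y r.1 r.2 y := by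
  induction p with
  | zero => exact Eventually.of_forall fun r => ⟨r.2, fun _ => r.2, rfl, rfl, fun j => j.elim0⟩
  | succ p ih =>
    have ih' := ih (D := fun j => D j.succ) (Y := fun j => Y j.succ) (fun j => hD _)
      (fun j => hY _) (fun j => hx _)
    obtain ⟨Φ, hΦ, hflow⟩ := exists_local_flow (hD 0) (hY 0) (hx 0)
    have hΦ0 : Φ (0, x) = x := hflow.self_of_nhds.unique (hY 0) (FlowsTo.zero (hx 0))
    have ht1 : Tendsto (fun r : (Fin (p + 1) → ℝ) × Ext n m => (r.1 0, r.2)) (𝓝 (0, x))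
        (𝓝 (0, x)) := by
      have : Continuous (fun r : (Fin (p + 1) → ℝ) × Ext n m => (r.1 0, r.2)) := by fun_prop
      exact this.tendsto (0, x)
    have ht2 : Tendsto (fun r : (Fin (p + 1) → ℝ) × Ext n m =>
        ((fun j : Fin p => r.1 j.succ), Φ (r.1 0, r.2))) (𝓝 (0, x)) (𝓝 (0, x)) := by
      rw [nhds_prod_eq (x := (0 : Fin p → ℝ))]
      refine Tendsto.prodMk ?_ ?_
      · have : Continuous (fun r : (Fin (p + 1) → ℝ) × Ext n m => fun j : Fin p => r.1 j.succ) := by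
          fun_prop
        exact this.tendsto (0, x)
      · have := hΦ.continuousAt.tendsto.comp ht1
        rwa [hΦ0] at this
    filter_upwards [ht1.eventually hflow, ht2.eventually ih'] with r hr1 ⟨y, z, hz0, hzl, hz⟩
    refine ⟨y, Fin.cons r.2 z, rfl, ?_, fun j => ?_⟩
    · rw [← Fin.succ_last, Fin.cons_succ, hzl]
    · refine Fin.cases ?_ (fun i => ?_) j
      · simpa [hz0] using hr1
      · simpa using hz i

lemma exists_isComposite {p : ℕ} {D : Fin p → Set (Ext n m)} {Y : Fin p → Ext n m → Ext n m}
    (hD : ∀ j, IsOpen (D j)) (hY : ∀ j, AnalyticOnNhd ℝ (Y j) (D j)) (hx : ∀ j, x ∈ D j) :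
    ∃ ε : Fin p → ℝ, (∀ j, 0 < ε j) ∧
      ∀ s : Fin p → ℝ, (∀ j, |s j| < ε j) → ∃ y, IsComposite D Y s x y := by
  obtain ⟨ε, hε, h⟩ := Metric.eventually_nhds_iff.1 (eventually_isComposite hD hY hx)
  refine ⟨fun _ => ε, fun _ => hε, fun s hs => @h (s, x) ?_⟩
  rw [Prod.dist_eq, dist_self, max_eq_left dist_nonneg, dist_pi_lt_iff hε]
  intro j
  simpa using hs j

/-- The flow of a push-forward of a constant vertical field is conjugate to a translation. -/
lemma FlowsTo.flowMap_neg_surrogate (hD : IsOpen D) (hS : AnalyticOnNhd ℝ S D) {lam : Fin m → ℝ}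
    (h : FlowsTo (surrogateDom D S τ) (surrogate D S τ lam) s x y) {r : ℝ} (hr : r ∈ uIcc 0 s) :
    flowMap D S (-τ) x + r • ((0, 0, lam) : Ext n m) ∈ D ∧
      (r = s → flowMap D S (-τ) y = flowMap D S (-τ) x + r • ((0, 0, lam) : Ext n m)) := by
  obtain ⟨c, rfl, rfl, hc⟩ := h
  have hder : ∀ u ∈ uIcc 0 s, HasDerivWithinAt (fun u => flowMap D S (-τ) (c u))
      ((0, 0, lam) : Ext n m) (uIcc 0 s) u := by
    intro u hu
    have hu1 : c u ∈ flowDom D S (-τ) := (hc u hu).1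
    have he : flowMap D S (-τ) (c u) ∈ flowDom D S τ := flowMap_mem_flowDom hu1
    have hce : flowMap D S τ (flowMap D S (-τ) (c u)) = c u := flowMap_flowMap_neg hS hu1
    have hdiff : ∀ {σ : ℝ} {v : Ext n m}, v ∈ flowDom D S σ → DifferentiableAt ℝ (flowMap D S σ) v :=
      fun {σ v} hv => DifferentiableAt.comp (g := flow D S) (f := fun v => (σ, v)) v
        (analyticAt_flow hD hS hv).differentiableAt (by fun_prop)
    have h1 : HasFDerivAt (flowMap D S (-τ)) (fderiv ℝ (flowMap D S (-τ)) (c u)) (c u) :=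
      (hdiff hu1).hasFDerivAt
    have h2 := h1.comp_hasDerivWithinAt u (hc u hu).2
    -- Differentiating Φ_{-τ} ∘ Φ_τ = id shows that Φ_{-τ} carries the surrogate field back to the
    -- constant vector λ.
    have h3 : (fderiv ℝ (flowMap D S (-τ)) (c u)) ∘L
        (fderiv ℝ (flowMap D S τ) (flowMap D S (-τ) (c u))) = ContinuousLinearMap.id ℝ _ := by
      have h4 : HasFDerivAt (flowMap D S (-τ) ∘ flowMap D S τ) _ (flowMap D S (-τ) (c u)) :=
        HasFDerivAt.comp (flowMap D S (-τ) (c u)) (by rw [hce]; exact h1) (hdiff he).hasFDerivAt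
      refine h4.unique ((hasFDerivAt_id _).congr_of_eventuallyEq ?_)
      filter_upwards [(isOpen_flowDom hD hS).mem_nhds he] with v hv
      have : v ∈ flowDom D S (-(-τ)) := by rwa [neg_neg]
      simpa using flowMap_flowMap_neg hS this
    have h5 := congrArg (fun L => L ((0, 0, lam) : Ext n m)) h3
    change fderiv ℝ (flowMap D S (-τ)) (c u) (surrogate D S τ lam (c u)) = (0, 0, lam) at h5
    rwa [h5] at h2
  have hconst : ∀ u ∈ uIcc 0 s,
      flowMap D S (-τ) (c u) = flowMap D S (-τ) (c 0) + u • ((0, 0, lam) : Ext n m) := by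
    intro u hu
    have h1 : ∀ v ∈ uIcc 0 s, HasDerivWithinAt
        (fun v => flowMap D S (-τ) (c v) - v • ((0, 0, lam) : Ext n m)) 0 (uIcc 0 s) v := by
      intro v hv
      have := (hder v hv).fun_sub ((hasDerivWithinAt_id v (uIcc 0 s)).smul_const ((0, 0, lam) : Ext n m))
      simpa using this
    have h2 := (convex_uIcc 0 s).norm_image_sub_le_of_norm_hasDerivWithin_le (C := 0) h1
      (fun v _ => by simp) left_mem_uIcc hu
    simp only [zero_mul, zero_smul, sub_zero, norm_le_zero_iff] at h2
    exact sub_eq_iff_eq_add.1 (sub_eq_zero.1 h2)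
  refine ⟨?_, fun h => h ▸ hconst r hr⟩
  rw [← hconst r hr]
  exact (flowsTo_flowMap (hc r hr).1).mem_right

lemma FlowsTo.fst_eq (hS : IsSection f K Ω S) (h : FlowsTo Ω S s x y) : y.1 = x.1 + s := by
  obtain ⟨c, rfl, rfl, hc⟩ := h
  have h1 : ∀ v ∈ uIcc 0 s, HasDerivWithinAt (fun v => (c v).1 - v) 0 (uIcc 0 s) v := by
    intro v hv
    have h2 : HasDerivWithinAt (fun v => (c v).1) (S (c v)).1 (uIcc 0 s) v :=
      (ContinuousLinearMap.fst ℝ ℝ ((Fin n → ℝ) × (Fin m → ℝ))).hasFDerivAt.comp_hasDerivWithinAt v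
        (hc v hv).2
    rw [(hS.2.2.2 _ (hc v hv).1).1] at h2
    simpa using h2.fun_sub (hasDerivWithinAt_id v (uIcc 0 s))
  have h2 := (convex_uIcc 0 s).norm_image_sub_le_of_norm_hasDerivWithin_le (C := 0) h1
    (fun v _ => by simp) left_mem_uIcc right_mem_uIcc
  simp only [zero_mul, sub_zero, norm_le_zero_iff] at h2
  linarith

/-- Forward integral curves of sections are solution arcs. -/
lemma FlowsTo.exists_isSolutionArc (hS : IsSection f K Ω S) (hs : 0 < s) (h : FlowsTo Ω S s x y) :
    ∃ q w, IsSolutionArc f K x y q w := by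
  have hy := h.fst_eq hS
  have hdom : ∀ t ∈ Icc x.1 y.1, x ∈ flowDom Ω S (t - x.1) := fun t ht =>
    mem_flowDom_of_mem_uIcc ⟨y, h⟩ (by
      rw [uIcc_of_le hs.le]; exact ⟨by linarith [ht.1], by linarith [ht.2]⟩)
  have han : AnalyticOnNhd ℝ (fun t => flowMap Ω S (t - x.1) x) (Icc x.1 y.1) := fun t ht =>
    AnalyticAt.fun_comp (g := flow Ω S) (f := fun t => (t - x.1, x))
      (analyticAt_flow hS.1 hS.2.2.1 (hdom t ht))
      ((analyticAt_id.sub analyticAt_const).prod analyticAt_const)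
  have htime : ∀ t ∈ Icc x.1 y.1, (flowMap Ω S (t - x.1) x).1 = t := fun t ht => by
    rw [(flowsTo_flowMap (hdom t ht)).fst_eq hS]; ring
  have hx0 : flowMap Ω S (x.1 - x.1) x = x := by
    rw [sub_self]; exact flowMap_zero hS.2.2.1 h.mem_left
  have hy0 : flowMap Ω S (y.1 - x.1) x = y := by
    rw [hy, add_sub_cancel_left]; exact flowMap_eq hS.2.2.1 h
  refine ⟨fun t => (flowMap Ω S (t - x.1) x).2.1, fun t => (flowMap Ω S (t - x.1) x).2.2,
    by linarith, fun t ht => analyticAt_fst.fun_comp (analyticAt_snd.fun_comp (han t ht)),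
    fun t ht => analyticAt_snd.fun_comp (analyticAt_snd.fun_comp (han t ht)), fun t ht => ?_, ?_, ?_⟩
  · have hmem := (flowsTo_flowMap (hdom t ht)).mem_right
    refine ⟨hS.2.1 hmem, ?_⟩
    have h1 := HasDerivAt.scomp t (hasDerivAt_flowMap hS.1 hS.2.2.1 (hdom t ht))
      ((hasDerivAt_id t).sub_const x.1)
    rw [one_smul] at h1
    have h2 : HasDerivAt (fun t => (flowMap Ω S (t - x.1) x).2.1)
        (S (flowMap Ω S (t - x.1) x)).2.1 t :=
      ((ContinuousLinearMap.fst ℝ (Fin n → ℝ) (Fin m → ℝ)) ∘L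
        (ContinuousLinearMap.snd ℝ ℝ ((Fin n → ℝ) × (Fin m → ℝ)))).hasFDerivAt.comp_hasDerivAt t h1
    rw [(hS.2.2.2 _ hmem).2] at h2
    have h3 : ((t, (flowMap Ω S (t - x.1) x).2.1, (flowMap Ω S (t - x.1) x).2.2) : Ext n m) =
        flowMap Ω S (t - x.1) x := Prod.ext (htime t ht).symm rfl
    rwa [h3]
  · simp only [hx0]
  · simp only [hy0]

lemma exists_isVerticalArc {lam : Fin m → ℝ} (hne : lam ≠ 0)
    (h : ∀ r ∈ Icc (0 : ℝ) 1, x + r • ((0, 0, lam) : Ext n m) ∈ extSpace n K) :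
    ∃ w, IsVerticalArc K x (x + ((0, 0, lam) : Ext n m)) w := by
  have hd : ∀ r : ℝ, HasDerivAt (fun r : ℝ => x.2.2 + r • lam) lam r := fun r => by
    simpa using ((hasDerivAt_id r).smul_const lam).const_add x.2.2
  refine ⟨fun r => x.2.2 + r • lam, by simp, by simp, fun r _ => ?_, fun r hr => ⟨?_, ?_⟩, by simp,
    by simp⟩
  · exact analyticAt_const.add (analyticAt_id.smul analyticAt_const)
  · simpa [extSpace] using h r hr
  · rwa [(hd r).deriv]

/-- `y` is the final point of a chain of arcs which starts at `x` with a solution arc. -/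
def Reach (f : Ext n m → (Fin n → ℝ)) (K : Set (Fin m → ℝ)) (x y : Ext n m) : Prop :=
  ∃ (k : ℕ) (v : ℕ → Ext n m), (∃ q w, IsSolutionArc f K (v 0) (v 1) q w) ∧
    (∀ i ≤ k, (∃ q w, IsSolutionArc f K (v i) (v (i + 1)) q w) ∨
      (∃ w, IsVerticalArc K (v i) (v (i + 1)) w)) ∧ v 0 = x ∧ v (k + 1) = y

/-- `y` is the final point of a completed graph from `x`. -/
def Joined (f : Ext n m → (Fin n → ℝ)) (K : Set (Fin m → ℝ)) (x y : Ext n m) : Prop :=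
  ∃ (k : ℕ) (v : ℕ → Ext n m), IsCompletedGraph f K k v ∧ v 0 = x ∧ v (k + 1) = y

lemma Joined.reach (h : Joined f K x y) : Reach f K x y := by
  obtain ⟨k, v, hv, h0, h1⟩ := h
  exact ⟨k, v, hv.1, hv.2.2, h0, h1⟩

lemma Reach.vertical (h : Reach f K x y) (hz : ∃ w, IsVerticalArc K y z w) : Reach f K x z := by
  obtain ⟨k, v, hv, hi, h0, rfl⟩ := h
  refine ⟨k + 1, Function.update v (k + 2) z, ?_, fun i hik => ?_, ?_, ?_⟩
  · rwa [Function.update_of_ne (by omega), Function.update_of_ne (by omega)]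
  · rcases hik.lt_or_eq with hlt | rfl
    · rw [Function.update_of_ne (by omega), Function.update_of_ne (by omega)]
      exact hi i (by omega)
    · rw [Function.update_self, Function.update_of_ne (by omega)]
      exact .inr hz
  · rwa [Function.update_of_ne (by omega)]
  · exact Function.update_self _ _ _

lemma Reach.joined (h : Reach f K x y) (hz : ∃ q w, IsSolutionArc f K y z q w) : Joined f K x z := by
  obtain ⟨k, v, hv, hi, h0, rfl⟩ := h
  refine ⟨k + 1, Function.update v (k + 2) z, ⟨?_, ?_, fun i hik => ?_⟩, ?_, ?_⟩
  · rwa [Function.update_of_ne (by omega), Function.update_of_ne (by omega)]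
  · rwa [Function.update_self, Function.update_of_ne (by omega)]
  · rcases hik.lt_or_eq with hlt | rfl
    · rw [Function.update_of_ne (by omega), Function.update_of_ne (by omega)]
      exact hi i (by omega)
    · rw [Function.update_self, Function.update_of_ne (by omega)]
      exact .inl hz
  · rwa [Function.update_of_ne (by omega)]
  · exact Function.update_self _ _ _

/-- The last arc is cut at the time t. The strict inequality keeps the shortened arc non-trivial; if
there is only one arc, it is the first one as well. -/
lemma IsFinalArc.joined {c : ℝ} {q : ℝ → (Fin n → ℝ)} {w : ℝ → (Fin m → ℝ)}
    (h : IsFinalArc f K xo yo c q w) {t : ℝ} (hct : c < t) (ht : t ≤ yo.1) :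
    Joined f K xo (t, q t, w t) := by
  obtain ⟨k, v, hv, h0, hk, rfl, hlt, hq, hw, hode, hx, hy⟩ := h
  have harc : IsSolutionArc f K (v k) (t, q t, w t) q w :=
    ⟨hct, fun r hr => hq r ⟨hr.1, hr.2.trans ht⟩, fun r hr => hw r ⟨hr.1, hr.2.trans ht⟩,
      fun r hr => hode r ⟨hr.1, hr.2.trans ht⟩, hx, rfl⟩
  refine ⟨k, Function.update v (k + 1) (t, q t, w t), ⟨?_, ?_, fun i hik => ?_⟩, ?_, ?_⟩
  · rcases k.eq_zero_or_pos with rfl | hpos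
    · rw [Function.update_of_ne (by omega), zero_add, Function.update_self]
      exact ⟨q, w, harc⟩
    · rw [Function.update_of_ne (by omega), Function.update_of_ne (by omega)]
      exact hv.1
  · rw [Function.update_of_ne (by omega), Function.update_self]
    exact ⟨q, w, harc⟩
  · rcases hik.lt_or_eq with hlt | rfl
    · rw [Function.update_of_ne (by omega), Function.update_of_ne (by omega)]
      exact hv.2.2 i (by omega)
    · rw [Function.update_of_ne (by omega), Function.update_self]
      exact .inl ⟨q, w, harc⟩
  · rwa [Function.update_of_ne (by omega)]
  · exact Function.update_self _ _ _

lemma mem_surrogateDom_of_isAdaptedSection {c : ℝ} {q : ℝ → (Fin n → ℝ)} {w : ℝ → (Fin m → ℝ)}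
    {δ : ℝ} (hfin : IsFinalArc f K xo yo c q w)
    (hS : IsAdaptedSection f K q w (yo.1 - δ) yo.1 Ω S) (h0 : 0 ≤ τ) (h1 : τ ≤ δ) :
    FlowsTo Ω S (-τ) yo (yo.1 - τ, q (yo.1 - τ), w (yo.1 - τ)) := by
  obtain ⟨k, v, -, -, -, -, -, -, -, -, -, hy⟩ := hfin
  have := hS.flowsTo h0 (by linarith)
  rwa [← hy] at this

/-- One step of the flow of a surrogate field, inserted in a completed graph. -/
lemma Joined.surrogate_step (hS : IsSection f K Ω S) {τ' : ℝ} (hτ : τ' < τ)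
    {lam : Fin m → ℝ} (h : FlowsTo (surrogateDom Ω S τ) (surrogate Ω S τ lam) s x y)
    (hx : Joined f K xo (flowMap Ω S (-τ) x)) (h0 : 0 ≤ τ') :
    y ∈ flowDom Ω S (-τ') ∧ Joined f K xo (flowMap Ω S (-τ') y) ∧ y.1 = x.1 := by
  have hdx := flowsTo_flowMap (D := Ω) (X := S) (s := -τ) (x := x) h.mem_left
  have hdy := flowsTo_flowMap (D := Ω) (X := S) (s := -τ) (x := y) h.mem_right
  have he := (h.flowMap_neg_surrogate hS.1 hS.2.2.1 right_mem_uIcc).2 rfl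
  have hmem : y ∈ flowDom Ω S (-τ') := mem_flowDom_of_mem_uIcc h.mem_right (by
    rw [uIcc_of_ge (by linarith)]; exact ⟨by linarith, by linarith⟩)
  have hreach : Reach f K xo (flowMap Ω S (-τ) y) := by
    rw [he]
    -- Vertical arcs must be regular, so a zero displacement is realized by no arc at all.
    by_cases hne : s • lam = 0
    · have : s • ((0, 0, lam) : Ext n m) = 0 := by simp [hne]
      rw [this, add_zero]
      exact hx.reach
    · have : s • ((0, 0, lam) : Ext n m) = (0, 0, s • lam) := by simp
      rw [this]
      refine hx.reach.vertical (exists_isVerticalArc hne fun r hr => ?_)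
      rw [← this, smul_smul]
      refine hS.2.1 (h.flowMap_neg_surrogate hS.1 hS.2.2.1 ?_).1
      rcases le_total 0 s with hs | hs
      · rw [uIcc_of_le hs]
        exact ⟨mul_nonneg hr.1 hs, mul_le_of_le_one_left hs hr.2⟩
      · rw [uIcc_of_ge hs]
        exact ⟨by nlinarith [hr.1, hr.2], mul_nonpos_of_nonneg_of_nonpos hr.1 hs⟩
  -- Forward along S from depth τ only up to depth τ'; this is the backward curve from y, traversed
  -- in reverse.
  have hstep : FlowsTo Ω S (τ - τ') (flowMap Ω S (-τ) y) (flowMap Ω S (-τ') y) := by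
    have h1 : flowMap Ω S (-τ) y ∈ flowDom Ω S (τ - τ') :=
      mem_flowDom_of_mem_uIcc (flowMap_mem_flowDom h.mem_right) (by
        rw [uIcc_of_le (by linarith)]; exact ⟨by linarith, by linarith⟩)
    have h2 := flowsTo_flowMap h1
    obtain ⟨c, hc0, hc1, hc⟩ := hdy
    have h4 := (FlowsTo.of_mem_uIcc hc (t := -τ') (by
      rw [uIcc_of_ge (by linarith)]; exact ⟨by linarith, by linarith⟩))
    rw [hc0] at h4
    rw [flowMap_eq hS.2.2.1 h4]
    refine ⟨fun r => c (-τ + r), by simpa using hc1, by ring_nf, fun r hr => ?_⟩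
    rw [uIcc_of_le (by linarith)] at hr ⊢
    have hmaps : MapsTo (fun r => -τ + r) (Icc 0 (τ - τ')) (uIcc 0 (-τ)) := fun u hu => by
      rw [uIcc_of_ge (by linarith)]; exact ⟨by linarith [hu.1], by linarith [hu.2]⟩
    refine ⟨(hc _ (hmaps hr)).1, ?_⟩
    have := HasDerivWithinAt.scomp r (hc _ (hmaps hr)).2
      ((hasDerivWithinAt_id r (Icc 0 (τ - τ'))).const_add (-τ)) hmaps
    rwa [one_smul] at this
  refine ⟨hmem, hreach.joined (hstep.exists_isSolutionArc hS (by linarith)), ?_⟩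
  have h1 := hdx.fst_eq hS
  have h2 := hdy.fst_eq hS
  rw [he] at h2
  simp at h2
  linarith

/-- The detours are made at increasing times, so the later ones do not disturb the arcs already
built. -/
theorem mem_attain_of_isComposite {T c δ : ℝ} {q : ℝ → (Fin n → ℝ)} {w : ℝ → (Fin m → ℝ)}
    (hT : yo.1 = xo.1 + T) (hfin : IsFinalArc f K xo yo c q w) (hc : c ≤ yo.1 - δ) (hδ : 0 < δ)
    (hS : IsAdaptedSection f K q w (yo.1 - δ) yo.1 Ω S) {p : ℕ} {lam : Fin p → (Fin m → ℝ)}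
    {τ : Fin p → ℝ} (hanti : StrictAnti τ) (hτ : ∀ j, 0 < τ j ∧ τ j < δ) {s : Fin p → ℝ}
    (h : IsComposite (fun j => surrogateDom Ω S (τ j))
      (fun j => surrogate Ω S (τ j) (lam j)) s yo y) : y ∈ Attain f K T xo := by
  obtain ⟨z, hz0, rfl, hz⟩ := h
  -- After j steps, the points at every depth below all depths used so far can be reached. The next
  -- step uses depth τ j, and the conclusion uses depth 0.
  have key : ∀ j : Fin (p + 1), (z j).1 = yo.1 ∧ ∀ τ', 0 ≤ τ' → τ' < δ →
      (∀ i : Fin p, i.castSucc < j → τ' < τ i) →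
      z j ∈ flowDom Ω S (-τ') ∧ Joined f K xo (flowMap Ω S (-τ') (z j)) := by
    intro j
    induction j using Fin.induction with
    | zero =>
      refine ⟨by rw [hz0], fun τ' h0 h1 _ => ?_⟩
      have h2 := mem_surrogateDom_of_isAdaptedSection hfin hS h0 h1.le
      rw [hz0, flowMap_eq hS.1.2.2.1 h2]
      exact ⟨⟨_, h2⟩, hfin.joined (by linarith) (by linarith)⟩
    | succ j ih =>
      have hj := (ih.2 (τ j) (hτ j).1.le (hτ j).2 fun i hi => hanti (by simpa using hi)).2
      refine ⟨?_, fun τ' h0 h1 h2 => ?_⟩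
      · rw [(hj.surrogate_step hS.1 (hτ j).1 (hz j) le_rfl).2.2, ih.1]
      · have := hj.surrogate_step hS.1 (h2 j Fin.castSucc_lt_succ) (hz j) h0
        exact ⟨this.1, this.2.1⟩
  obtain ⟨h1, h2⟩ := key (Fin.last p)
  obtain ⟨h3, h4⟩ := h2 0 le_rfl hδ fun i _ => (hτ i).1
  refine ⟨h1.trans hT, ?_⟩
  rw [neg_zero] at h3 h4
  rwa [flowMap_zero hS.1.2.2.1 h3.choose_spec.mem_left] at h4

theorem exists_isComposite_surrogate {c δ : ℝ} {q : ℝ → (Fin n → ℝ)} {w : ℝ → (Fin m → ℝ)}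
    (hfin : IsFinalArc f K xo yo c q w)
    (hS : IsAdaptedSection f K q w (yo.1 - δ) yo.1 Ω S) {p : ℕ} (lam : Fin p → (Fin m → ℝ))
    {τ : Fin p → ℝ} (hτ : ∀ j, 0 < τ j ∧ τ j < δ) :
    ∃ ε : Fin p → ℝ, (∀ j, 0 < ε j) ∧ ∀ s : Fin p → ℝ, (∀ j, |s j| < ε j) →
      ∃ y, IsComposite (fun j => surrogateDom Ω S (τ j))
        (fun j => surrogate Ω S (τ j) (lam j)) s yo y :=
  exists_isComposite (fun _ => isOpen_flowDom hS.1.1 hS.1.2.2.1)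
    (fun _ _ hx => analyticAt_surrogate hS.1.1 hS.1.2.2.1 (fun _ _ => analyticAt_const) hx)
    fun j => ⟨_, mem_surrogateDom_of_isAdaptedSection hfin hS (hτ j).1.le (hτ j).2.le⟩

end Attainability

/-! ### The transition matrix of push-forwards -/

section LinearEquation

variable {n m : ℕ} {D : Set (Ext n m)} {S : Ext n m → Ext n m} {x₀ : Ext n m}
  {ι : Type*} [Fintype ι] {X : ι → Ext n m → Ext n m} {a : ι → ι → Ext n m → ℝ}

open Classical in
/-- The flow of the linear differential equation with coefficients `-a` along the backward
integral curves of `S`. -/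
lemma exists_analytic_transition (hD : IsOpen D) (hS : AnalyticOnNhd ℝ S D) (hx₀ : x₀ ∈ D)
    (ha : ∀ i j, AnalyticAt ℝ (a i j) x₀) :
    ∃ A : ℝ × Ext n m → ι → ι → ℝ, AnalyticAt ℝ A (0, x₀) ∧ ∀ᶠ p in 𝓝 ((0 : ℝ), x₀),
      A (0, p.2) = (fun i j => if i = j then 1 else 0) ∧ ∀ i j, HasDerivAt (fun t => A (t, p.2) i j)
        (-∑ l, a i l (flowMap D S (-p.1) p.2) * A p l j) p.1 := by
  -- The backward curve of S and the matrix are integrated together. The system is autonomous and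
  -- analytic, and its local flow is analytic in time and initial point.
  let F : Ext n m × (ι → ι → ℝ) → Ext n m × (ι → ι → ℝ) := fun v =>
    (-S v.1, fun i j => -∑ l, a i l v.1 * v.2 l j)
  let B₀ : ι → ι → ℝ := fun i j => if i = j then 1 else 0
  have hproj : ∀ l j (v : Ext n m × (ι → ι → ℝ)),
      AnalyticAt ℝ (fun v : Ext n m × (ι → ι → ℝ) => v.2 l j) v := fun l j v =>
    ((ContinuousLinearMap.proj (R := ℝ) (φ := fun _ : ι => ℝ) j) ∘L
      (ContinuousLinearMap.proj (R := ℝ) (φ := fun _ : ι => ι → ℝ) l) ∘L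
      (ContinuousLinearMap.snd ℝ (Ext n m) (ι → ι → ℝ))).analyticAt v
  have hF : AnalyticAt ℝ F (x₀, B₀) := by
    refine AnalyticAt.prod (AnalyticAt.neg ?_) ?_
    · exact AnalyticAt.fun_comp (g := S) (hS x₀ hx₀) analyticAt_fst
    · refine analyticAt_pi_iff.2 fun i => analyticAt_pi_iff.2 fun j => AnalyticAt.neg ?_
      refine Finset.analyticAt_fun_sum _ fun l _ => AnalyticAt.mul ?_ (hproj l j _)
      exact AnalyticAt.fun_comp (g := a i l) (ha i l) analyticAt_fst
  obtain ⟨Ψ, hΨ, hev⟩ := exists_analytic_localFlow hF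
  have hι : AnalyticAt ℝ (fun p : ℝ × Ext n m => (p.1, (p.2, B₀))) (0, x₀) :=
    analyticAt_fst.prod (analyticAt_snd.prod analyticAt_const)
  have hA : AnalyticAt ℝ (fun p : ℝ × Ext n m => Ψ (p.1, (p.2, B₀))) (0, x₀) :=
    AnalyticAt.fun_comp (g := Ψ) (f := fun p : ℝ × Ext n m => (p.1, (p.2, B₀))) hΨ hι
  refine ⟨fun p => (Ψ (p.1, (p.2, B₀))).2, analyticAt_snd.fun_comp hA, ?_⟩
  have hmem : ∀ᶠ p in 𝓝 ((0 : ℝ), x₀), (Ψ (p.1, (p.2, B₀))).1 ∈ D := by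
    have h1 : Ψ (0, (x₀, B₀)) = (x₀, B₀) := hev.self_of_nhds.1
    exact hA.continuousAt.fst.eventually (by
      change ∀ᶠ y in 𝓝 (Ψ (0, (x₀, B₀))).1, y ∈ D
      rw [h1]; exact hD.mem_nhds hx₀)
  have hev' := hι.continuousAt.tendsto.eventually hev
  obtain ⟨δ, hδ, hb⟩ := Metric.eventually_nhds_iff.1 (hev'.and hmem)
  refine Metric.eventually_nhds_iff.2 ⟨δ, hδ, ?_⟩
  rintro ⟨τ, y⟩ hτy
  have hbox : ∀ t, |t| ≤ |τ| → dist ((t, y) : ℝ × Ext n m) (0, x₀) < δ := by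
    intro t ht
    refine lt_of_le_of_lt ?_ hτy
    rw [Prod.dist_eq, Prod.dist_eq]
    refine max_le_max ?_ le_rfl
    simpa using ht
  have hder : ∀ t, |t| ≤ |τ| → HasDerivAt (fun t => Ψ (t, (y, B₀))) (F (Ψ (t, (y, B₀)))) t :=
    fun t ht => (hb (hbox t ht)).1.2
  have h0 : Ψ (0, (y, B₀)) = (y, B₀) := (hb (hbox 0 (by simp))).1.1
  have hflow : FlowsTo D S (-τ) y (Ψ (τ, (y, B₀))).1 := by
    have h1 : FlowsTo D (fun x => -S x) τ y (Ψ (τ, (y, B₀))).1 := by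
      refine ⟨fun t => (Ψ (t, (y, B₀))).1, by simp only [h0], rfl, fun t ht => ?_⟩
      have ht' : |t| ≤ |τ| := by simpa using abs_sub_left_of_mem_uIcc ht
      exact ⟨(hb (hbox t ht')).2, (((ContinuousLinearMap.fst ℝ (Ext n m)
        (ι → ι → ℝ)).hasFDerivAt.comp_hasDerivAt t (hder t ht')).hasDerivWithinAt)⟩
    rw [← flowsTo_neg_field_iff]
    simpa using h1
  refine ⟨by simp only [h0]; rfl, fun i j => ?_⟩
  simp only
  rw [flowMap_eq hS hflow]
  have h2 := ((ContinuousLinearMap.proj (R := ℝ) (φ := fun _ : ι => ℝ) j) ∘L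
      (ContinuousLinearMap.proj (R := ℝ) (φ := fun _ : ι => ι → ℝ) i) ∘L
      (ContinuousLinearMap.snd ℝ (Ext n m) (ι → ι → ℝ))).hasFDerivAt.comp_hasDerivAt τ
        (hder τ le_rfl)
  exact h2

open Classical in
/-- If the fields `X i` span a family which is closed under the bracket with `S`, then their
push-forwards by the flow of `S` are their combinations. -/
lemma exists_pushFlow_eq_sum (hD : IsOpen D) (hS : AnalyticOnNhd ℝ S D) (hx₀ : x₀ ∈ D)
    (hX : ∀ i, AnalyticOnNhd ℝ (X i) D) (ha : ∀ i j, AnalyticAt ℝ (a i j) x₀)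
    (hbr : ∀ i, VectorField.lieBracket ℝ S (X i) =ᶠ[𝓝 x₀] fun x => ∑ j, a i j x • X j x) :
    ∃ A : ℝ × Ext n m → ι → ι → ℝ, AnalyticAt ℝ A (0, x₀) ∧ ∀ᶠ p in 𝓝 ((0 : ℝ), x₀),
      p.2 ∈ flowDom D S (-p.1) ∧
      A (0, p.2) = (fun i j => if i = j then 1 else 0) ∧ (∀ i j, HasDerivAt (fun t => A (t, p.2) i j)
        (-∑ l, a i l (flowMap D S (-p.1) p.2) * A p l j) p.1) ∧
      (0 ≤ p.1 → ∀ i, pushFlow D S p.1 (X i) p.2 = ∑ j, A p i j • X j p.2) := by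
  obtain ⟨A, hA, hev⟩ := exists_analytic_transition hD hS hx₀ ha
  refine ⟨A, hA, ?_⟩
  have hx₀' : x₀ ∈ flowDom D S (-0) := by rw [neg_zero]; exact mem_flowDom_zero hx₀
  have hdom := eventually_mem_flowDom_neg hD hS hx₀'
  have hback : Tendsto (fun p : ℝ × Ext n m => flowMap D S (-p.1) p.2) (𝓝 (0, x₀)) (𝓝 x₀) := by
    have h1 := (analyticAt_flow_neg hD hS hx₀').continuousAt.tendsto
    have h2 : flow D S (-0, x₀) = x₀ := by rw [neg_zero]; exact flowMap_zero hS hx₀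
    rw [h2] at h1
    exact h1
  obtain ⟨C, hC⟩ : ∃ C : ℝ, ∀ᶠ x in 𝓝 x₀, ∀ i j, |a i j x| ≤ C := by
    refine ⟨∑ i, ∑ j, (|a i j x₀| + 1), eventually_all.2 fun i => eventually_all.2 fun j => ?_⟩
    have h1 : ∀ᶠ x in 𝓝 x₀, |a i j x| < |a i j x₀| + 1 :=
      (ha i j).continuousAt.abs.eventually_lt_const (by linarith)
    filter_upwards [h1] with x hx
    refine hx.le.trans ((Finset.single_le_sum (f := fun j => |a i j x₀| + 1)
      (fun j _ => by positivity) (Finset.mem_univ j)).trans (Finset.single_le_sum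
      (f := fun i => ∑ j, (|a i j x₀| + 1)) (fun i _ => by positivity) (Finset.mem_univ i)))
  obtain ⟨δ, hδ, hb⟩ := Metric.eventually_nhds_iff.1
    ((hev.and hdom).and (hback.eventually (hC.and (eventually_all.2 hbr))))
  refine Metric.eventually_nhds_iff.2 ⟨δ, hδ, ?_⟩
  rintro ⟨τ, y⟩ hτy
  refine ⟨(hb hτy).1.2, (hb hτy).1.1.1, (hb hτy).1.1.2, fun hτ => ?_⟩
  simp only at hτ ⊢
  have hbox : ∀ t ∈ Icc 0 τ, dist ((t, y) : ℝ × Ext n m) (0, x₀) < δ := by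
    intro t ht
    refine lt_of_le_of_lt ?_ hτy
    rw [Prod.dist_eq, Prod.dist_eq]
    refine max_le_max ?_ le_rfl
    simpa [abs_of_nonneg ht.1, abs_of_nonneg hτ] using ht.2
  have hy : y ∈ D := (hb hτy).1.2.choose_spec.mem_left
  -- Both terms solve the same linear equation with the same initial value, so their difference
  -- vanishes by a Grönwall estimate.
  let R : ℝ → ι → Ext n m := fun t i => pushFlow D S t (X i) y - ∑ j, A (t, y) i j • X j y
  have hR : ∀ t ∈ Icc 0 τ, HasDerivAt R
      (fun i => -∑ l, a i l (flowMap D S (-t) y) • R t l) t := by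
    intro t ht
    obtain ⟨⟨⟨-, hAd⟩, hdy⟩, -, hbr'⟩ := hb (hbox t ht)
    refine hasDerivAt_pi.2 fun i => ?_
    have h1 := hasDerivAt_pushFlow hD hS (hX i) hdy
    have h2 : HasDerivAt (fun t => ∑ j, A (t, y) i j • X j y)
        (∑ j, (-∑ l, a i l (flowMap D S (-t) y) * A (t, y) l j) • X j y) t :=
      HasDerivAt.fun_sum fun j _ => (hAd i j).smul_const (X j y)
    have h3 : pushFlow D S t (VectorField.lieBracket ℝ S (X i)) y =
        ∑ l, a i l (flowMap D S (-t) y) • pushFlow D S t (X l) y := by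
      simp only [pushFlow]
      rw [hbr' i]
      simp only [map_sum, map_smul]
    have h4 : (-∑ l, a i l (flowMap D S (-t) y) • R t l) =
        -pushFlow D S t (VectorField.lieBracket ℝ S (X i)) y -
          ∑ j, (-∑ l, a i l (flowMap D S (-t) y) * A (t, y) l j) • X j y := by
      rw [h3]
      simp only [R, smul_sub, Finset.sum_sub_distrib, neg_smul, Finset.sum_neg_distrib,
        Finset.sum_smul, Finset.smul_sum, smul_smul, sub_neg_eq_add, neg_sub]
      rw [Finset.sum_comm]
      abel
    rw [h4]
    exact h1.fun_sub h2
  have hzero : ∀ t ∈ Icc 0 τ, R t = 0 := by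
    refine eq_zero_of_abs_deriv_le_mul_abs_self_of_eq_zero_right (K := Fintype.card ι * C)
      (f' := fun t i => -∑ l, a i l (flowMap D S (-t) y) • R t l)
      (fun t ht => (hR t ht).continuousAt.continuousWithinAt)
      (fun t ht => (hR t ⟨ht.1, ht.2.le⟩).hasDerivWithinAt) ?_ fun t ht => ?_
    · funext i
      simp only [R, pushFlow_zero hD hS hy, (hb (hbox 0 ⟨le_rfl, hτ⟩)).1.1.1]
      simp
    · have hCt := (hb (hbox t ⟨ht.1, ht.2.le⟩)).2.1
      rcases isEmpty_or_nonempty ι with hι | hι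
      · simp [Subsingleton.elim (R t) 0]
        rfl
      have hC0 : 0 ≤ C := (abs_nonneg _).trans (hCt (Classical.arbitrary ι) (Classical.arbitrary ι))
      refine (pi_norm_le_iff_of_nonneg (by positivity)).2 fun i => ?_
      rw [norm_neg]
      refine (norm_sum_le _ _).trans ?_
      calc ∑ l, ‖a i l (flowMap D S (-t) y) • R t l‖ ≤ ∑ _l : ι, C * ‖R t‖ := by
            refine Finset.sum_le_sum fun l _ => ?_
            rw [norm_smul]
            exact mul_le_mul (hCt i l) (norm_le_pi_norm _ _) (norm_nonneg _) hC0
        _ = Fintype.card ι * C * ‖R t‖ := by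
            rw [Finset.sum_const, Finset.card_univ, nsmul_eq_mul, mul_assoc]
  intro i
  exact sub_eq_zero.1 (congrFun (hzero τ ⟨hτ, le_rfl⟩) i)

end LinearEquation

/-! ### Brackets of analytic combinations -/

section Combinations

variable {E F : Type*} [NormedAddCommGroup E] [NormedSpace ℝ E] [NormedAddCommGroup F]
  [NormedSpace ℝ F] {ι κ : Type*} [Fintype ι] {U V : Set E} {x₀ : E}

/-- `Y` is a combination of the fields `X i` on `U`, with analytic coefficients. -/
def IsCombo (X : ι → E → F) (U : Set E) (Y : E → F) : Prop :=
  ∃ g : ι → E → ℝ, (∀ i, AnalyticOnNhd ℝ (g i) U) ∧ ∀ x ∈ U, Y x = ∑ i, g i x • X i x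

variable {X : ι → E → F} {Y Z : E → F}

lemma IsCombo.mono (h : IsCombo X U Y) (hV : V ⊆ U) : IsCombo X V Y := by
  obtain ⟨g, hg, h⟩ := h
  exact ⟨g, fun i => (hg i).mono hV, fun x hx => h x (hV hx)⟩

lemma IsCombo.congr (h : IsCombo X U Y) (hY : EqOn Z Y U) : IsCombo X U Z := by
  obtain ⟨g, hg, h⟩ := h
  exact ⟨g, hg, fun x hx => (hY hx).trans (h x hx)⟩

lemma IsCombo.add (hY : IsCombo X U Y) (hZ : IsCombo X U Z) :
    IsCombo X U fun x => Y x + Z x := by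
  obtain ⟨g, hg, hY⟩ := hY
  obtain ⟨h, hh, hZ⟩ := hZ
  exact ⟨fun i x => g i x + h i x, fun i => (hg i).add (hh i), fun x hx => by
    beta_reduce
    rw [hY x hx, hZ x hx, ← Finset.sum_add_distrib]; simp only [add_smul]⟩

lemma IsCombo.smul {φ : E → ℝ} (hφ : AnalyticOnNhd ℝ φ U) (hY : IsCombo X U Y) :
    IsCombo X U fun x => φ x • Y x := by
  obtain ⟨g, hg, hY⟩ := hY
  exact ⟨fun i x => φ x * g i x, fun i => hφ.mul (hg i), fun x hx => by
    beta_reduce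
    rw [hY x hx, Finset.smul_sum]; simp only [smul_smul]⟩

lemma IsCombo.zero : IsCombo X U fun _ => (0 : F) :=
  ⟨fun _ _ => 0, fun _ _ _ => analyticAt_const, fun _ _ => by simp⟩

open Classical in
lemma isCombo_self (i : ι) : IsCombo X U (X i) :=
  ⟨fun j _ => if j = i then 1 else 0, fun _ _ _ => analyticAt_const, fun _ _ => by simp⟩

lemma IsCombo.sum {s : Finset κ} {W : κ → E → F} (h : ∀ k ∈ s, IsCombo X U (W k)) :
    IsCombo X U fun x => ∑ k ∈ s, W k x := by
  classical
  induction s using Finset.induction_on with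
  | empty => simpa using IsCombo.zero
  | insert k s hk ih =>
    have h1 := (h k (Finset.mem_insert_self k s)).add
      (ih fun j hj => h j (Finset.mem_insert_of_mem hj))
    exact h1.congr fun x _ => Finset.sum_insert hk

lemma IsCombo.trans [Fintype κ] {W : κ → E → F} (h : IsCombo W U Y) (hW : ∀ k, IsCombo X U (W k)) :
    IsCombo X U Y := by
  obtain ⟨g, hg, hY⟩ := h
  exact (IsCombo.sum (s := Finset.univ) fun k _ => (hW k).smul (hg k)).congr hY

lemma isCombo_of_comp [Fintype κ] {e : κ → ι} (h : IsCombo (fun k => X (e k)) U Y) : IsCombo X U Y :=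
  h.trans fun k => isCombo_self (e k)

lemma lieBracket_sum_smul_right {X : ι → E → E} {Y S : E → E} {g : ι → E → ℝ} {x : E}
    (hg : ∀ i, AnalyticAt ℝ (g i) x) (hX : ∀ i, AnalyticAt ℝ (X i) x)
    (hY : Y =ᶠ[𝓝 x] fun x => ∑ i, g i x • X i x) :
    VectorField.lieBracket ℝ S Y x =
      ∑ i, (fderiv ℝ (g i) x (S x) • X i x + g i x • VectorField.lieBracket ℝ S (X i) x) := by
  have hder : HasFDerivAt (fun x => ∑ i, g i x • X i x)
      (∑ i, (g i x • fderiv ℝ (X i) x + (fderiv ℝ (g i) x).smulRight (X i x))) x :=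
    HasFDerivAt.fun_sum fun i _ => (hg i).differentiableAt.hasFDerivAt.fun_smul
      (hX i).differentiableAt.hasFDerivAt
  simp only [VectorField.lieBracket, hY.fderiv_eq, hY.eq_of_nhds, hder.fderiv, sum_apply,
    add_apply, smul_apply, ContinuousLinearMap.smulRight_apply, map_sum, map_smul, smul_sub,
    Finset.sum_add_distrib, Finset.sum_sub_distrib]
  abel

lemma lieBracket_sum_smul_left {X : ι → E → E} {Y S : E → E} {g : ι → E → ℝ} {x : E}
    (hg : ∀ i, AnalyticAt ℝ (g i) x) (hX : ∀ i, AnalyticAt ℝ (X i) x)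
    (hS : S =ᶠ[𝓝 x] fun x => ∑ i, g i x • X i x) :
    VectorField.lieBracket ℝ S Y x =
      ∑ i, (g i x • VectorField.lieBracket ℝ (X i) Y x + (-fderiv ℝ (g i) x (Y x)) • X i x) := by
  rw [VectorField.lieBracket_swap, lieBracket_sum_smul_right hg hX hS,
    ← Finset.sum_neg_distrib]
  refine Finset.sum_congr rfl fun i _ => ?_
  rw [VectorField.lieBracket_swap (V := X i), smul_neg, neg_smul]
  abel

/-- By the Leibniz rule, stability under the bracket with S only has to be known for the generators.
The set U does not shrink, so the lemma can be iterated without limit. -/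
lemma IsCombo.lieBracket_right [CompleteSpace E] {X : ι → E → E} {Y S : E → E} (hU : IsOpen U)
    (hX : ∀ i, AnalyticOnNhd ℝ (X i) U) (hS : AnalyticOnNhd ℝ S U)
    (hbr : ∀ i, IsCombo X U (VectorField.lieBracket ℝ S (X i))) (hY : IsCombo X U Y) :
    IsCombo X U (VectorField.lieBracket ℝ S Y) := by
  obtain ⟨g, hg, hY⟩ := hY
  have h1 : IsCombo X U fun x => ∑ i, ((fderiv ℝ (g i) x (S x)) • X i x +
      g i x • VectorField.lieBracket ℝ S (X i) x) := by
    refine IsCombo.sum fun i _ => (IsCombo.smul (fun x hx => ?_) (isCombo_self i)).add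
      ((hbr i).smul (hg i))
    exact analyticAt_clm_apply (hg i x hx).fderiv (hS x hx)
  refine h1.congr fun x hx => ?_
  exact lieBracket_sum_smul_right (fun i => hg i x hx) (fun i => hX i x hx)
    (by filter_upwards [hU.mem_nhds hx] with z hz using hY z hz)

/-- Brackets with combinations of fields. -/
lemma IsCombo.lieBracket_left [Fintype κ] [CompleteSpace E] {X : ι → E → E} {W : κ → E → E} {Y S : E → E}
    (hU : IsOpen U) (hW : ∀ k, AnalyticOnNhd ℝ (W k) U) (hWX : ∀ k, IsCombo X U (W k))
    (hY : AnalyticOnNhd ℝ Y U) (hbr : ∀ k, IsCombo X U (VectorField.lieBracket ℝ (W k) Y))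
    (hS : IsCombo W U S) : IsCombo X U (VectorField.lieBracket ℝ S Y) := by
  obtain ⟨g, hg, hS⟩ := hS
  have h1 : IsCombo X U fun x => ∑ k, (g k x • VectorField.lieBracket ℝ (W k) Y x +
      (-fderiv ℝ (g k) x (Y x)) • W k x) := by
    refine IsCombo.sum fun k _ => ((hbr k).smul (hg k)).add (IsCombo.smul (fun x hx => ?_) (hWX k))
    exact (analyticAt_clm_apply (hg k x hx).fderiv (hY x hx)).neg
  refine h1.congr fun x hx => ?_
  exact lieBracket_sum_smul_left (fun i => hg i x hx) (fun i => hW i x hx)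
    (by filter_upwards [hU.mem_nhds hx] with z hz using hS z hz)

open Classical in
/-- A germ of a combination of finitely many fields. -/
lemma coe_mem_locSpan_range_iff : (Y : Germ (𝓝 x₀) F) ∈ locSpan x₀ (range X) ↔
    ∃ U, IsOpen U ∧ x₀ ∈ U ∧ IsCombo X U Y := by
  rw [mem_locSpan_iff]
  constructor
  · rintro ⟨N, W, g, hW, hg, hY⟩
    choose e he using hW
    obtain ⟨U, hU, hUo, hxU⟩ := eventually_nhds_iff.1
      (hY.and (eventually_all.2 fun i => (hg i).eventually_analyticAt))
    refine ⟨U, hUo, hxU, isCombo_of_comp (e := e) ⟨g, fun i x hx => (hU x hx).2 i, fun x hx => ?_⟩⟩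
    simp only [he]
    exact (hU x hx).1
  · rintro ⟨U, hU, hx, g, hg, hY⟩
    refine ⟨Fintype.card ι, fun i => X ((Fintype.equivFin ι).symm i),
      fun i => g ((Fintype.equivFin ι).symm i), fun i => ⟨_, rfl⟩, fun i => hg _ _ hx, ?_⟩
    filter_upwards [hU.mem_nhds hx] with x hx
    rw [hY x hx]
    exact ((Fintype.equivFin ι).symm.sum_comp fun i => g i x • X i x).symm

/-- The Leibniz rule for germs. The submodule P receives both the fields of G, which appear with
differentiated coefficients, and their brackets. -/
lemma lieBracket_mem_locSpan [CompleteSpace E] {G : Set (E → E)}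
    {P : Submodule (analyticGerms x₀) (Germ (𝓝 x₀) E)} {S Y : E → E} (hS : AnalyticAt ℝ S x₀)
    (hG : ∀ X ∈ G, AnalyticAt ℝ X x₀) (hGP : ∀ X ∈ G, (X : Germ (𝓝 x₀) E) ∈ P)
    (hbr : ∀ X ∈ G, (VectorField.lieBracket ℝ S X : Germ (𝓝 x₀) E) ∈ P)
    (hY : (Y : Germ (𝓝 x₀) E) ∈ locSpan x₀ G) :
    (VectorField.lieBracket ℝ S Y : Germ (𝓝 x₀) E) ∈ P := by
  obtain ⟨N, X, g, hX, hg, hYX⟩ := mem_locSpan_iff.1 hY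
  have h1 : (VectorField.lieBracket ℝ S Y : Germ (𝓝 x₀) E) = ((fun x => ∑ i,
      (fderiv ℝ (g i) x (S x) • X i x + g i x • VectorField.lieBracket ℝ S (X i) x) : E → E) :
        Germ (𝓝 x₀) E) := by
    refine Germ.coe_eq.2 ?_
    filter_upwards [eventually_eventually_nhds.2 hYX,
      eventually_all.2 fun i => (hg i).eventually_analyticAt,
      eventually_all.2 fun i => (hG _ (hX i)).eventually_analyticAt] with x h1 h2 h3
    exact lieBracket_sum_smul_right h2 h3 h1
  rw [h1, coe_finset_sum_germ]
  refine Submodule.sum_mem _ fun i _ => ?_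
  have hd : AnalyticAt ℝ (fun x => fderiv ℝ (g i) x (S x)) x₀ := analyticAt_clm_apply (hg i).fderiv hS
  exact P.add_mem (P.smul_mem (germOf _ hd) (hGP _ (hX i)))
    (P.smul_mem (germOf _ (hg i)) (hbr _ (hX i)))

end Combinations

/-! ### Linear algebra for the choice of depths -/

section SingleSection

/-- If, for each `δ > 0`, the vectors `u α t` with `0 < t < δ` span the space, one may choose a
basis formed by such vectors, at strictly decreasing values of `t`. -/
lemma exists_linearIndependent_strictAnti {V : Type*} [AddCommGroup V] [Module ℝ V]
    [FiniteDimensional ℝ V] {κ : Type*} (u : κ → ℝ → V)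
    (hu : ∀ δ : ℝ, 0 < δ → Submodule.span ℝ {v | ∃ α, ∃ t ∈ Ioo 0 δ, u α t = v} = ⊤)
    (N : ℕ) (hN : N ≤ Module.finrank ℝ V) {δ : ℝ} (hδ : 0 < δ) :
    ∃ (τ : Fin N → ℝ) (α : Fin N → κ), StrictAnti τ ∧ (∀ j, τ j ∈ Ioo 0 δ) ∧
      LinearIndependent ℝ fun j => u (α j) (τ j) := by
  induction N with
  | zero => exact ⟨fun j => j.elim0, fun j => j.elim0, fun j => j.elim0, fun j => j.elim0,
      linearIndependent_empty_type⟩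
  | succ N ih =>
    obtain ⟨τ, α, hanti, hτ, hlin⟩ := ih (by omega)
    -- The next vector is sought at a time below all chosen ones; the spanning assumption is
    -- available on every such interval.
    obtain ⟨δ', hδ', hδδ', hlt⟩ : ∃ δ' : ℝ, 0 < δ' ∧ δ' ≤ δ ∧ ∀ j, δ' ≤ τ j := by
      rcases isEmpty_or_nonempty (Fin N) with h | h
      · exact ⟨δ, hδ, le_rfl, fun j => h.elim j⟩
      · obtain ⟨j, hj⟩ := Finite.exists_min τ
        exact ⟨τ j, (hτ j).1, (hτ j).2.le, hj⟩
    obtain ⟨β, t, ht, hnot⟩ : ∃ β, ∃ t ∈ Ioo 0 δ',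
        u β t ∉ Submodule.span ℝ (range fun j => u (α j) (τ j)) := by
      by_contra! hcon
      have h1 : Submodule.span ℝ {v | ∃ α, ∃ t ∈ Ioo 0 δ', u α t = v} ≤
          Submodule.span ℝ (range fun j => u (α j) (τ j)) := by
        refine Submodule.span_le.2 ?_
        rintro v ⟨β, t, ht, rfl⟩
        exact hcon β t ht
      rw [hu δ' hδ', top_le_iff] at h1
      have h2 := finrank_span_eq_card hlin
      rw [h1, finrank_top, Fintype.card_fin] at h2
      omega
    refine ⟨Fin.snoc τ t, Fin.snoc α β, ?_, fun j => ?_, ?_⟩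
    · intro i j hij
      refine Fin.lastCases (fun hij => ?_) (fun j hij => ?_) j hij
      · obtain ⟨i, rfl⟩ := Fin.eq_castSucc_of_ne_last hij.ne
        simpa using ht.2.trans_le (hlt i)
      · obtain ⟨i, rfl⟩ := Fin.eq_castSucc_of_ne_last (hij.trans_le (Fin.le_last _)).ne
        simpa using hanti (by simpa using hij)
    · refine Fin.lastCases ?_ (fun j => ?_) j
      · simpa using ⟨ht.1, ht.2.trans_le hδδ'⟩
      · simpa using hτ j
    · have h3 : (fun j : Fin (N + 1) => u (Fin.snoc (α := fun _ => κ) α β j)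
          (Fin.snoc (α := fun _ => ℝ) τ t j)) =
          Fin.snoc (α := fun _ => V) (fun j => u (α j) (τ j)) (u β t) := by
        funext j
        refine Fin.lastCases ?_ (fun j => ?_) j <;> simp
      rw [h3]
      exact linearIndependent_finSnoc.2 ⟨hlin, hnot⟩

lemma analyticAt_det {E ι : Type*} [NormedAddCommGroup E] [NormedSpace ℝ E] [Fintype ι]
    [DecidableEq ι] {M : ι → ι → E → ℝ} {x : E} (hM : ∀ i j, AnalyticAt ℝ (M i j) x) :
    AnalyticAt ℝ (fun x => Matrix.det (Matrix.of fun i j => M i j x)) x := by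
  simp only [Matrix.det_apply, Matrix.of_apply]
  refine Finset.analyticAt_fun_sum _ fun σ _ => ?_
  simp only [Units.smul_def, zsmul_eq_mul]
  exact analyticAt_const.mul (Finset.analyticAt_fun_prod _ fun i _ => hM _ _)

/-- Inversion of a system of linear relations between fields. -/
lemma exists_inverse_relations {E F ι : Type*} [NormedAddCommGroup E] [NormedSpace ℝ E]
    [NormedAddCommGroup F] [NormedSpace ℝ F] [Fintype ι] [DecidableEq ι] {M : ι → ι → E → ℝ}
    {x₀ : E} (hM : ∀ i j, AnalyticAt ℝ (M i j) x₀)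
    (hdet : IsUnit (Matrix.of fun i j => M i j x₀)) {X Y : ι → E → F}
    (hY : ∀ i, Y i =ᶠ[𝓝 x₀] fun x => ∑ j, M i j x • X j x) (i : ι) :
    (X i : Germ (𝓝 x₀) F) ∈ locSpan x₀ (range Y) := by
  have hd : AnalyticAt ℝ (fun x => Matrix.det (Matrix.of fun i j => M i j x)) x₀ :=
    analyticAt_det hM
  have hne : Matrix.det (Matrix.of fun i j => M i j x₀) ≠ 0 :=
    ((Matrix.isUnit_iff_isUnit_det _).1 hdet).ne_zero
  have hadj : ∀ j, AnalyticAt ℝ (fun x => (Matrix.adjugate (Matrix.of fun i j => M i j x)) i j)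
      x₀ := by
    intro j
    have h1 : AnalyticAt ℝ (fun x => Matrix.det (Matrix.of fun k l =>
        (if k = j then fun _ => (Pi.single i 1 : ι → ℝ) l else M k l) x)) x₀ := by
      refine analyticAt_det fun k l => ?_
      split_ifs
      · exact analyticAt_const
      · exact hM k l
    refine h1.congr (Eventually.of_forall fun x => ?_)
    simp only [Matrix.adjugate_apply]
    congr 1
    ext k l
    by_cases hk : k = j
    · subst hk; simp
    · simp [hk, Matrix.updateRow_apply]
  rw [coe_mem_locSpan_range_iff]
  obtain ⟨U, hU, hUo, hxU⟩ := eventually_nhds_iff.1 (((eventually_all.2 hY).and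
    (hd.continuousAt.eventually_ne hne)).and ((hd.inv hne).eventually_analyticAt.and
      (eventually_all.2 fun j => (hadj j).eventually_analyticAt)))
  refine ⟨U, hUo, hxU, fun j x => (Matrix.det (Matrix.of fun i j => M i j x))⁻¹ *
    (Matrix.adjugate (Matrix.of fun i j => M i j x)) i j,
    fun j x hx => (hU x hx).2.1.mul ((hU x hx).2.2 j), fun x hx => ?_⟩
  have h2 := Matrix.adjugate_mul (Matrix.of fun i j => M i j x)
  have h3 : ∀ l, ∑ j, (Matrix.adjugate (Matrix.of fun i j => M i j x)) i j * M j l x =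
      if i = l then Matrix.det (Matrix.of fun i j => M i j x) else 0 := by
    intro l
    have := congrFun (congrFun h2 i) l
    simpa [Matrix.mul_apply, Matrix.one_apply] using this
  have h4 : ∑ j, (Matrix.adjugate (Matrix.of fun i j => M i j x)) i j • Y j x =
      Matrix.det (Matrix.of fun i j => M i j x) • X i x := by
    simp only [(hU x hx).1.1, Finset.smul_sum, smul_smul]
    rw [Finset.sum_comm]
    simp only [← Finset.sum_smul, h3]
    simp
  simp only [mul_smul]
  rw [← Finset.smul_sum, h4, smul_smul, inv_mul_cancel₀ (hU x hx).1.2, one_smul]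

end SingleSection

/-! ### Generators from one section -/

section SingleSection

variable {n m : ℕ} {Ω : Set (Ext n m)} {S : Ext n m → Ext n m} {x₀ : Ext n m}

open Classical in
/-- The iterated brackets with `S` satisfy, near a point, a linear relation of companion type. -/
lemma exists_companion_relations (hS : AnalyticAt ℝ S x₀) :
    ∃ (ν : ℕ) (a : Fin (ν + 1) × Fin m → Fin (ν + 1) × Fin m → Ext n m → ℝ),
      (∀ k α, (adField S k α : Germ (𝓝 x₀) (Ext n m)) ∈
        locSpan x₀ (range fun i : Fin (ν + 1) × Fin m => adField S i.1 i.2)) ∧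
      (∀ i j, AnalyticAt ℝ (a i j) x₀) ∧
      (∀ i, VectorField.lieBracket ℝ S (adField S i.1 i.2) =ᶠ[𝓝 x₀]
        fun x => ∑ j, a i j x • adField S j.1 j.2 x) ∧
      ∀ (i : Fin (ν + 1) × Fin m) (h : i.1.1 + 1 < ν + 1),
        a i = fun j _ => if j = (⟨i.1.1 + 1, h⟩, i.2) then 1 else 0 := by
  obtain ⟨s, hs, hspan⟩ := exists_finset_locSpan_eq x₀
    {X : Ext n m → Ext n m | ∃ k α, X = adField S k α} (by
      rintro _ ⟨k, α, rfl⟩; exact analyticAt_adField hS k α)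
  have hs' : ∀ X ∈ s, ∃ k, ∃ α, X = adField S k α := fun X hX => hs hX
  choose! κ hκ using hs'
  -- All brackets up to the highest order in a finite generating set are kept. Then the bracket with
  -- S merely raises the order, except at order ν, where a relation is needed.
  obtain ⟨ν, hν⟩ : ∃ ν, ∀ X ∈ s, κ X ≤ ν := ⟨s.sup κ, fun X hX => Finset.le_sup hX⟩
  have hgen : ∀ k α, (adField S k α : Germ (𝓝 x₀) (Ext n m)) ∈
      locSpan x₀ (range fun i : Fin (ν + 1) × Fin m => adField S i.1 i.2) := by
    intro k α
    have h1 : (adField S k α : Germ (𝓝 x₀) (Ext n m)) ∈ locSpan x₀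
        {X : Ext n m → Ext n m | ∃ k α, X = adField S k α} :=
      Submodule.subset_span ⟨_, ⟨k, α, rfl⟩, rfl⟩
    rw [hspan] at h1
    refine Submodule.span_mono (image_mono ?_) h1
    intro X hX
    obtain ⟨α, hα⟩ := hκ X hX
    exact ⟨(⟨κ X, by have := hν X hX; omega⟩, α), hα.symm⟩
  have hrel : ∀ i : Fin (ν + 1) × Fin m, ∃ g : Fin (ν + 1) × Fin m → Ext n m → ℝ,
      (∀ j, AnalyticAt ℝ (g j) x₀) ∧ (VectorField.lieBracket ℝ S (adField S i.1 i.2) =ᶠ[𝓝 x₀]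
        fun x => ∑ j, g j x • adField S j.1 j.2 x) ∧ ∀ h : i.1.1 + 1 < ν + 1,
        g = fun j _ => if j = (⟨i.1.1 + 1, h⟩, i.2) then 1 else 0 := by
    intro i
    rw [← adField_succ]
    by_cases h : i.1.1 + 1 < ν + 1
    · exact ⟨fun j _ => if j = (⟨i.1.1 + 1, h⟩, i.2) then 1 else 0, fun _ => analyticAt_const,
        Eventually.of_forall fun x => by simp, fun _ => rfl⟩
    · obtain ⟨U, hU, hx, g, hg, hY⟩ := coe_mem_locSpan_range_iff.1 (hgen (i.1 + 1) i.2)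
      exact ⟨g, fun j => hg j x₀ hx, by filter_upwards [hU.mem_nhds hx] with x hx using hY x hx,
        fun h' => absurd h' h⟩
  choose a ha using hrel
  exact ⟨ν, a, hgen, fun i => (ha i).1, fun i => (ha i).2.1, fun i => (ha i).2.2⟩

open Classical in
-- Surrogate fields are combinations of the brackets with coefficients in the rows of index (0, α)
-- of the transition matrix. As many depths as there are brackets can be chosen so that these rows
-- form an invertible matrix at the point, and so nearby.
lemma exists_surrogates_locSpan (hΩ : IsOpen Ω) (hS : AnalyticOnNhd ℝ S Ω) (hx₀ : x₀ ∈ Ω)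
    {δ : ℝ} (hδ : 0 < δ) : ∃ (N : ℕ) (τ : Fin N → ℝ) (lam : Fin N → (Fin m → ℝ)), StrictAnti τ ∧
      (∀ i, τ i ∈ Ioo 0 δ ∧ x₀ ∈ surrogateDom Ω S (τ i)) ∧
      (∀ i, (surrogate Ω S (τ i) (lam i) : Germ (𝓝 x₀) (Ext n m)) ∈
        locSpan x₀ {X | ∃ k α, X = adField S k α}) ∧
      ∀ k α, (adField S k α : Germ (𝓝 x₀) (Ext n m)) ∈
        locSpan x₀ (range fun i => surrogate Ω S (τ i) (lam i)) := by
  obtain ⟨ν, a, hgen, ha, hbr, hcomp⟩ := exists_companion_relations (hS x₀ hx₀)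
  obtain ⟨A, hA, hev⟩ := exists_pushFlow_eq_sum hΩ hS hx₀
    (fun i x hx => analyticAt_adField (hS x hx) _ _) ha hbr
  obtain ⟨δ₁, hδ₁, hb⟩ := Metric.eventually_nhds_iff.1 (hev.and hA.eventually_analyticAt)
  have hbox : ∀ t ∈ Ioo 0 (min δ δ₁), dist ((t, x₀) : ℝ × Ext n m) (0, x₀) < δ₁ := by
    intro t ht
    rw [Prod.dist_eq, dist_self, max_eq_left dist_nonneg]
    simpa [abs_of_pos ht.1] using (ht.2.trans_le (min_le_right _ _))
  let u : Fin m → ℝ → Fin (ν + 1) × Fin m → ℝ := fun α t => A (t, x₀) (0, α)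
  have hspan : ∀ ε : ℝ, 0 < ε → Submodule.span ℝ {v | ∃ α, ∃ t ∈ Ioo 0 ε, u α t = v} = ⊤ := by
    intro ε hε
    by_contra hne
    obtain ⟨ℓ, hℓ, hker⟩ := Submodule.exists_le_ker_of_lt_top _ (lt_top_iff_ne_top.2 hne)
    let L : (Fin (ν + 1) × Fin m → ℝ) →L[ℝ] ℝ := LinearMap.toContinuousLinearMap ℓ
    set η := min ε (min δ δ₁) with hη
    have hη0 : 0 < η := lt_min hε (lt_min hδ hδ₁)
    -- A linear form that kills the rows of order 0 on an interval kills their derivatives, which by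
    -- the companion form are, up to sign, the rows of the next order.
    have hzero : ∀ (k : ℕ) (hk : k < ν + 1) (α : Fin m), ∀ t ∈ Ioo 0 η,
        L (A (t, x₀) (⟨k, hk⟩, α)) = 0 := by
      intro k
      induction k with
      | zero =>
        intro hk α t ht
        exact hker (Submodule.subset_span ⟨α, t, ⟨ht.1, ht.2.trans_le (min_le_left _ _)⟩, rfl⟩)
      | succ k ih =>
        intro hk α t ht
        have ht' := hb (hbox t ⟨ht.1, ht.2.trans_le (min_le_right _ _)⟩)
        have h1 : HasDerivAt (fun t => A (t, x₀) (⟨k, by omega⟩, α))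
            (-A (t, x₀) (⟨k + 1, hk⟩, α)) t := by
          refine hasDerivAt_pi.2 fun j => ?_
          have h2 := ht'.1.2.2.1 (⟨k, by omega⟩, α) j
          rw [hcomp (⟨k, by omega⟩, α) hk] at h2
          simpa using h2
        have h3 := L.hasFDerivAt.comp_hasDerivAt t h1
        have h4 : (L ∘ fun t => A (t, x₀) (⟨k, by omega⟩, α)) =ᶠ[𝓝 t] fun _ => 0 := by
          filter_upwards [Ioo_mem_nhds ht.1 ht.2] with r hr using ih _ α r hr
        have h5 := h3.unique ((hasDerivAt_const t (0 : ℝ)).congr_of_eventuallyEq h4)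
        simpa using h5
    -- As t tends to 0 the transition matrix tends to the identity, and the form kills every basis
    -- vector.
    have hbasis : ∀ i, L (Pi.single i 1) = 0 := by
      intro i
      have h0 : A (0, x₀) i = Pi.single i 1 := by
        rw [(hb (y := (0, x₀)) (by simpa using hδ₁)).1.2.1]
        funext j
        simp [Pi.single_apply, eq_comm]
      have hcont : ContinuousAt (fun t => L (A (t, x₀) i)) 0 := by
        refine L.continuous.continuousAt.comp ?_
        have h1 : ContinuousAt A (0, x₀) := hA.continuousAt
        have h2 : ContinuousAt (fun t : ℝ => A (t, x₀)) 0 :=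
          ContinuousAt.comp (g := A) (f := fun t : ℝ => (t, x₀)) h1 (by fun_prop)
        exact (continuous_apply i).continuousAt.comp h2
      have h1 : Tendsto (fun t => L (A (t, x₀) i)) (𝓝[>] 0) (𝓝 (L (A (0, x₀) i))) :=
        hcont.tendsto.mono_left nhdsWithin_le_nhds
      have h2 : (fun t => L (A (t, x₀) i)) =ᶠ[𝓝[>] 0] fun _ => 0 := by
        filter_upwards [Ioo_mem_nhdsGT hη0] with t ht using hzero i.1.1 i.1.2 i.2 t ht
      rw [← h0]
      exact tendsto_nhds_unique h1 (tendsto_const_nhds.congr' h2.symm)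
    refine hℓ (LinearMap.pi_ext' fun i => LinearMap.ext_ring ?_)
    rw [LinearMap.comp_apply, LinearMap.zero_comp, LinearMap.zero_apply]
    exact hbasis i
  obtain ⟨τ, α, hanti, hτ, hlin⟩ := exists_linearIndependent_strictAnti u hspan
    (Fintype.card (Fin (ν + 1) × Fin m)) (by simp) (lt_min hδ hδ₁)
  let e := Fintype.equivFin (Fin (ν + 1) × Fin m)
  let M : Fin (ν + 1) × Fin m → Fin (ν + 1) × Fin m → Ext n m → ℝ :=
    fun i j x => A (τ (e i), x) (0, α (e i)) j
  have hM : ∀ i j, AnalyticAt ℝ (M i j) x₀ := by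
    intro i j
    have h1 : AnalyticAt ℝ (fun x => A (τ (e i), x)) x₀ :=
      AnalyticAt.fun_comp (g := A) (f := fun x => (τ (e i), x)) (hb (hbox _ (hτ (e i)))).2
        (analyticAt_const.prod analyticAt_id)
    exact analyticAt_pi_iff.1 (analyticAt_pi_iff.1 h1 _) j
  have hdet : IsUnit (Matrix.of fun i j => M i j x₀) := by
    rw [← Matrix.linearIndependent_rows_iff_isUnit]
    exact hlin.comp e e.injective
  have hY : ∀ i, surrogate Ω S (τ (e i)) (Pi.single (α (e i)) 1) =ᶠ[𝓝 x₀]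
      fun x => ∑ j, M i j x • adField S j.1 j.2 x := by
    intro i
    have h1 : ContinuousAt (fun x : Ext n m => (τ (e i), x)) x₀ := by fun_prop
    have h2 := h1.tendsto.eventually (Metric.isOpen_ball.mem_nhds (hbox _ (hτ (e i))))
    filter_upwards [h2] with x hx
    exact (hb hx).1.2.2.2 (hτ (e i)).1.le (0, α (e i))
  refine ⟨_, τ, fun j => Pi.single (α j) 1, hanti, fun j => ⟨⟨(hτ j).1, (hτ j).2.trans_le
    (min_le_left _ _)⟩, (hb (hbox _ (hτ j))).1.1⟩, fun j => ?_, fun k α' => ?_⟩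
  · obtain ⟨i, rfl⟩ := e.surjective j
    have h1 : (surrogate Ω S (τ (e i)) (Pi.single (α (e i)) 1) : Germ (𝓝 x₀) (Ext n m)) ∈
        locSpan x₀ (range fun i : Fin (ν + 1) × Fin m => adField S i.1 i.2) := by
      obtain ⟨U, hU, hUo, hxU⟩ := eventually_nhds_iff.1 ((hY i).and
        (eventually_all.2 fun j => (hM i j).eventually_analyticAt))
      exact coe_mem_locSpan_range_iff.2 ⟨U, hUo, hxU, M i, fun j x hx => (hU x hx).2 j,
        fun x hx => (hU x hx).1⟩
    refine Submodule.span_mono (image_mono ?_) h1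
    rintro _ ⟨i, rfl⟩
    exact ⟨_, _, rfl⟩
  · have h1 : locSpan x₀ (range fun i : Fin (ν + 1) × Fin m => adField S i.1 i.2) ≤
        locSpan x₀ (range fun j => surrogate Ω S (τ j) (Pi.single (α j) 1)) := by
      refine Submodule.span_le.2 ?_
      rintro _ ⟨_, ⟨i, rfl⟩, rfl⟩
      have h2 := exists_inverse_relations hM hdet hY i
      refine Submodule.span_mono (image_mono ?_) h2
      rintro _ ⟨i, rfl⟩
      exact ⟨e i, rfl⟩
    exact h1 (hgen k α')

lemma exists_isCombination {G : Set (Ext n m → Ext n m)} {Y : Ext n m → Ext n m}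
    (h : (Y : Germ (𝓝 x₀) (Ext n m)) ∈ locSpan x₀ G) :
    ∀ᶠ U in (𝓝 x₀).smallSets, IsCombination G U Y := by
  obtain ⟨N, X, g, hX, hg, hY⟩ := mem_locSpan_iff.1 h
  filter_upwards [(hY.and (eventually_all.2 fun i => (hg i).eventually_analyticAt)).smallSets]
    with U hU
  exact ⟨N, X, g, hX, fun i x hx => (hU x hx).2 i, fun x hx => (hU x hx).1⟩

/-- Stated with `smallSets`, so that finitely many germ relations can be realized together on one
neighbourhood and all its subsets. -/
lemma eventually_isCombo {ι : Type*} [Fintype ι] {X : ι → Ext n m → Ext n m} {Y : Ext n m → Ext n m}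
    (h : (Y : Germ (𝓝 x₀) (Ext n m)) ∈ locSpan x₀ (range X)) :
    ∀ᶠ U in (𝓝 x₀).smallSets, IsCombo X U Y := by
  obtain ⟨U, hU, hx, hc⟩ := coe_mem_locSpan_range_iff.1 h
  filter_upwards [eventually_smallSets_subset.2 (hU.mem_nhds hx)] with V hV using hc.mono hV

/-- Surrogate fields of a section generate the brackets with this section. -/
theorem exists_generators_secondaryOf (hΩ : IsOpen Ω) (hS : AnalyticOnNhd ℝ S Ω) (hx₀ : x₀ ∈ Ω)
    {δ : ℝ} (hδ : 0 < δ) : ∃ U₀ : Set (Ext n m), IsOpen U₀ ∧ x₀ ∈ U₀ ∧ U₀ ⊆ Ω ∧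
      ∀ U : Set (Ext n m), IsOpen U → x₀ ∈ U → U ⊆ U₀ →
        ∃ (N : ℕ) (τ : Fin N → ℝ) (lam : Fin N → (Fin m → ℝ)), StrictAnti τ ∧
          (∀ i, 0 < τ i ∧ τ i < δ ∧ U ⊆ surrogateDom Ω S (τ i)) ∧
          IsGeneratingTuple (SecondaryOf S) U (fun i => surrogate Ω S (τ i) (lam i)) := by
  obtain ⟨N, τ, lam, hanti, hτ, hsur, had⟩ := exists_surrogates_locSpan hΩ hS hx₀ hδ
  have hbr : ∀ i, (VectorField.lieBracket ℝ S (surrogate Ω S (τ i) (lam i)) :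
      Germ (𝓝 x₀) (Ext n m)) ∈ locSpan x₀ (range fun i => surrogate Ω S (τ i) (lam i)) := by
    intro i
    refine lieBracket_mem_locSpan (hS x₀ hx₀) ?_ ?_ ?_ (hsur i)
    · rintro _ ⟨k, α, rfl⟩
      exact analyticAt_adField (hS x₀ hx₀) k α
    · rintro _ ⟨k, α, rfl⟩
      exact had k α
    · rintro _ ⟨k, α, rfl⟩
      rw [← adField_succ]
      exact had _ _
  have hdom : ∀ i, ∀ᶠ U in (𝓝 x₀).smallSets, U ⊆ surrogateDom Ω S (τ i) := fun i =>
    eventually_smallSets_subset.2 ((isOpen_flowDom hΩ hS).mem_nhds (hτ i).2)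
  obtain ⟨V, hV, hVU⟩ := eventually_smallSets.1
    (((eventually_smallSets_subset.2 (hΩ.mem_nhds hx₀)).and (eventually_all.2 hdom)).and
      ((eventually_all.2 fun i => exists_isCombination (hsur i)).and
        ((eventually_all.2 fun α => eventually_isCombo (had 0 α)).and
          (eventually_all.2 fun i => eventually_isCombo (hbr i)))))
  obtain ⟨⟨hVΩ, hVdom⟩, hVsur, hVvert, hVbr⟩ := hVU _ (interior_subset (s := V))
  have hsan : ∀ i, AnalyticOnNhd ℝ (surrogate Ω S (τ i) (lam i)) (interior V) := fun i x hx =>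
    analyticAt_surrogate hΩ hS (fun _ _ => analyticAt_const) (hVdom i hx)
  -- Infinitely many brackets on one neighbourhood: only the fields ∂/∂w^α and the brackets of S
  -- with the generators came from germs.
  have hall : ∀ k α, IsCombo (fun i => surrogate Ω S (τ i) (lam i)) (interior V)
      (adField S k α) := by
    intro k α
    induction k with
    | zero => exact hVvert α
    | succ k ih =>
      rw [adField_succ]
      exact ih.lieBracket_right isOpen_interior hsan (hS.mono hVΩ) hVbr
  refine ⟨interior V, isOpen_interior, mem_interior_iff_mem_nhds.2 hV, hVΩ, fun U hU hxU hUV =>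
    ⟨N, τ, lam, hanti, fun i => ⟨(hτ i).1.1, (hτ i).1.2, hUV.trans (hVdom i)⟩, fun i => ?_,
      fun U' hU' hU'U Y hY => ?_⟩⟩
  · obtain ⟨M, X, g, hX, hg, hY⟩ := hVsur i
    exact ⟨M, X, g, hX, fun j => (hg j).mono hUV, fun x hx => hY x (hUV hx)⟩
  · obtain ⟨M, X, g, hX, hg, hY⟩ := hY
    refine IsCombo.trans (W := X) ⟨g, hg, hY⟩ fun j => ?_
    obtain ⟨k, α, hkα⟩ := hX j
    rw [hkα]
    exact (hall k α).mono (hU'U.trans hUV)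

end SingleSection

/-! ### Comparison of coefficients in perturbed iterates -/

section Coefficients

variable {M : Type*} [AddCommGroup M] [Module ℝ M] {W : Submodule ℝ M}

/-- The coefficients of a polynomial with values in a subspace are in that subspace. -/
lemma mem_of_forall_sum_pow_smul_mem {v : ℕ → M} {N : ℕ}
    (h : ∀ c : ℝ, ∑ k ∈ Finset.range N, c ^ k • v k ∈ W) {k : ℕ} (hk : k < N) : v k ∈ W := by
  rw [← Submodule.Quotient.mk_eq_zero, ← Module.forall_dual_apply_eq_zero_iff ℝ]
  intro φ
  have hp : ∑ k ∈ Finset.range N,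
      Polynomial.C (φ (Submodule.Quotient.mk (v k) : M ⧸ W)) * Polynomial.X ^ k = 0 := by
    refine Polynomial.funext fun c => ?_
    have h1 := (Submodule.Quotient.mk_eq_zero W).2 (h c)
    rw [← Submodule.mkQ_apply, map_sum] at h1
    have h2 := congrArg φ h1
    rw [map_sum, map_zero] at h2
    rw [Polynomial.eval_finsetSum, Polynomial.eval_zero, ← h2]
    refine Finset.sum_congr rfl fun k _ => ?_
    rw [Polynomial.eval_mul, Polynomial.eval_C, Polynomial.eval_pow, Polynomial.eval_X, map_smul,
      map_smul, smul_eq_mul, mul_comm, Submodule.mkQ_apply]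
  have h3 := congrArg (fun p => Polynomial.coeff p k) hp
  simpa [Polynomial.finsetSum_coeff, Polynomial.coeff_C_mul, Polynomial.coeff_X_pow, hk] using h3

variable (A B : Module.End ℝ M) (z : M)

/-- The term which is linear in `B` in the expansion of `(A + r + B) ^ k z`. -/
def linearTerm (r : ℝ) : ℕ → M
  | 0 => 0
  | k + 1 => A (linearTerm r k) + r • linearTerm r k + B ((A ^ k) z)

/-- The coefficients of `linearTerm`, as a polynomial in the parameter. -/
def linearCoeff : ℕ → ℕ → M
  | 0, _ => 0
  | k + 1, 0 => A (linearCoeff k 0) + B ((A ^ k) z)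
  | k + 1, l + 1 => A (linearCoeff k (l + 1)) + linearCoeff k l

lemma linearCoeff_eq_zero {k l : ℕ} (h : k ≤ l) : linearCoeff A B z k l = 0 := by
  induction k generalizing l with
  | zero => rfl
  | succ k ih =>
    obtain ⟨l, rfl⟩ := Nat.exists_eq_add_of_le' (Nat.one_le_of_lt h)
    simp [linearCoeff, ih (show k ≤ l + 1 by omega), ih (show k ≤ l by omega)]

lemma linearTerm_eq_sum (r : ℝ) (k : ℕ) :
    linearTerm A B z r k = ∑ l ∈ Finset.range (k + 1), r ^ l • linearCoeff A B z k l := by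
  induction k with
  | zero => simp [linearTerm, linearCoeff]
  | succ k ih =>
    have h1 : linearTerm A B z r k = linearCoeff A B z k 0 +
        ∑ l ∈ Finset.range (k + 1), r ^ (l + 1) • linearCoeff A B z k (l + 1) := by
      rw [ih, Finset.sum_range_succ', Finset.sum_range_succ,
        linearCoeff_eq_zero A B z (show k ≤ k + 1 by omega)]
      simp [add_comm]
    rw [Finset.sum_range_succ', linearTerm]
    nth_rewrite 2 [ih]
    rw [h1]
    simp only [linearCoeff, map_add, map_sum, map_smul, Finset.smul_sum, smul_smul, pow_zero,
      one_smul, smul_add, Finset.sum_add_distrib, pow_succ']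
    abel

/-- The commutation rule moves P to the left past A at the cost of replacing A by A + r. The
coefficient of c is therefore P applied to the sum over i < k of (A + r)^{k-1-i} B A^i z. -/
lemma exists_expansion {P : Module.End ℝ M} {r : ℝ}
    (hAP : ∀ x, A (P x) = P (A x + r • x)) (k : ℕ) :
    ∃ v : ℕ → M, v 0 = (A ^ k) z ∧ v 1 = P (linearTerm A B z r k) ∧ (∀ d, k < d → v d = 0) ∧
      ∀ c : ℝ, ((A + c • (P * B)) ^ k) z = ∑ d ∈ Finset.range (k + 2), c ^ d • v d := by
  induction k with
  | zero =>
    refine ⟨fun d => if d = 0 then z else 0, by simp, by simp [linearTerm],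
      fun d hd => if_neg hd.ne', fun c => ?_⟩
    simp
  | succ k ih =>
    obtain ⟨v, h0, h1, hv, hsum⟩ := ih
    let v' : ℕ → M := fun d => Nat.casesOn d (A (v 0)) fun d => A (v (d + 1)) + P (B (v d))
    have hv0 : v' 0 = A (v 0) := rfl
    have hvs : ∀ d, v' (d + 1) = A (v (d + 1)) + P (B (v d)) := fun _ => rfl
    refine ⟨v', ?_, ?_, ?_, fun c => ?_⟩
    · simp [hv0, h0, pow_succ']
    · rw [← zero_add 1, hvs, zero_add, h0, h1, hAP, linearTerm]
      simp only [map_add]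
    · rintro (_ | d) hd
      · omega
      · simp [hvs, hv d (by omega), hv (d + 1) (by omega)]
    · have h2 : ∑ d ∈ Finset.range (k + 2), c ^ d • v d =
          v 0 + ∑ d ∈ Finset.range (k + 2), c ^ (d + 1) • v (d + 1) := by
        rw [Finset.sum_range_succ', Finset.sum_range_succ _ (k + 1), hv (k + 1 + 1) (by omega)]
        simp [add_comm]
      rw [pow_succ', Module.End.mul_apply, hsum c, LinearMap.add_apply, LinearMap.smul_apply,
        Module.End.mul_apply, Finset.sum_range_succ' _ (k + 2)]
      nth_rewrite 1 [h2]
      simp only [hv0, hvs, map_add, map_sum, map_smul, Finset.smul_sum, smul_smul, pow_zero,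
        one_smul, smul_add, Finset.sum_add_distrib, pow_succ']
      abel

/-- If the iterates of all the operators `A + c P_r B` send `z` into `W`, so do the operators
`B A ^ k`. -/
lemma apply_pow_mem_of_perturbations {P : ℝ → Module.End ℝ M} (hP : ∀ r x, P r x ∈ W → x ∈ W)
    (hAP : ∀ r x, A (P r x) = P r (A x + r • x))
    (h : ∀ (c r : ℝ) (k : ℕ), ((A + c • (P r * B)) ^ k) z ∈ W) (k : ℕ) : B ((A ^ k) z) ∈ W := by
  have hF : ∀ r k, linearTerm A B z r k ∈ W := by
    intro r k
    -- Membership for all c gives the coefficient of c, from which P r is cancelled; membership for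
    -- all r then gives each coefficient of the remaining polynomial in r.
    obtain ⟨v, -, h1, -, hsum⟩ := exists_expansion A B z (hAP r) k
    refine hP r _ ?_
    rw [← h1]
    exact mem_of_forall_sum_pow_smul_mem (fun c => hsum c ▸ h c r k) (by omega)
  have hH : ∀ k l, linearCoeff A B z k l ∈ W := by
    intro k l
    rcases le_or_gt k l with hkl | hkl
    · rw [linearCoeff_eq_zero A B z hkl]; exact W.zero_mem
    · exact mem_of_forall_sum_pow_smul_mem (fun r => linearTerm_eq_sum A B z r k ▸ hF r k)
        (hkl.trans (Nat.lt_succ_self k))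
  -- Explicitly, `E r l` is the sum over i ≤ r of binom(r + l - i, l) A^{r-i} B A^i z. The index r
  -- now counts the factors A, and the difference of `E (r + 1)` in l is A applied to `E r`.
  let E : ℕ → ℕ → M := fun r l => linearCoeff A B z (r + 1 + l) l
  have hE0 : ∀ l, E 0 (l + 1) = E 0 l := by
    intro l
    change A (linearCoeff A B z (0 + 1 + l) (l + 1)) + linearCoeff A B z (0 + 1 + l) l = _
    rw [linearCoeff_eq_zero A B z (by omega), map_zero, zero_add]
  have hE : ∀ r l, E (r + 1) (l + 1) = A (E r (l + 1)) + E (r + 1) l := by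
    intro r l
    have h1 : E r (l + 1) = linearCoeff A B z (r + 1 + 1 + l) (l + 1) := by
      simp only [E, show r + 1 + (l + 1) = r + 1 + 1 + l by omega]
    rw [h1]
    rfl
  -- W is not assumed stable under A. Each factor A is exchanged for a difference in l, at the cost
  -- of increasing l and r.
  have hlarge : ∀ i r l, (A ^ i) (E r (l + i)) ∈ W := by
    intro i
    induction i with
    | zero => exact fun r l => hH _ _
    | succ i ih =>
      intro r l
      have h1 := hE r (l + i)
      rw [← sub_eq_iff_eq_add] at h1
      rw [← add_assoc, pow_succ, Module.End.mul_apply, ← h1, map_sub]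
      exact W.sub_mem (by simpa [add_right_comm] using ih (r + 1) (l + 1)) (ih (r + 1) l)
  -- From large l one descends to every l if the differences are in W. They are, by induction on r,
  -- since they involve only `E (r - 1)`.
  have hdown : ∀ i r, (∀ l, (A ^ i) (E r (l + 1)) - (A ^ i) (E r l) ∈ W) →
      ∀ l, (A ^ i) (E r l) ∈ W := by
    intro i r hd l
    have h1 : ∀ j, (A ^ i) (E r (l + j)) ∈ W → (A ^ i) (E r l) ∈ W := by
      intro j
      induction j with
      | zero => exact id
      | succ j ih =>
        intro hj
        refine ih ?_
        have := W.sub_mem hj (hd (l + j))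
        rwa [← add_assoc, sub_sub_cancel] at this
    exact h1 i (hlarge i r l)
  have hall : ∀ r i l, (A ^ i) (E r l) ∈ W := by
    intro r
    induction r with
    | zero => exact fun i => hdown i 0 fun l => by rw [hE0, sub_self]; exact W.zero_mem
    | succ r ih =>
      refine fun i => hdown i (r + 1) fun l => ?_
      rw [hE, map_add, add_sub_cancel_right, ← Module.End.mul_apply, ← pow_succ]
      exact ih _ _
  cases k with
  | zero =>
    have h1 : E 0 0 = B ((A ^ 0) z) := by simp [E, linearCoeff]
    rw [← h1]
    exact hH _ _
  | succ k =>
    -- The last summand is what is wanted, and the other two terms are now known to be in W.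
    have h1 : E (k + 1) 0 = A (E k 0) + B ((A ^ (k + 1)) z) := rfl
    rw [← sub_eq_iff_eq_add'] at h1
    rw [← h1]
    exact W.sub_mem (hH _ _) (by simpa using hall k 1 0)

end Coefficients

/-! ### Perturbation of a section by e^{rt} V -/

section Perturbation

variable {n m : ℕ} {U : Set (Ext n m)} {S V : Ext n m → Ext n m}

/-- The space of analytic fields on `U` whose time component vanishes (extended by zero). -/
def spatialFields (U : Set (Ext n m)) : Submodule ℝ (Ext n m → Ext n m) where
  carrier := {X | AnalyticOnNhd ℝ X U ∧ (∀ x ∈ U, (X x).1 = 0) ∧ ∀ x ∉ U, X x = 0}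
  add_mem' := fun {X Y} hX hY => ⟨hX.1.add hY.1, fun x hx => by
    simp [hX.2.1 x hx, hY.2.1 x hx], fun x hx => by simp [hX.2.2 x hx, hY.2.2 x hx]⟩
  zero_mem' := ⟨fun _ _ => analyticAt_const, fun _ _ => rfl, fun _ _ => rfl⟩
  smul_mem' := fun c X hX => ⟨fun x hx => analyticAt_const.smul (hX.1 x hx), fun x hx => by
    simp [hX.2.1 x hx], fun x hx => by simp [hX.2.2 x hx]⟩

lemma indicator_mem_spatialFields (hU : IsOpen U) {X : Ext n m → Ext n m}
    (hX : AnalyticOnNhd ℝ X U) (h1 : ∀ x ∈ U, (X x).1 = 0) : U.indicator X ∈ spatialFields U := by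
  refine ⟨fun x hx => (hX x hx).congr ?_, fun x hx => ?_, fun x hx => indicator_of_notMem hx _⟩
  · filter_upwards [hU.mem_nhds hx] with z hz using (indicator_of_mem hz _).symm
  · rw [indicator_of_mem hx, h1 x hx]

lemma lieBracket_fst_eq_zero (hU : IsOpen U) {X : Ext n m → Ext n m} {c : ℝ}
    (hS : AnalyticOnNhd ℝ S U) (hSc : ∀ x ∈ U, (S x).1 = c) (hX : AnalyticOnNhd ℝ X U)
    (hX0 : ∀ x ∈ U, (X x).1 = 0) {x : Ext n m} (hx : x ∈ U) :
    (VectorField.lieBracket ℝ S X x).1 = 0 := by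
  have hconst : ∀ {Y : Ext n m → Ext n m} {c : ℝ}, AnalyticOnNhd ℝ Y U → (∀ x ∈ U, (Y x).1 = c) →
      ∀ v, (fderiv ℝ Y x v).1 = 0 := by
    intro Y c hY hYc v
    have h1 : HasFDerivAt (fun x => (Y x).1) _ x :=
      (ContinuousLinearMap.fst ℝ ℝ ((Fin n → ℝ) × (Fin m → ℝ))).hasFDerivAt.comp x
        (hY x hx).differentiableAt.hasFDerivAt
    have h2 : (fun x => (Y x).1) =ᶠ[𝓝 x] fun _ => c := by
      filter_upwards [hU.mem_nhds hx] with z hz using hYc z hz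
    have h3 := h1.unique ((hasFDerivAt_const c x).congr_of_eventuallyEq h2)
    simpa using congrArg (fun L => L v) h3
  rw [VectorField.lieBracket, Prod.fst_sub, hconst hX hX0, hconst hS hSc, sub_zero]

/-- The bracket with `S`, as an operator on fields whose time component vanishes. -/
noncomputable def adOn (hU : IsOpen U) (hS : AnalyticOnNhd ℝ S U) {c : ℝ}
    (hSc : ∀ x ∈ U, (S x).1 = c) : Module.End ℝ (spatialFields U) where
  toFun X := ⟨U.indicator (VectorField.lieBracket ℝ S X), indicator_mem_spatialFields hU
    (fun x hx => analyticAt_lieBracket (hS x hx) (X.2.1 x hx))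
    fun x hx => lieBracket_fst_eq_zero hU hS hSc X.2.1 X.2.2.1 hx⟩
  map_add' X Y := by
    refine Subtype.ext (funext fun x => ?_)
    by_cases hx : x ∈ U
    · simp only [indicator_of_mem hx, Submodule.coe_add, Pi.add_apply]
      exact VectorField.lieBracket_add_right (X.2.1 x hx).differentiableAt
        (Y.2.1 x hx).differentiableAt
    · simp [indicator_of_notMem hx]
  map_smul' r X := by
    refine Subtype.ext (funext fun x => ?_)
    by_cases hx : x ∈ U
    · simp only [indicator_of_mem hx, Submodule.coe_smul, Pi.smul_apply, RingHom.id_apply]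
      exact VectorField.lieBracket_const_smul_right (X.2.1 x hx).differentiableAt
    · simp [indicator_of_notMem hx]

lemma adOn_apply (hU : IsOpen U) (hS : AnalyticOnNhd ℝ S U) {c : ℝ}
    (hSc : ∀ x ∈ U, (S x).1 = c) (X : spatialFields U) {x : Ext n m} (hx : x ∈ U) :
    (adOn hU hS hSc X : Ext n m → Ext n m) x = VectorField.lieBracket ℝ S X x :=
  indicator_of_mem hx _

lemma adOn_pow_apply (hU : IsOpen U) (hS : AnalyticOnNhd ℝ S U) {c : ℝ}
    (hSc : ∀ x ∈ U, (S x).1 = c) {α : Fin m} {z : spatialFields U}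
    (hz : ∀ x ∈ U, (z : Ext n m → Ext n m) x = vert (Pi.single α 1) x) (k : ℕ) :
    ∀ x ∈ U, ((adOn hU hS hSc ^ k) z : Ext n m → Ext n m) x = adField S k α x := by
  induction k with
  | zero => exact hz
  | succ k ih =>
    intro x hx
    rw [pow_succ', Module.End.mul_apply, adOn_apply hU hS hSc _ hx, adField_succ]
    refine EventuallyEq.lieBracket_vectorField_eq (Eventually.of_forall fun _ => rfl) ?_
    filter_upwards [hU.mem_nhds hx] with y hy using ih y hy

/-- Multiplication by `exp (r t)`. -/
noncomputable def expMul (U : Set (Ext n m)) (r : ℝ) : Module.End ℝ (spatialFields U) where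
  toFun X := ⟨fun x => Real.exp (r * x.1) • (X : Ext n m → Ext n m) x,
    fun x hx => AnalyticAt.smul (f := fun x : Ext n m => Real.exp (r * x.1))
      (analyticAt_const.mul analyticAt_fst).rexp (X.2.1 x hx), fun x hx => by simp [X.2.2.1 x hx],
    fun x hx => by simp [X.2.2.2 x hx]⟩
  map_add' X Y := by ext1; funext x; simp
  map_smul' c X := by ext1; funext x; exact smul_comm (Real.exp (r * x.1)) c ((X : Ext n m → Ext n m) x)

lemma expMul_apply (r : ℝ) (X : spatialFields U) (x : Ext n m) :
    (expMul U r X : Ext n m → Ext n m) x = Real.exp (r * x.1) • (X : Ext n m → Ext n m) x := rfl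

lemma hasFDerivAt_exp_time (r : ℝ) (x : Ext n m) :
    HasFDerivAt (fun x : Ext n m => Real.exp (r * x.1))
      ((r * Real.exp (r * x.1)) • ContinuousLinearMap.fst ℝ ℝ ((Fin n → ℝ) × (Fin m → ℝ))) x := by
  have h1 := ((ContinuousLinearMap.fst ℝ ℝ ((Fin n → ℝ) × (Fin m → ℝ))).hasFDerivAt
    (x := x)).const_mul r
  have h2 := h1.exp
  rw [smul_smul, mul_comm] at h2
  exact h2

/-- The factor e^{rt} has the derivative r e^{rt} along S because S has time component 1. This is
the commutation rule that supplies the second parameter r. -/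
lemma adOn_expMul (hU : IsOpen U) (hS : AnalyticOnNhd ℝ S U) (hS1 : ∀ x ∈ U, (S x).1 = 1) (r : ℝ)
    (X : spatialFields U) : adOn hU hS hS1 (expMul U r X) =
      expMul U r (adOn hU hS hS1 X + r • X) := by
  refine Subtype.ext (funext fun x => ?_)
  by_cases hx : x ∈ U
  · rw [adOn_apply hU hS hS1 _ hx, expMul_apply, Submodule.coe_add, Pi.add_apply,
      adOn_apply hU hS hS1 _ hx]
    have h1 : HasFDerivAt (expMul U r X : Ext n m → Ext n m) _ x :=
      (hasFDerivAt_exp_time r x).fun_smul (X.2.1 x hx).differentiableAt.hasFDerivAt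
    simp only [VectorField.lieBracket, h1.fderiv, expMul_apply, add_apply, smul_apply,
      ContinuousLinearMap.smulRight_apply, ContinuousLinearMap.coe_fst', hS1 x hx, map_smul,
      Submodule.coe_smul, Pi.smul_apply, smul_add, smul_sub, smul_eq_mul, mul_one, smul_smul,
      mul_comm r]
    abel
  · simp [expMul_apply, (adOn hU hS hS1 _).2.2.2 x hx, X.2.2.2 x hx]

/-- No derivative of e^{rt} appears, since it would be taken along a field without time component.
This is why the operators act on `spatialFields`. -/
lemma adOn_perturbation (hU : IsOpen U) (hS : AnalyticOnNhd ℝ S U) (hS1 : ∀ x ∈ U, (S x).1 = 1)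
    (hV : AnalyticOnNhd ℝ V U) (hV0 : ∀ x ∈ U, (V x).1 = 0) (c r : ℝ)
    (hS' : AnalyticOnNhd ℝ (fun x => S x + (c * Real.exp (r * x.1)) • V x) U)
    (hS1' : ∀ x ∈ U, (S x + (c * Real.exp (r * x.1)) • V x).1 = 1) :
    adOn hU hS' hS1' = adOn hU hS hS1 + c • (expMul U r * adOn hU hV hV0) := by
  refine LinearMap.ext fun X => Subtype.ext (funext fun x => ?_)
  by_cases hx : x ∈ U
  · rw [adOn_apply hU hS' hS1' _ hx, LinearMap.add_apply, LinearMap.smul_apply,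
      Module.End.mul_apply, Submodule.coe_add, Pi.add_apply, adOn_apply hU hS hS1 _ hx,
      Submodule.coe_smul, Pi.smul_apply, expMul_apply, adOn_apply hU hV hV0 _ hx]
    have h1 : HasFDerivAt (fun x => S x + (c * Real.exp (r * x.1)) • V x) _ x :=
      (hS x hx).differentiableAt.hasFDerivAt.fun_add
        (((hasFDerivAt_exp_time r x).const_mul c).fun_smul (hV x hx).differentiableAt.hasFDerivAt)
    simp only [VectorField.lieBracket, h1.fderiv, add_apply, smul_apply,
      ContinuousLinearMap.smulRight_apply, ContinuousLinearMap.coe_fst', X.2.2.1 x hx, map_smul,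
      map_add, smul_sub, smul_zero, smul_smul, zero_smul, add_zero]
    abel
  · exact ((adOn hU hS' hS1' X).2.2.2 x hx).trans
      (((adOn hU hS hS1 + c • (expMul U r * adOn hU hV hV0)) X).2.2.2 x hx).symm

end Perturbation

/-! ### Generators of the secondary distribution -/

section Generators

variable {n m : ℕ} {f : Ext n m → (Fin n → ℝ)} {K : Set (Fin m → ℝ)} {Ω Ω' U : Set (Ext n m)}
  {S S' : Ext n m → Ext n m} {x₀ : Ext n m}

lemma IsSection.mono (hS : IsSection f K Ω S) (hU : IsOpen U) (h : U ⊆ Ω) : IsSection f K U S :=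
  ⟨hU, h.trans hS.2.1, hS.2.2.1.mono h, fun x hx => hS.2.2.2 x (h hx)⟩

lemma IsSection.add_vertical {V : Ext n m → Ext n m} (hS : IsSection f K Ω S)
    (hV : AnalyticOnNhd ℝ V Ω) (hV0 : ∀ x ∈ Ω, (V x).1 = 0 ∧ (V x).2.1 = 0) :
    IsSection f K Ω fun x => S x + V x :=
  ⟨hS.1, hS.2.1, hS.2.2.1.add hV, fun x hx => by
    simp [hS.2.2.2 x hx, hV0 x hx]⟩

/-- The iterated brackets of the fields `∂/∂w^α` with a single section, for all sections defined
near `x₀`. -/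
def bracketFields (f : Ext n m → (Fin n → ℝ)) (K : Set (Fin m → ℝ)) (x₀ : Ext n m) :
    Set (Ext n m → Ext n m) :=
  {X | ∃ Ω S k α, IsSection f K Ω S ∧ x₀ ∈ Ω ∧ X = adField S k α}

lemma analyticAt_of_mem_bracketFields {X : Ext n m → Ext n m} (hX : X ∈ bracketFields f K x₀) :
    AnalyticAt ℝ X x₀ := by
  obtain ⟨Ω, S, k, α, hS, hx, rfl⟩ := hX
  exact analyticAt_adField (hS.2.2.1 x₀ hx) k α

lemma adField_mem_locSpan (hS : IsSection f K Ω S) (hx : x₀ ∈ Ω) (k : ℕ) (α : Fin m) :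
    (adField S k α : Germ (𝓝 x₀) (Ext n m)) ∈ locSpan x₀ (bracketFields f K x₀) :=
  Submodule.subset_span ⟨_, ⟨Ω, S, k, α, hS, hx, rfl⟩, rfl⟩

/-- Two sections differ by a vertical field V, and S + c e^{rt} V is a section for all c and r. Its
iterated brackets are in the module by definition, and comparing coefficients brings in [V, ad_S^k
∂/∂w]. -/
lemma lieBracket_adField_mem_locSpan (hS : IsSection f K Ω S) (hx : x₀ ∈ Ω)
    (hS' : IsSection f K Ω' S') (hx' : x₀ ∈ Ω') (k : ℕ) (α : Fin m) :
    (VectorField.lieBracket ℝ S' (adField S k α) : Germ (𝓝 x₀) (Ext n m)) ∈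
      locSpan x₀ (bracketFields f K x₀) := by
  set U := Ω ∩ Ω' with hUdef
  have hU : IsOpen U := hS.1.inter hS'.1
  have hxU : x₀ ∈ U := ⟨hx, hx'⟩
  have hSU : IsSection f K U S := hS.mono hU inter_subset_left
  have hSU' : IsSection f K U S' := hS'.mono hU inter_subset_right
  let V : Ext n m → Ext n m := fun x => S' x - S x
  have hV : AnalyticOnNhd ℝ V U := hSU'.2.2.1.sub hSU.2.2.1
  have hV0 : ∀ x ∈ U, (V x).1 = 0 ∧ (V x).2.1 = 0 := fun x hx => by
    simp [V, hSU.2.2.2 x hx, hSU'.2.2.2 x hx]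
  have hpert : ∀ c r : ℝ, IsSection f K U fun x => S x + (c * Real.exp (r * x.1)) • V x :=
    fun c r => hSU.add_vertical (fun x hx => AnalyticAt.smul
      (f := fun x : Ext n m => c * Real.exp (r * x.1))
      (analyticAt_const.mul (analyticAt_const.mul analyticAt_fst).rexp) (hV x hx))
      fun x hx => by simp [hV0 x hx]
  let z : spatialFields U := ⟨U.indicator (vert (Pi.single α 1)),
    indicator_mem_spatialFields hU (fun _ _ => analyticAt_const) fun _ _ => rfl⟩
  have hz : ∀ x ∈ U, (z : Ext n m → Ext n m) x = vert (Pi.single α 1) x := fun x hx =>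
    indicator_of_mem hx _
  let W : Submodule ℝ (spatialFields U) :=
    { carrier := {X | ((X : Ext n m → Ext n m) : Germ (𝓝 x₀) (Ext n m)) ∈
        locSpan x₀ (bracketFields f K x₀)}
      add_mem' := fun {X Y} hX hY => (locSpan x₀ (bracketFields f K x₀)).add_mem hX hY
      zero_mem' := (locSpan x₀ (bracketFields f K x₀)).zero_mem
      smul_mem' := fun c X hX => (locSpan x₀ (bracketFields f K x₀)).smul_mem
        (germOf (fun _ => c) analyticAt_const) hX }
  have hW : ∀ X : spatialFields U, X ∈ W ↔ ((X : Ext n m → Ext n m) : Germ (𝓝 x₀) (Ext n m)) ∈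
      locSpan x₀ (bracketFields f K x₀) := fun _ => Iff.rfl
  have hgerm : ∀ {X Y : Ext n m → Ext n m}, (∀ x ∈ U, X x = Y x) →
      (X : Germ (𝓝 x₀) (Ext n m)) = (Y : Germ (𝓝 x₀) (Ext n m)) := fun h =>
    Germ.coe_eq.2 (by filter_upwards [hU.mem_nhds hxU] with x hx using h x hx)
  -- `locSpan` is a module over analytic germs, so one may multiply by e^{-rt}.
  have hP : ∀ r X, expMul U r X ∈ W → X ∈ W := by
    intro r X hX
    have hexp : AnalyticAt ℝ (fun x : Ext n m => Real.exp (-r * x.1)) x₀ :=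
      (analyticAt_const.mul analyticAt_fst).rexp
    have h1 := (locSpan x₀ (bracketFields f K x₀)).smul_mem (germOf _ hexp) hX
    rw [germOf_smul_coe] at h1
    have h2 : (fun x : Ext n m => Real.exp (-r * x.1) • (expMul U r X : Ext n m → Ext n m) x) =
        (X : Ext n m → Ext n m) := by
      funext x
      rw [expMul_apply, smul_smul, ← Real.exp_add]
      simp
    rwa [h2] at h1
  have hiter : ∀ (c r : ℝ) (k : ℕ), ((adOn hU hSU.2.2.1 (fun x hx => (hSU.2.2.2 x hx).1) +
      c • (expMul U r * adOn hU hV fun x hx => (hV0 x hx).1)) ^ k) z ∈ W := by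
    intro c r k
    rw [← adOn_perturbation hU hSU.2.2.1 (fun x hx => (hSU.2.2.2 x hx).1) hV
      (fun x hx => (hV0 x hx).1) c r (hpert c r).2.2.1 fun x hx => ((hpert c r).2.2.2 x hx).1]
    rw [hW, hgerm (adOn_pow_apply hU (hpert c r).2.2.1 _ hz k)]
    exact adField_mem_locSpan (hpert c r) hxU k α
  have hmem : (VectorField.lieBracket ℝ V (adField S k α) : Germ (𝓝 x₀) (Ext n m)) ∈
      locSpan x₀ (bracketFields f K x₀) := by
    have h1 := apply_pow_mem_of_perturbations _ _ z hP
      (adOn_expMul hU hSU.2.2.1 fun x hx => (hSU.2.2.2 x hx).1) hiter k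
    rw [hW] at h1
    refine (hgerm fun x hx => ?_) ▸ h1
    rw [adOn_apply hU hV _ _ hx]
    refine EventuallyEq.lieBracket_vectorField_eq (Eventually.of_forall fun _ => rfl) ?_
    filter_upwards [hU.mem_nhds hx] with y hy using adOn_pow_apply hU _ _ hz k y hy
  have hsum : (VectorField.lieBracket ℝ S' (adField S k α) : Germ (𝓝 x₀) (Ext n m)) =
      (adField S (k + 1) α : Germ (𝓝 x₀) (Ext n m)) +
        (VectorField.lieBracket ℝ V (adField S k α) : Germ (𝓝 x₀) (Ext n m)) := by
    rw [← Germ.coe_add, adField_succ]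
    refine hgerm fun x hx => ?_
    have h1 : S' = S + V := by funext x; simp [V]
    nth_rewrite 1 [h1]
    exact VectorField.lieBracket_add_left (hSU.2.2.1 x hx).differentiableAt
      (hV x hx).differentiableAt
  rw [hsum]
  exact Submodule.add_mem _ (adField_mem_locSpan hS hx _ _) hmem

/-- Every section is S₀ plus a combination of the ∂/∂w^α with analytic coefficients. Finitely many
relations on U thus control brackets with all sections on U. -/
lemma IterBracket.isCombo {ι : Type*} [Fintype ι] {X : ι → Ext n m → Ext n m}
    {S₀ : Ext n m → Ext n m} (hS₀ : IsSection f K U S₀) (hX : ∀ i, AnalyticOnNhd ℝ (X i) U)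
    (hvert : ∀ α : Fin m, IsCombo X U (vert (Pi.single α 1)))
    (hbr : ∀ i, IsCombo X U (VectorField.lieBracket ℝ S₀ (X i)))
    (hbrv : ∀ (α : Fin m) i, IsCombo X U (VectorField.lieBracket ℝ (vert (Pi.single α 1)) (X i)))
    {Y : Ext n m → Ext n m} (hY : IterBracket f K U Y) : IsCombo X U Y := by
  have hvertical : ∀ {Z : Ext n m → Ext n m}, AnalyticOnNhd ℝ Z U →
      (∀ x ∈ U, (Z x).1 = 0 ∧ (Z x).2.1 = 0) →
      IsCombo (fun α : Fin m => vert (n := n) (Pi.single α 1)) U Z := by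
    intro Z hZ hv
    refine ⟨fun α x => (Z x).2.2 α, fun α x hx => ?_, fun x hx => ?_⟩
    · exact ((ContinuousLinearMap.proj (R := ℝ) (φ := fun _ : Fin m => ℝ) α).analyticAt _).fun_comp
        (analyticAt_snd.fun_comp (analyticAt_snd.fun_comp (hZ x hx)))
    · rw [sum_smul_vert]
      exact Prod.ext (hv x hx).1 (Prod.ext (hv x hx).2 rfl)
  induction hY with
  | vertical Z hZ hv => exact (hvertical hZ hv).trans hvert
  | bracket S Y hS _ ih =>
    refine ih.lieBracket_right hS.1 hX hS.2.2.1 fun i => ?_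
    have hV : AnalyticOnNhd ℝ (fun x => S x - S₀ x) U := hS.2.2.1.sub hS₀.2.2.1
    have h1 : IsCombo X U (VectorField.lieBracket ℝ (fun x => S x - S₀ x) (X i)) := by
      refine IsCombo.lieBracket_left hS.1 (fun α _ _ => analyticAt_const) hvert (hX i)
        (fun α => hbrv α i) (hvertical hV fun x hx => ?_)
      simp [hS.2.2.2 x hx, hS₀.2.2.2 x hx]
    refine ((hbr i).add h1).congr fun x hx => ?_
    have h2 : S = S₀ + fun x => S x - S₀ x := by funext x; simp
    nth_rewrite 1 [h2]
    exact VectorField.lieBracket_add_left (hS₀.2.2.1 x hx).differentiableAt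
      (hV x hx).differentiableAt

/-- The secondary distribution is generated by surrogate fields. -/
theorem exists_generators_secondary (hK : IsOpen K) (hf : AnalyticOnNhd ℝ f (extSpace n K))
    (hx₀ : x₀ ∈ extSpace n K) {δ : ℝ} (hδ : 0 < δ) :
    ∃ U₀ : Set (Ext n m), IsOpen U₀ ∧ x₀ ∈ U₀ ∧ U₀ ⊆ extSpace n K ∧
      ∀ U : Set (Ext n m), IsOpen U → x₀ ∈ U → U ⊆ U₀ →
        ∃ (N : ℕ) (Ω : Fin N → Set (Ext n m)) (S : Fin N → Ext n m → Ext n m) (τ : Fin N → ℝ)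
          (lam : Fin N → (Fin m → ℝ)),
          (∀ i, IsSection f K (Ω i) (S i) ∧ 0 < τ i ∧ τ i < δ ∧
            U ⊆ surrogateDom (Ω i) (S i) (τ i)) ∧
          IsGeneratingTuple (Secondary f K) U
            (fun i => surrogate (Ω i) (S i) (τ i) (lam i)) := by
  let S₀ : Ext n m → Ext n m := fun x => (1, f x, 0)
  have hS₀ : IsSection f K (extSpace n K) S₀ := ⟨isOpen_extSpace hK, Subset.rfl,
    fun x hx => analyticAt_const.prod ((hf x hx).prod analyticAt_const), fun _ _ => ⟨rfl, rfl⟩⟩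
  -- Only surrogates whose germs are analytic combinations of brackets are admitted: pointwise
  -- membership would not place them in the family of fields. There are still enough of them to
  -- generate all brackets.
  let G : Set (Ext n m → Ext n m) := {X | ∃ Ω S τ lam, (IsSection f K Ω S ∧ τ ∈ Ioo 0 δ ∧
    x₀ ∈ surrogateDom Ω S τ ∧ (surrogate Ω S τ lam : Germ (𝓝 x₀) (Ext n m)) ∈
      locSpan x₀ {X | ∃ k α, X = adField S k α}) ∧ X = surrogate Ω S τ lam}
  have hGan : ∀ X ∈ G, AnalyticAt ℝ X x₀ := by
    rintro _ ⟨Ω, S, τ, lam, ⟨hS, -, hdom, -⟩, rfl⟩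
    exact analyticAt_surrogate hS.1 hS.2.2.1 (fun _ _ => analyticAt_const) hdom
  obtain ⟨s, hsG, hspan⟩ := exists_finset_locSpan_eq x₀ G hGan
  let X : Fin s.card → Ext n m → Ext n m := fun i => (s.equivFin.symm i : Ext n m → Ext n m)
  have hrange : range X = (s : Set (Ext n m → Ext n m)) := by
    ext Y
    constructor
    · rintro ⟨i, rfl⟩
      exact (s.equivFin.symm i).2
    · exact fun hY => ⟨s.equivFin ⟨Y, hY⟩, by simp [X]⟩
  have hXG : ∀ i, X i ∈ G := fun i => hsG (s.equivFin.symm i).2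
  choose Ω S τ lam hΩ hXeq using hXG
  have hXeq' : X = fun i => surrogate (Ω i) (S i) (τ i) (lam i) := funext hXeq
  have hle : locSpan x₀ (bracketFields f K x₀) ≤ locSpan x₀ (range X) := by
    rw [hrange, ← hspan]
    refine Submodule.span_le.2 ?_
    rintro _ ⟨_, ⟨Ω, S, k, α, hS, hx, rfl⟩, rfl⟩
    obtain ⟨N, τ, lam, -, hτ, hsur, had⟩ := exists_surrogates_locSpan hS.1 hS.2.2.1 hx hδ
    refine Submodule.span_mono (image_mono ?_) (had k α)
    rintro _ ⟨i, rfl⟩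
    exact ⟨Ω, S, τ i, lam i, ⟨hS, (hτ i).1, (hτ i).2, hsur i⟩, rfl⟩
  have hΩx : ∀ i, x₀ ∈ Ω i := fun i => (hΩ i).2.2.1.choose_spec.mem_left
  have hXspan : ∀ i, (X i : Germ (𝓝 x₀) (Ext n m)) ∈ locSpan x₀ (bracketFields f K x₀) := by
    intro i
    rw [hXeq i]
    refine Submodule.span_mono (image_mono ?_) (hΩ i).2.2.2
    rintro _ ⟨k, α, rfl⟩
    exact ⟨Ω i, S i, k, α, (hΩ i).1, hΩx i, rfl⟩
  have hbr : ∀ {T : Ext n m → Ext n m}, IsSection f K (extSpace n K) T → ∀ Y ∈ bracketFields f K x₀,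
      (VectorField.lieBracket ℝ T Y : Germ (𝓝 x₀) (Ext n m)) ∈ locSpan x₀ (range X) := by
    rintro T hT _ ⟨Ω, S, k, α, hS, hx, rfl⟩
    exact hle (lieBracket_adField_mem_locSpan hS hx hT hx₀ k α)
  -- The field ∂/∂w^α is not a section, but it is the difference of the two sections S₀ + ∂/∂w^α and
  -- S₀.
  have hbrv : ∀ α : Fin m, ∀ Y ∈ bracketFields f K x₀,
      (VectorField.lieBracket ℝ (vert (Pi.single α 1)) Y : Germ (𝓝 x₀) (Ext n m)) ∈
        locSpan x₀ (range X) := by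
    intro α Y hY
    have hT : IsSection f K (extSpace n K) fun x => S₀ x + vert (Pi.single α 1) x :=
      hS₀.add_vertical (fun _ _ => analyticAt_const) fun _ _ => ⟨rfl, rfl⟩
    have h1 := Submodule.sub_mem _ (hbr hT Y hY) (hbr hS₀ Y hY)
    rw [← Germ.coe_sub] at h1
    refine (Germ.coe_eq.2 ?_) ▸ h1
    filter_upwards [(isOpen_extSpace hK).mem_nhds hx₀] with x hx
    rw [Pi.sub_apply, sub_eq_iff_eq_add']
    exact VectorField.lieBracket_add_left (hS₀.2.2.1 x hx).differentiableAt
      (differentiableAt_const _)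
  have hcl : ∀ {T : Ext n m → Ext n m}, AnalyticAt ℝ T x₀ → (∀ Y ∈ bracketFields f K x₀,
      (VectorField.lieBracket ℝ T Y : Germ (𝓝 x₀) (Ext n m)) ∈ locSpan x₀ (range X)) → ∀ i,
      (VectorField.lieBracket ℝ T (X i) : Germ (𝓝 x₀) (Ext n m)) ∈ locSpan x₀ (range X) :=
    fun hT h i => lieBracket_mem_locSpan hT (fun _ hY => analyticAt_of_mem_bracketFields hY)
      (fun Y hY => hle (Submodule.subset_span ⟨Y, hY, rfl⟩)) h (hXspan i)
  have hdom : ∀ i, ∀ᶠ U in (𝓝 x₀).smallSets, U ⊆ surrogateDom (Ω i) (S i) (τ i) := fun i =>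
    eventually_smallSets_subset.2
      ((isOpen_flowDom (hΩ i).1.1 (hΩ i).1.2.2.1).mem_nhds (hΩ i).2.2.1)
  obtain ⟨V, hV, hVU⟩ := eventually_smallSets.1
    (((eventually_smallSets_subset.2 ((isOpen_extSpace hK).mem_nhds hx₀)).and
      (eventually_all.2 hdom)).and
      ((eventually_all.2 fun i => exists_isCombination (hΩ i).2.2.2).and
        ((eventually_all.2 fun α : Fin m => eventually_isCombo
          (hle (adField_mem_locSpan hS₀ hx₀ 0 α))).and
          ((eventually_all.2 fun i => eventually_isCombo
            (hcl (hS₀.2.2.1 x₀ hx₀) (hbr hS₀) i)).and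
          (eventually_all.2 fun α : Fin m => eventually_all.2 fun i => eventually_isCombo
            (hcl analyticAt_const (hbrv α) i))))))
  refine ⟨interior V, isOpen_interior, mem_interior_iff_mem_nhds.2 hV,
    (hVU _ interior_subset).1.1, fun U hU hxU hUV => ?_⟩
  obtain ⟨-, hUsur, -⟩ := hVU U (hUV.trans interior_subset)
  have hUdom : ∀ i, U ⊆ surrogateDom (Ω i) (S i) (τ i) :=
    (hVU U (hUV.trans interior_subset)).1.2
  refine ⟨_, Ω, S, τ, lam, fun i => ⟨(hΩ i).1, (hΩ i).2.1.1, (hΩ i).2.1.2, hUdom i⟩, fun i => ?_,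
    fun U' hU' hU'U Y hY => ?_⟩
  · obtain ⟨M, Z, g, hZ, hg, hsum⟩ := hUsur i
    refine ⟨M, Z, g, fun j => ?_, hg, hsum⟩
    obtain ⟨k, α, hj⟩ := hZ j
    rw [mem_ofPred_eq, hj]
    exact iterBracket_adField ((hΩ i).1.mono hU fun x hx =>
      (hUdom i hx).choose_spec.mem_left) k α
  -- The set U' need not contain x₀; the finitely many relations hold on every subset of V.
  · obtain ⟨⟨hU'K, hU'dom⟩, -, hvert, hbr', hbrv'⟩ :=
      hVU U' ((hU'U.trans hUV).trans interior_subset)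
    obtain ⟨M, Z, g, hZ, hg, hsum⟩ := hY
    have hXan : ∀ i, AnalyticOnNhd ℝ (X i) U' := fun i x hx => by
      rw [hXeq i]
      exact analyticAt_surrogate (hΩ i).1.1 (hΩ i).1.2.2.1 (fun _ _ => analyticAt_const)
        (hU'dom i hx)
    have h1 : IsCombo X U' Y := IsCombo.trans (W := Z) ⟨g, hg, hsum⟩ fun j =>
      (hZ j).isCombo (hS₀.mono hU' hU'K) hXan hvert hbr' hbrv'
    rwa [hXeq'] at h1

end Generators

end CtrlSys

theorem theoremA {n m : ℕ} (K : Set (Fin m → ℝ)) (hK : IsOpen K) (hKc : IsConnected K)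
    (f : Ext n m → (Fin n → ℝ)) (hf : AnalyticOnNhd ℝ f (extSpace n K))
    (T : ℝ) (hT : 0 < T) (xo yo : Ext n m) (hyo : yo ∈ Attain f K T xo)
    (c : ℝ) (q : ℝ → (Fin n → ℝ)) (w : ℝ → (Fin m → ℝ)) (hfin : IsFinalArc f K xo yo c q w)
    (δT : ℝ) (hδ : 0 < δT) (hδT : δT < T) (hc : c ≤ yo.1 - δT) :
    -- there are sections having the last part of the solution as an integral curve
    (∃ Ω S, IsAdaptedSection f K q w (yo.1 - δT) yo.1 Ω S) ∧
    -- (1) composed flows of their surrogate fields, with decreasing depths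
    (∀ Ω S, IsAdaptedSection f K q w (yo.1 - δT) yo.1 Ω S →
      ∀ (p : ℕ) (lam : Fin p → (Fin m → ℝ)) (τ : Fin p → ℝ),
        StrictAnti τ → (∀ j, 0 < τ j ∧ τ j < δT) →
        (∃ ε : Fin p → ℝ, (∀ j, 0 < ε j) ∧
          ∀ s : Fin p → ℝ, (∀ j, |s j| < ε j) →
            ∃ y, IsComposite (fun j => surrogateDom Ω S (τ j))
              (fun j => surrogate Ω S (τ j) (lam j)) s yo y) ∧
        (∀ (s : Fin p → ℝ) (y : Ext n m),
          IsComposite (fun j => surrogateDom Ω S (τ j))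
            (fun j => surrogate Ω S (τ j) (lam j)) s yo y → y ∈ Attain f K T xo)) ∧
    -- (2) surrogate fields take values in the secondary distribution
    (∀ Ω S, IsSection f K Ω S → ∀ τ : ℝ, 0 < τ → τ < T → ∀ lam : Fin m → ℝ,
      ∀ y ∈ surrogateDom Ω S τ,
        surrogate Ω S τ lam y ∈ fibre K (Secondary f K) y ∧
        surrogate Ω S τ lam y ∈ fibre K (SecondaryOf S) y) ∧
    -- (3) near `yo` the secondary distribution is generated by surrogate fields
    (∃ U₀ : Set (Ext n m), IsOpen U₀ ∧ yo ∈ U₀ ∧ U₀ ⊆ extSpace n K ∧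
      ∀ U : Set (Ext n m), IsOpen U → yo ∈ U → U ⊆ U₀ →
        ∃ (N : ℕ) (Ω : Fin N → Set (Ext n m)) (S : Fin N → Ext n m → Ext n m) (τ : Fin N → ℝ)
          (lam : Fin N → (Fin m → ℝ)),
          (∀ i, IsSection f K (Ω i) (S i) ∧ 0 < τ i ∧ τ i < δT ∧
            U ⊆ surrogateDom (Ω i) (S i) (τ i)) ∧
          IsGeneratingTuple (Secondary f K) U
            (fun i => surrogate (Ω i) (S i) (τ i) (lam i))) ∧
    -- (3') the same for a single section and the iterated brackets with it
    (∀ Ω S, IsSection f K Ω S → yo ∈ Ω →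
      ∃ U₀ : Set (Ext n m), IsOpen U₀ ∧ yo ∈ U₀ ∧ U₀ ⊆ Ω ∧
        ∀ U : Set (Ext n m), IsOpen U → yo ∈ U → U ⊆ U₀ →
          ∃ (N : ℕ) (τ : Fin N → ℝ) (lam : Fin N → (Fin m → ℝ)),
            StrictAnti τ ∧
            (∀ i, 0 < τ i ∧ τ i < δT ∧ U ⊆ surrogateDom Ω S (τ i)) ∧
            IsGeneratingTuple (SecondaryOf S) U (fun i => surrogate Ω S (τ i) (lam i))) := by
  have hfin' := hfin
  obtain ⟨k, v, -, -, -, rfl, -, -, hw, hq, -, -⟩ := hfin'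
  refine ⟨?_, fun Ω S hS p lam τ hanti hτ => ⟨exists_isComposite_surrogate hfin hS lam hτ,
    fun s y h => mem_attain_of_isComposite hyo.1 hfin hc hδ hS hanti hτ h⟩,
    fun Ω S hS τ h0 _ lam y hy => surrogate_mem_fibre hS h0.le lam hy, ?_, ?_⟩
  · exact exists_isAdaptedSection hK hf (fun t ht => hw t ⟨hc.trans ht.1, ht.2⟩)
      fun t ht => hq t ⟨hc.trans ht.1, ht.2⟩
  · refine exists_generators_secondary hK hf ?_ hδ
    have hfin' := hfin
    obtain ⟨k, v, -, -, -, -, hlt, -, -, hq, -, hy⟩ := hfin'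
    rw [hy]
    exact (hq _ ⟨hlt.le, le_rfl⟩).1
  · exact fun Ω S hS hx => exists_generators_secondaryOf hS.1 hS.2.2.1 hx hδ
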